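/- Work over $\mathbb C$. All vector spaces are complex, and $\delta(x)=\sum_{n\in\mathbb Z}x^n$. A weak quantum vertex algebra is a vector space $V$ with a vector $\mathbf 1$ and a linear map $Y(\cdot,x):V\to \mathrm{Hom}(V,V((x)))$, $Y(v,x)=\sum_{n\in\mathbb Z}v_nx^{-n-1}$, such that $Y(\mathbf 1,x)v=v$, $Y(v,x)\mathbf 1\in V[[x]]$ and $\lim_{x\to0}Y(v,x)\mathbf 1=v$ for all $v\in V$, and such that for all $u,v\in V$ there is $\sum_{i=1}^r v^{(i)}\otimes u^{(i)}\otimes f_i(x)\in V\otimes V\otimes\mathbb C((x))$ with $$x_0^{-1}\delta\Big(\frac{x_1-x_2}{x_0}\Big)Y(u,x_1)Y(v,x_2)-x_0^{-1}\delta\Big(\frac{x_2-x_1}{-x_0}\Big)\sum_{i=1}^r f_i(-x_0)Y(v^{(i)},x_2)Y(u^{(i)},x_1)=x_2^{-1}\delta\Big(\frac{x_1-x_0}{x_2}\Big)Y(Y(u,x_0)v,x_2),\qquad(*)$$ where powers of a binomial are expanded in nonnegative powers of its second term. $V$ is nondegenerate if for every $n\ge1$ the linear map $Z_n:V^{\otimes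 n}\otimes\mathbb C((x_1))\cdots((x_n))\to V((x_1))\cdots((x_n))$, $Z_n(u_1\otimes\cdots\otimes u_n\otimes f)=f\,Y(u_1,x_1)\cdots Y(u_n,x_n)\mathbf 1$, is injective. A quantum vertex algebra is a weak quantum vertex algebra $V$ equipped with a unitary rational quantum Yang–Baxter operator, that is, a linear map $\mathcal S(x):V\otimes V\to V\otimes V\otimes\mathbb C((x))$ with $\mathcal S_{21}(-x)\mathcal S(x)=1$ and $\mathcal S_{12}(x)\mathcal S_{13}(x+z)\mathcal S_{23}(z)=\mathcal S_{23}(z)\mathcal S_{13}(x+z)\mathcal S_{12}(x)$ (with $f(x+z)$ expanded in nonnegative powers of $z$), such that for all $u,v\in V$ the identity $(*)$ holds with $\sum_i v^{(i)}\otimes u^{(i)}\otimes f_i(x)=\mathcal S(x)(v\otimes u)$. For a vector space $U$, let $FCD(U)=S(\mathbb C[\partial]\otimes U)$ be the free commutative differential algebra over $U$ (the symmetric algebra, with the derivation $\partial$ extending multiplication by $\partial$), viewed as a vertex algebra with vacuum $1$ and $Y(a,x)b=(e^{x\partial}a)b$. **Corollary.** Let $V$ be a weak quantum vertex algebra of countable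 dimension over $\mathbb C$. Assume that there is an increasing filtration $E=\{E_n\}_{n\ge0}$ of $V$ by subspaces, with $\bigcup_nE_n=V$, $\mathbf 1\in E_0$ and $u_kv\in E_{m+n}$ for all $u\in E_m$, $v\in E_n$, $m,n\ge 0$, $k\in\mathbb Z$, such that the associated graded structure $\mathrm{gr}_E(V)=\bigoplus_{n\ge0}E_n/E_{n-1}$ (where $E_{-1}=0$), with vacuum $\mathbf 1+E_{-1}$ and products $(u+E_{m-1})_k(v+E_{n-1})=u_kv+E_{m+n-1}$, is isomorphic to $FCD(U)$ for some vector space $U$, by a linear bijection which preserves the vacuum and all products $a_kb$, $k\in\mathbb Z$. Then $V$ is nondegenerate, and there is exactly one linear map $\mathcal S(x):V\otimes V\to V\otimes V\otimes\mathbb C((x))$ for which $(V,\mathcal S)$ is a quantum vertex algebra. -/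

import Mathlib

open scoped TensorProduct

noncomputable section

namespace QVA

universe u v w

/-! ## Vertex-algebra-like structures over `ℂ` -/

/-- A vector space `V` with a vacuum vector `𝟏` and a linear map
`Y(·,x) : V → Hom(V, V((x)))`, `Y(u,x)v = ∑ₙ (uₙ v) x^{-n-1}`, recorded through the `n`-products
`prod n u v = uₙ v`; `trunc` says that `Y(u,x)v` lies in `V((x))`. No axiom is imposed here. -/
structure VertexData (V : Type u) [AddCommGroup V] [Module ℂ V] where
  prod : ℤ → V →ₗ[ℂ] V →ₗ[ℂ] V
  vac : V
  trunc : ∀ a b : V, ∃ N : ℤ, ∀ n : ℤ, N ≤ n → prod n a b = 0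

/-- An isomorphism: a linear bijection which preserves the vacuum and all `n`-products. -/
structure VertexIso {V : Type u} [AddCommGroup V] [Module ℂ V] {W : Type v} [AddCommGroup W]
    [Module ℂ W] (A : VertexData V) (B : VertexData W) where
  toEquiv : V ≃ₗ[ℂ] W
  map_vac : toEquiv A.vac = B.vac
  map_prod : ∀ (n : ℤ) (a b : V), toEquiv (A.prod n a b) = B.prod n (toEquiv a) (toEquiv b)

section Basic

variable {V : Type u} [AddCommGroup V] [Module ℂ V]

/-- `V ⊗ V ⊗ ℂ((x))`. -/
abbrev TwoTensorLaurent (V : Type u) [AddCommGroup V] [Module ℂ V] : Type u :=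
  (V ⊗[ℂ] V) ⊗[ℂ] LaurentSeries ℂ

/-- The coefficient of `x₀^{-p-1} x₁^{-q-1} x₂^{-r-1}` in
`x₀⁻¹ δ((x₁-x₂)/x₀) Y(a,x₁) Y(b,x₂) c = ∑ₚ x₀^{-p-1} (x₁-x₂)^p Y(a,x₁) Y(b,x₂) c`
(powers of `x₁-x₂` are expanded in nonnegative powers of `x₂`). -/
def VertexData.jacobiFirst (A : VertexData V) (a b c : V) (p q r : ℤ) : V :=
  ∑ᶠ i : ℕ, ((-1 : ℤ) ^ i * Ring.choose p i) • A.prod (p + q - i) a (A.prod (r + i) b c)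

/-- The coefficient of `x₀^{-p-1} x₁^{-q-1} x₂^{-r-1}` in
`x₀⁻¹ δ((x₂-x₁)/(-x₀)) f(-x₀) Y(b,x₂) Y(a,x₁) c`, that is, in
`∑ₚ (-1)^p x₀^{-p-1} (x₂-x₁)^p f(x₂-x₁) Y(b,x₂) Y(a,x₁) c`
(powers of `x₂-x₁` are expanded in nonnegative powers of `x₁`). In the sum, `j` runs over the
exponents of `f(x) = ∑ⱼ fⱼ x^j`. Only finitely many terms are nonzero. -/
def VertexData.jacobiSecond (A : VertexData V) (b a : V) (f : LaurentSeries ℂ) (c : V)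
    (p q r : ℤ) : V :=
  ((p.negOnePow : ℤˣ) : ℤ) • ∑ᶠ k : ℕ × ℤ,
    (((((-1 : ℤ) ^ k.1 * Ring.choose (p + k.2) k.1 : ℤ) : ℂ)) * f.coeff k.2) •
      A.prod (p + r + k.2 - k.1) b (A.prod (q + k.1) a c)

/-- The coefficient of `x₀^{-p-1} x₁^{-q-1} x₂^{-r-1}` in
`x₂⁻¹ δ((x₁-x₀)/x₂) Y(Y(a,x₀)b,x₂) c = x₁⁻¹ δ((x₂+x₀)/x₁) Y(Y(a,x₀)b,x₂) c
  = ∑_q x₁^{-q-1} (x₂+x₀)^q Y(Y(a,x₀)b,x₂) c`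
(powers of `x₂+x₀` are expanded in nonnegative powers of `x₀`). -/
def VertexData.jacobiThird (A : VertexData V) (a b c : V) (p q r : ℤ) : V :=
  ∑ᶠ i : ℕ, (Ring.choose q i) • A.prod (q + r - i) (A.prod (p + i) a b) c

/-- The `𝒮`-Jacobi identity for `a, b` and the tensor
`s = ∑ᵢ b⁽ⁱ⁾ ⊗ a⁽ⁱ⁾ ⊗ fᵢ(x) ∈ V ⊗ V ⊗ ℂ((x))`:
`x₀⁻¹ δ((x₁-x₂)/x₀) Y(a,x₁)Y(b,x₂) - x₀⁻¹ δ((x₂-x₁)/(-x₀)) ∑ᵢ fᵢ(-x₀) Y(b⁽ⁱ⁾,x₂)Y(a⁽ⁱ⁾,x₁)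
  = x₂⁻¹ δ((x₁-x₀)/x₂) Y(Y(a,x₀)b,x₂)`,
as an equality of all coefficients, applied to every vector `c`. -/
def VertexData.SJacobi (A : VertexData V) (a b : V) (s : TwoTensorLaurent V) : Prop :=
  ∃ (m : ℕ) (b' a' : Fin m → V) (f : Fin m → LaurentSeries ℂ),
    s = ∑ i, (b' i ⊗ₜ[ℂ] a' i) ⊗ₜ[ℂ] f i ∧
    ∀ (c : V) (p q r : ℤ),
      A.jacobiFirst a b c p q r - ∑ i, A.jacobiSecond (b' i) (a' i) (f i) c p q r
        = A.jacobiThird a b c p q r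

/-- Weak quantum vertex algebras: `Y(𝟏,x)v = v`, `Y(v,x)𝟏 ∈ V[[x]]` with constant term `v`, and
the `𝒮`-Jacobi identity holds for all `a, b` with some tensor in `V ⊗ V ⊗ ℂ((x))`. -/
structure VertexData.IsWeakQuantumVertexAlgebra (A : VertexData V) : Prop where
  vac_left : ∀ (n : ℤ) (a : V), A.prod n A.vac a = if n = -1 then a else 0
  creation_regular : ∀ (n : ℤ) (a : V), 0 ≤ n → A.prod n a A.vac = 0
  creation : ∀ a : V, A.prod (-1) a A.vac = a
  sJacobi : ∀ a b : V, ∃ s : TwoTensorLaurent V, A.SJacobi a b s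

/-! ## Nondegeneracy -/

/-- Exponents `(e₁,…,eₙ)` of monomials in `x₁,…,xₙ`, ordered lexicographically with the exponent
of `xₙ` being the most significant one. A set of exponents is well ordered iff the exponents of `xₙ`
in it are bounded below, for each exponent of `xₙ` those of `x_{n-1}` are bounded below, and so on.
So Hahn series over this ordered group are the iterated Laurent series in `((x₁))⋯((xₙ))`. -/
abbrev Expo (n : ℕ) : Type := Lex ((Fin n)ᵒᵈ → ℤ)

/-- The field `ℂ((x₁))((x₂))⋯((xₙ))`. -/
abbrev IterLaurent (n : ℕ) : Type := HahnSeries (Expo n) ℂ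

/-- The `ℂ((x₁))⋯((xₙ))`-vector space `V((x₁))((x₂))⋯((xₙ))`. -/
abbrev IterLaurentModule (n : ℕ) (V : Type u) [AddCommGroup V] [Module ℂ V] : Type u :=
  HahnModule (Expo n) ℂ V

/-- The coefficient of `x₁^{e₁} ⋯ xₙ^{eₙ}` in `Y(a₁,x₁) ⋯ Y(aₙ,xₙ) 𝟏`. -/
def VertexData.correlator (A : VertexData V) : (n : ℕ) → (Fin n → V) → (Fin n → ℤ) → V
  | 0, _, _ => A.vac
  | n + 1, a, e => A.prod (-e 0 - 1) (a 0) (A.correlator n (Fin.tail a) (Fin.tail e))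

theorem VertexData.correlator_bound (A : VertexData V) : ∀ (n : ℕ) (a : Fin n → V) (i : Fin n)
    (g : Fin n → ℤ), ∃ B : ℤ, ∀ e : Fin n → ℤ, (∀ j, i < j → e j = g j) →
      A.correlator n a e ≠ 0 → B ≤ e i := by
  intro n
  induction n with
  | zero => intro _ i; exact i.elim0
  | succ n ih =>
    intro a i g
    refine Fin.cases ?_ (fun i => ?_) i
    · obtain ⟨N, hN⟩ := A.trunc (a 0) (A.correlator n (Fin.tail a) (Fin.tail g))
      refine ⟨-N, fun e he h => ?_⟩
      by_contra hlt
      apply h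
      have ht : Fin.tail e = Fin.tail g := by
        funext j
        exact he j.succ (Fin.succ_pos j)
      simp only [VertexData.correlator, ht]
      exact hN _ (by omega)
    · obtain ⟨B, hB⟩ := ih (Fin.tail a) i (Fin.tail g)
      refine ⟨B, fun e he h => ?_⟩
      refine hB (Fin.tail e) (fun j hj => he j.succ (Fin.succ_lt_succ_iff.mpr hj)) ?_
      intro h0
      apply h
      simp [VertexData.correlator, h0]

theorem expo_isPWO {n : ℕ} (s : Set (Expo n))
    (hs : ∀ (i : Fin n) (g : Fin n → ℤ), ∃ B : ℤ, ∀ e ∈ s,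
      (∀ j, i < j → ofLex e (OrderDual.toDual j) = g j) → B ≤ ofLex e (OrderDual.toDual i)) :
    s.IsPWO := by
  rw [Set.isPWO_iff_isWF, Set.isWF_iff_no_descending_seq]
  intro f hf hfs
  have key : ∀ k : ℕ, k ≤ n → ∃ N, ∀ m, N ≤ m → ∀ j : Fin n, n - k ≤ (j : ℕ) →
      ofLex (f m) (OrderDual.toDual j) = ofLex (f N) (OrderDual.toDual j) := by
    intro k
    induction k with
    | zero => intro _; exact ⟨0, fun m _ j hj => absurd j.2 (by omega)⟩
    | succ k ih =>
      intro hk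
      obtain ⟨N, hN⟩ := ih (by omega)
      let i : Fin n := ⟨n - (k + 1), by omega⟩
      obtain ⟨B, hB⟩ := hs i (fun j => ofLex (f N) (OrderDual.toDual j))
      have hB' : ∀ m, N ≤ m → B ≤ ofLex (f m) (OrderDual.toDual i) := fun m hm =>
        hB _ (hfs m) (fun j hj => hN m hm j (by
          have : n - (k + 1) < (j : ℕ) := hj
          omega))
      have hanti : ∀ m m', N ≤ m → m ≤ m' →
          ofLex (f m') (OrderDual.toDual i) ≤ ofLex (f m) (OrderDual.toDual i) := by
        intro m m' hm hmm'
        rcases hmm'.eq_or_lt with rfl | hlt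
        · exact le_rfl
        obtain ⟨l, hl, hl'⟩ := hf hlt
        rcases lt_trichotomy (OrderDual.ofDual l) i with h | h | h
        · exact (hl (OrderDual.toDual i) h).le
        · have : l = OrderDual.toDual i := congrArg OrderDual.toDual h
          subst this
          exact hl'.le
        · exfalso
          have h1 := hN m hm (OrderDual.ofDual l) (by
            have : n - (k + 1) < ((OrderDual.ofDual l : Fin n) : ℕ) := h
            omega)
          have h2 := hN m' (hm.trans hmm') (OrderDual.ofDual l) (by
            have : n - (k + 1) < ((OrderDual.ofDual l : Fin n) : ℕ) := h
            omega)
          have h3 : ofLex (f m') l < ofLex (f m) l := hl'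
          have h4 : ofLex (f m') l = ofLex (f m) l := h2.trans h1.symm
          omega
      obtain ⟨b, ⟨m₀, hm₀, rfl⟩, hmin⟩ := Int.exists_least_of_bdd
        (P := fun b => ∃ m, N ≤ m ∧ ofLex (f m) (OrderDual.toDual i) = b)
        ⟨B, by rintro z ⟨m, hm, rfl⟩; exact hB' m hm⟩ ⟨_, N, le_rfl, rfl⟩
      refine ⟨m₀, fun m hm j hj => ?_⟩
      rcases (show n - (k + 1) ≤ (j : ℕ) from hj).eq_or_lt with h | h
      · have hji : j = i := Fin.ext h.symm
        subst hji
        exact le_antisymm (hanti m₀ m hm₀ hm) (hmin _ ⟨m, hm₀.trans hm, rfl⟩)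
      · rw [hN m (hm₀.trans hm) j (by omega), hN m₀ hm₀ j (by omega)]
  obtain ⟨N, hN⟩ := key n le_rfl
  have heq : f (N + 1) = f N := by
    apply ofLex.injective
    funext j
    exact hN (N + 1) (by omega) (OrderDual.ofDual j) (by omega)
  exact (hf (Nat.lt_succ_self N)).ne heq

theorem VertexData.correlator_update_add (A : VertexData V) : ∀ (n : ℕ) (a : Fin n → V)
    (i : Fin n) (x y : V) (e : Fin n → ℤ),
    A.correlator n (Function.update a i (x + y)) e =
      A.correlator n (Function.update a i x) e + A.correlator n (Function.update a i y) e := by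
  intro n
  induction n with
  | zero => intro _ i; exact i.elim0
  | succ n ih =>
    intro a i x y e
    refine Fin.cases ?_ (fun i => ?_) i
    · simp [VertexData.correlator]
    · have h0 : ∀ z, Function.update a i.succ z 0 = a 0 := fun z =>
        Function.update_of_ne (Fin.succ_ne_zero i).symm _ _
      simp [VertexData.correlator, h0, ih]

theorem VertexData.correlator_update_smul (A : VertexData V) : ∀ (n : ℕ) (a : Fin n → V)
    (i : Fin n) (t : ℂ) (x : V) (e : Fin n → ℤ),
    A.correlator n (Function.update a i (t • x)) e =
      t • A.correlator n (Function.update a i x) e := by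
  intro n
  induction n with
  | zero => intro _ i; exact i.elim0
  | succ n ih =>
    intro a i t x e
    refine Fin.cases ?_ (fun i => ?_) i
    · simp [VertexData.correlator]
    · have h0 : ∀ z, Function.update a i.succ z 0 = a 0 := fun z =>
        Function.update_of_ne (Fin.succ_ne_zero i).symm _ _
      simp [VertexData.correlator, h0, ih]

/-- The series `Y(a₁,x₁) ⋯ Y(aₙ,xₙ) 𝟏 ∈ V((x₁))⋯((xₙ))`. -/
def VertexData.correlatorSeries (A : VertexData V) (n : ℕ) (a : Fin n → V) :
    HahnSeries (Expo n) V where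
  coeff e := A.correlator n a (fun i => ofLex e (OrderDual.toDual i))
  isPWO_support' := by
    apply expo_isPWO
    intro i g
    obtain ⟨B, hB⟩ := A.correlator_bound n a i g
    exact ⟨B, fun e he hj => hB _ hj he⟩

/-- `(a₁,…,aₙ) ↦ Y(a₁,x₁) ⋯ Y(aₙ,xₙ) 𝟏` as a multilinear map. -/
def VertexData.correlatorMap (A : VertexData V) (n : ℕ) :
    MultilinearMap ℂ (fun _ : Fin n => V) (IterLaurentModule n V) :=
  MultilinearMap.mk' (fun a => HahnModule.of ℂ (A.correlatorSeries n a))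
    (fun a i x y => by
      apply (HahnModule.of ℂ).symm.injective
      ext e
      exact A.correlator_update_add n a i x y _)
    (fun a i t x => by
      apply (HahnModule.of ℂ).symm.injective
      ext e
      exact A.correlator_update_smul n a i t x _)

/-- The linear map `Zₙ : V^{⊗n} ⊗ ℂ((x₁))⋯((xₙ)) → V((x₁))⋯((xₙ))`,
`Zₙ(a₁ ⊗ ⋯ ⊗ aₙ ⊗ f) = f Y(a₁,x₁) ⋯ Y(aₙ,xₙ) 𝟏`. -/
def VertexData.Z (A : VertexData V) (n : ℕ) :
    (⨂[ℂ] _ : Fin n, V) ⊗[ℂ] IterLaurent n →ₗ[ℂ] IterLaurentModule n V :=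
  TensorProduct.lift (LinearMap.mk₂ ℂ
    (fun t f => f • (PiTensorProduct.lift (A.correlatorMap n) t : IterLaurentModule n V))
    (fun t t' f => by rw [map_add, smul_add])
    (fun c t f => by rw [map_smul, ← smul_comm])
    (fun t f f' => by rw [add_smul])
    (fun c t f => by rw [smul_assoc]))

/-- Nondegeneracy: `Zₙ` is injective for every positive integer `n`. -/
def VertexData.Nondegenerate (A : VertexData V) : Prop :=
  ∀ n : ℕ, 0 < n → Function.Injective (A.Z n)

/-! ## Quantum Yang–Baxter operators and quantum vertex algebras -/

/-- `ℂ((x))((z))`. -/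
abbrev TwoVarLaurent : Type := LaurentSeries (LaurentSeries ℂ)

theorem laurent_smul_eq (c : ℂ) (f : LaurentSeries ℂ) :
    c • f = (HahnSeries.single 0 c : LaurentSeries ℂ) * f :=
  HahnSeries.single_zero_mul_eq_smul.symm

theorem twoVar_smul_eq (c : ℂ) (f : TwoVarLaurent) :
    c • f = (HahnSeries.single 0 (HahnSeries.single 0 c) : TwoVarLaurent) * f := by
  apply HahnSeries.ext
  funext n
  rw [HahnSeries.coeff_smul, laurent_smul_eq, HahnSeries.coeff_single_zero_mul]

instance : IsScalarTower ℂ (LaurentSeries ℂ) (LaurentSeries ℂ) :=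
  ⟨fun c f g => by
    rw [smul_eq_mul, smul_eq_mul, laurent_smul_eq, laurent_smul_eq, mul_assoc]⟩

instance : SMulCommClass ℂ (LaurentSeries ℂ) (LaurentSeries ℂ) :=
  ⟨fun c f g => by
    rw [smul_eq_mul, smul_eq_mul, laurent_smul_eq, laurent_smul_eq, mul_left_comm]⟩

instance : IsScalarTower ℂ TwoVarLaurent TwoVarLaurent :=
  ⟨fun c f g => by
    rw [smul_eq_mul, smul_eq_mul, twoVar_smul_eq, twoVar_smul_eq]
    exact mul_assoc (G := TwoVarLaurent) _ _ _⟩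

instance : SMulCommClass ℂ TwoVarLaurent TwoVarLaurent :=
  ⟨fun c f g => by
    rw [smul_eq_mul, smul_eq_mul, twoVar_smul_eq, twoVar_smul_eq]
    exact mul_left_comm (G := TwoVarLaurent) _ _ _⟩

/-- The `R`-linear extension `N ⊗ R → M ⊗ R` of a linear map `T : N → M ⊗ R`:
`n ⊗ r ↦ r T(n)`. -/
def extendScalars {N : Type u} {M : Type v} {R : Type w} [AddCommGroup N] [Module ℂ N]
    [AddCommGroup M] [Module ℂ M] [CommRing R] [Module ℂ R] [IsScalarTower ℂ R R]
    [SMulCommClass ℂ R R] (T : N →ₗ[ℂ] M ⊗[ℂ] R) :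
    N ⊗[ℂ] R →ₗ[ℂ] M ⊗[ℂ] R :=
  LinearMap.lTensor M (LinearMap.mul' ℂ R) ∘ₗ
    (TensorProduct.assoc ℂ M R R).toLinearMap ∘ₗ LinearMap.rTensor R T

/-- `f(x) ↦ f(-x)`. -/
def negVar : LaurentSeries ℂ →ₗ[ℂ] LaurentSeries ℂ where
  toFun f :=
    { coeff := fun n => ((n.negOnePow : ℤˣ) : ℤ) • f.coeff n
      isPWO_support' := f.isPWO_support.mono (fun n hn h => hn (by
        show ((n.negOnePow : ℤˣ) : ℤ) • f.coeff n = 0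
        rw [h, smul_zero])) }
  map_add' f g := by ext n; simp
  map_smul' c f := by ext n; simp [mul_left_comm]

/-- `S₂₁(-x) = P S(-x) P`, with `P` the flip of the two tensor factors `V`. -/
def opposite (S : V ⊗[ℂ] V →ₗ[ℂ] TwoTensorLaurent V) : V ⊗[ℂ] V →ₗ[ℂ] TwoTensorLaurent V :=
  TensorProduct.map (TensorProduct.comm ℂ V V).toLinearMap negVar ∘ₗ S ∘ₗ
    (TensorProduct.comm ℂ V V).toLinearMap

/-- Unitarity: `S₂₁(-x) S(x) = 1`. -/
def IsUnitaryOperator (S : V ⊗[ℂ] V →ₗ[ℂ] TwoTensorLaurent V) : Prop :=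
  ∀ t : V ⊗[ℂ] V, extendScalars (opposite S) (S t) = t ⊗ₜ[ℂ] (1 : LaurentSeries ℂ)

/-- `f(x) ↦ f(x) ∈ ℂ((x))((z))`. -/
def inX : LaurentSeries ℂ →ₗ[ℂ] TwoVarLaurent where
  toFun f := HahnSeries.single 0 f
  map_add' f g := by simp
  map_smul' c f := by
    apply HahnSeries.ext
    funext n
    by_cases h : n = 0
    · subst h; simp
    · simp [HahnSeries.coeff_single_of_ne h]

/-- `f(x) ↦ f(z) ∈ ℂ((x))((z))`. -/
def inZ : LaurentSeries ℂ →ₗ[ℂ] TwoVarLaurent where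
  toFun f := f.map (HahnSeries.C : ℂ →+* LaurentSeries ℂ)
  map_add' f g := by
    apply HahnSeries.ext
    funext n
    simp
  map_smul' c f := by
    apply HahnSeries.ext
    funext n
    rw [RingHom.id_apply, HahnSeries.coeff_smul, HahnSeries.map_coeff, HahnSeries.map_coeff,
      HahnSeries.coeff_smul, smul_eq_mul, map_mul, HahnSeries.C_mul_eq_smul]

/-- `f(x) ↦ f(x+z) = ∑_{k ≥ 0} (1/k!) f^{(k)}(x) z^k ∈ ℂ((x))((z))`. -/
def inXplusZ : LaurentSeries ℂ →ₗ[ℂ] TwoVarLaurent where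
  toFun f := HahnSeries.ofPowerSeries ℤ (LaurentSeries ℂ)
    (PowerSeries.mk fun k => LaurentSeries.hasseDeriv ℂ k f)
  map_add' f g := by
    rw [← map_add]; congr 1; ext k : 1; simp
  map_smul' c f := by
    apply HahnSeries.ext
    funext n
    rw [RingHom.id_apply, HahnSeries.coeff_smul]
    rcases lt_or_ge n 0 with hn | hn
    · have hr : n ∉ Set.range ((Nat.castOrderEmbedding : ℕ ↪o ℤ)) := by
        rintro ⟨m, hm⟩
        simp at hm
        omega
      rw [HahnSeries.ofPowerSeries_apply, HahnSeries.ofPowerSeries_apply,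
        HahnSeries.embDomain_of_notMem_range hr, HahnSeries.embDomain_of_notMem_range hr,
        smul_zero]
    · lift n to ℕ using hn
      simp [HahnSeries.ofPowerSeries_apply_coeff]

/-- `V ⊗ V ⊗ V`. -/
abbrev ThreeTensor (V : Type u) [AddCommGroup V] [Module ℂ V] : Type u := (V ⊗[ℂ] V) ⊗[ℂ] V

/-- `S₁₂` with the variable substituted by `σ : ℂ((x)) → ℂ((x))((z))`. -/
def leg12 (S : V ⊗[ℂ] V →ₗ[ℂ] TwoTensorLaurent V) (σ : LaurentSeries ℂ →ₗ[ℂ] TwoVarLaurent) :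
    ThreeTensor V →ₗ[ℂ] ThreeTensor V ⊗[ℂ] TwoVarLaurent :=
  (TensorProduct.rightComm ℂ (V ⊗[ℂ] V) TwoVarLaurent V).toLinearMap ∘ₗ
    LinearMap.rTensor V (LinearMap.lTensor (V ⊗[ℂ] V) σ ∘ₗ S)

/-- `S₁₃`: conjugate `S₁₂` by the flip of the second and third tensor factors. -/
def leg13 (S : V ⊗[ℂ] V →ₗ[ℂ] TwoTensorLaurent V) (σ : LaurentSeries ℂ →ₗ[ℂ] TwoVarLaurent) :
    ThreeTensor V →ₗ[ℂ] ThreeTensor V ⊗[ℂ] TwoVarLaurent :=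
  LinearMap.rTensor TwoVarLaurent (TensorProduct.rightComm ℂ V V V).toLinearMap ∘ₗ
    leg12 S σ ∘ₗ (TensorProduct.rightComm ℂ V V V).toLinearMap

/-- `S₂₃` with the variable substituted by `σ`. -/
def leg23 (S : V ⊗[ℂ] V →ₗ[ℂ] TwoTensorLaurent V) (σ : LaurentSeries ℂ →ₗ[ℂ] TwoVarLaurent) :
    ThreeTensor V →ₗ[ℂ] ThreeTensor V ⊗[ℂ] TwoVarLaurent :=
  LinearMap.rTensor TwoVarLaurent (TensorProduct.assoc ℂ V V V).symm.toLinearMap ∘ₗ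
    (TensorProduct.assoc ℂ V (V ⊗[ℂ] V) TwoVarLaurent).symm.toLinearMap ∘ₗ
    LinearMap.lTensor V (LinearMap.lTensor (V ⊗[ℂ] V) σ ∘ₗ S) ∘ₗ
    (TensorProduct.assoc ℂ V V V).toLinearMap

/-- The quantum Yang–Baxter equation
`S₁₂(x) S₁₃(x+z) S₂₃(z) = S₂₃(z) S₁₃(x+z) S₁₂(x)` on `V ⊗ V ⊗ V`. -/
def IsYangBaxterOperator (S : V ⊗[ℂ] V →ₗ[ℂ] TwoTensorLaurent V) : Prop :=
  extendScalars (R := TwoVarLaurent) (leg12 S inX) ∘ₗ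
      extendScalars (R := TwoVarLaurent) (leg13 S inXplusZ) ∘ₗ leg23 S inZ =
    extendScalars (R := TwoVarLaurent) (leg23 S inZ) ∘ₗ
      extendScalars (R := TwoVarLaurent) (leg13 S inXplusZ) ∘ₗ leg12 S inX

/-- `(V, S)` is a quantum vertex algebra: `V` is a weak quantum vertex algebra, `S` is a unitary
rational quantum Yang–Baxter operator on `V`, and the `𝒮`-Jacobi identity holds for all `a, b` with
the tensor `S(x)(b ⊗ a)`. -/
structure VertexData.IsQuantumVertexAlgebra (A : VertexData V)
    (S : V ⊗[ℂ] V →ₗ[ℂ] TwoTensorLaurent V) : Prop where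
  weak : A.IsWeakQuantumVertexAlgebra
  unitary : IsUnitaryOperator S
  yangBaxter : IsYangBaxterOperator S
  sJacobi : ∀ a b : V, A.SJacobi a b (S (b ⊗ₜ[ℂ] a))

/-! ## Filtrations and the associated graded structure -/

/-- An increasing exhaustive filtration of `V` with `E_n = 0` for `n < 0`, with `𝟏 ∈ E₀`, and
compatible with all `n`-products. -/
structure VertexData.IsFiltration (A : VertexData V) (E : ℤ → Submodule ℂ V) : Prop where
  mono : Monotone E
  exhaustive : ∀ a : V, ∃ n, a ∈ E n
  neg : ∀ n : ℤ, n < 0 → E n = ⊥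
  vac_mem : A.vac ∈ E 0
  prod_mem : ∀ (m n k : ℤ) (a b : V), a ∈ E m → b ∈ E n → A.prod k a b ∈ E (m + n)

/-- `E_n / E_{n-1}`. -/
def GrPiece (E : ℤ → Submodule ℂ V) (n : ℤ) : Type u :=
  E n ⧸ (E (n - 1)).comap (E n).subtype

instance (E : ℤ → Submodule ℂ V) (n : ℤ) : AddCommGroup (GrPiece E n) :=
  inferInstanceAs (AddCommGroup (E n ⧸ (E (n - 1)).comap (E n).subtype))

instance (E : ℤ → Submodule ℂ V) (n : ℤ) : Module ℂ (GrPiece E n) :=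
  inferInstanceAs (Module ℂ (E n ⧸ (E (n - 1)).comap (E n).subtype))

/-- The projection `E_n → E_n / E_{n-1}`. -/
def GrPiece.mk (E : ℤ → Submodule ℂ V) (n : ℤ) : E n →ₗ[ℂ] GrPiece E n :=
  ((E (n - 1)).comap (E n).subtype).mkQ

theorem GrPiece.mk_surjective (E : ℤ → Submodule ℂ V) (n : ℤ) :
    Function.Surjective (GrPiece.mk E n) :=
  Submodule.mkQ_surjective _

theorem GrPiece.mk_eq_zero (E : ℤ → Submodule ℂ V) (n : ℤ) (a : E n) :
    GrPiece.mk E n a = 0 ↔ (a : V) ∈ E (n - 1) :=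
  Submodule.Quotient.mk_eq_zero ((E (n - 1)).comap (E n).subtype)

/-- The map on `E_n / E_{n-1}` induced by a linear map on `E_n` which vanishes on `E_{n-1}`. -/
def GrPiece.lift (E : ℤ → Submodule ℂ V) (n : ℤ) {W : Type v} [AddCommGroup W] [Module ℂ W]
    (T : E n →ₗ[ℂ] W) (hT : ∀ a : E n, (a : V) ∈ E (n - 1) → T a = 0) : GrPiece E n →ₗ[ℂ] W :=
  Submodule.liftQ ((E (n - 1)).comap (E n).subtype) T fun a ha => hT a ha

@[simp]
theorem GrPiece.lift_mk (E : ℤ → Submodule ℂ V) (n : ℤ) {W : Type v} [AddCommGroup W]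
    [Module ℂ W] (T : E n →ₗ[ℂ] W) (hT : ∀ a : E n, (a : V) ∈ E (n - 1) → T a = 0) (a : E n) :
    GrPiece.lift E n T hT (GrPiece.mk E n a) = T a :=
  rfl

/-- `gr_E(V) = ⨁ₙ E_n / E_{n-1}`. -/
abbrev Gr (E : ℤ → Submodule ℂ V) : Type u := DirectSum ℤ (GrPiece E)

/-- The class `a + E_{n-1}`, in degree `n` of `gr_E(V)`, of an element `a` of `E_n`. -/
def grClass (E : ℤ → Submodule ℂ V) (n : ℤ) : E n →ₗ[ℂ] Gr E :=
  DirectSum.lof ℂ ℤ (GrPiece E) n ∘ₗ GrPiece.mk E n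

theorem grClass_eq_zero (E : ℤ → Submodule ℂ V) (n : ℤ) (a : E n) (h : (a : V) ∈ E (n - 1)) :
    grClass E n a = 0 := by
  simp [grClass, (GrPiece.mk_eq_zero E n a).mpr h]

variable {A : VertexData V} {E : ℤ → Submodule ℂ V}

/-- `(a, b) ↦ a_k b + E_{m+n-1}` on `E_m × E_n`. -/
def grProdPre (hE : A.IsFiltration E) (k m n : ℤ) : E m →ₗ[ℂ] E n →ₗ[ℂ] Gr E :=
  LinearMap.mk₂ ℂ
    (fun a b => grClass E (m + n) ⟨A.prod k a b, hE.prod_mem m n k a b a.2 b.2⟩)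
    (fun a a' b => by rw [← map_add]; congr 1; ext; simp)
    (fun c a b => by rw [← map_smul]; congr 1; ext; simp)
    (fun a b b' => by rw [← map_add]; congr 1; ext; simp)
    (fun c a b => by rw [← map_smul]; congr 1; ext; simp)

theorem grProdPre_eq_zero (hE : A.IsFiltration E) (k m n : ℤ) (a : E m) (b : E n)
    (h : A.prod k a b ∈ E (m + n - 1)) : grProdPre hE k m n a b = 0 :=
  grClass_eq_zero E (m + n) ⟨A.prod k a b, hE.prod_mem m n k a b a.2 b.2⟩ h

/-- `(a, b + E_{n-1}) ↦ a_k b + E_{m+n-1}`. -/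
def grProdHalf (hE : A.IsFiltration E) (k m n : ℤ) : E m →ₗ[ℂ] GrPiece E n →ₗ[ℂ] Gr E where
  toFun a := GrPiece.lift E n (grProdPre hE k m n a) fun b hb =>
    grProdPre_eq_zero hE k m n a b (by
      have := hE.prod_mem m (n - 1) k a b a.2 hb
      rwa [← add_sub_assoc] at this)
  map_add' a a' := by
    apply LinearMap.ext
    intro b
    obtain ⟨b, rfl⟩ := GrPiece.mk_surjective E n b
    simp
  map_smul' c a := by
    apply LinearMap.ext
    intro b
    obtain ⟨b, rfl⟩ := GrPiece.mk_surjective E n b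
    simp

/-- `(a + E_{m-1}, b + E_{n-1}) ↦ a_k b + E_{m+n-1}`. -/
def grProdPiece (hE : A.IsFiltration E) (k m n : ℤ) :
    GrPiece E m →ₗ[ℂ] GrPiece E n →ₗ[ℂ] Gr E :=
  GrPiece.lift E m (grProdHalf hE k m n) fun a ha => by
    apply LinearMap.ext
    intro b
    obtain ⟨b, rfl⟩ := GrPiece.mk_surjective E n b
    exact grProdPre_eq_zero hE k m n a b (by
      have := hE.prod_mem (m - 1) n k a b ha b.2
      rwa [sub_add_eq_add_sub] at this)

/-- The `k`-th product of `gr_E(V)`. -/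
def grProd (hE : A.IsFiltration E) (k : ℤ) : Gr E →ₗ[ℂ] Gr E →ₗ[ℂ] Gr E :=
  DirectSum.toModule ℂ ℤ _ fun m =>
    (DirectSum.toModule ℂ ℤ _ fun n => (grProdPiece hE k m n).flip).flip

theorem grProd_class (hE : A.IsFiltration E) (k m n : ℤ) (a : E m) (b : E n) :
    grProd hE k (grClass E m a) (grClass E n b) =
      grClass E (m + n) ⟨A.prod k a b, hE.prod_mem m n k a b a.2 b.2⟩ := by
  simp [grProd, grClass, grProdPiece, grProdHalf, grProdPre]

theorem gr_induction {P : Gr E → Prop} (h0 : P 0) (hc : ∀ n (a : E n), P (grClass E n a))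
    (ha : ∀ a b, P a → P b → P (a + b)) (a : Gr E) : P a := by
  induction a using DirectSum.induction_on with
  | zero => exact h0
  | of n a =>
    obtain ⟨a, rfl⟩ := GrPiece.mk_surjective E n a
    exact hc n a
  | add a b h h' => exact ha a b h h'

/-- The structure of `gr_E(V)`: the vacuum is `𝟏 + E_{-1}`, and
`(a + E_{m-1})_k (b + E_{n-1}) = a_k b + E_{m+n-1}`. -/
def grData (hE : A.IsFiltration E) : VertexData (Gr E) where
  prod := grProd hE
  vac := grClass E 0 ⟨A.vac, hE.vac_mem⟩
  trunc := by
    intro a b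
    induction a using gr_induction with
    | h0 => exact ⟨0, by simp⟩
    | ha a a' h h' =>
      obtain ⟨N, hN⟩ := h
      obtain ⟨N', hN'⟩ := h'
      refine ⟨max N N', fun n hn => ?_⟩
      rw [map_add, LinearMap.add_apply, hN n (le_trans (le_max_left _ _) hn),
        hN' n (le_trans (le_max_right _ _) hn), add_zero]
    | hc m a =>
      induction b using gr_induction with
      | h0 => exact ⟨0, by simp⟩
      | ha b b' h h' =>
        obtain ⟨N, hN⟩ := h
        obtain ⟨N', hN'⟩ := h'
        refine ⟨max N N', fun n hn => ?_⟩
        rw [map_add, hN n (le_trans (le_max_left _ _) hn),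
          hN' n (le_trans (le_max_right _ _) hn), add_zero]
      | hc n b =>
        obtain ⟨N, hN⟩ := A.trunc a b
        refine ⟨N, fun k hk => ?_⟩
        rw [grProd_class]
        apply grClass_eq_zero
        simp [hN k hk]

end Basic

/-! ## Free commutative differential algebras -/

/-- A commutative algebra `R` with a derivation `d`, viewed as a vertex algebra:
`𝟏 = 1` and `Y(a,x)b = (e^{xd} a) b`, that is, `a_n b = 0` for `n ≥ 0` and
`a_{-k-1} b = (1/k!) d^k(a) b` for `k ≥ 0`. -/
def ofDifferentialAlgebra {R : Type u} [CommRing R] [Algebra ℂ R] (d : Derivation ℂ R R) :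
    VertexData R where
  prod n := if 0 ≤ n then 0 else
    (((-n - 1).toNat.factorial : ℂ)⁻¹) •
      LinearMap.mul ℂ R ∘ₗ ((d : R →ₗ[ℂ] R) ^ (-n - 1).toNat)
  vac := 1
  trunc _ _ := ⟨0, fun n hn => by simp [hn]⟩

/-- The unique derivation of the symmetric algebra `S(M)` extending a linear map `M → M`. -/
def symDerivation {M : Type u} [AddCommGroup M] [Module ℂ M] (D : M →ₗ[ℂ] M) :
    Derivation ℂ (SymmetricAlgebra ℂ M) (SymmetricAlgebra ℂ M) :=
  let S := SymmetricAlgebra ℂ M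
  let Φ : S →ₐ[ℂ] TrivSqZeroExt S S := SymmetricAlgebra.lift
    ((TrivSqZeroExt.inlAlgHom ℂ S S).toLinearMap ∘ₗ SymmetricAlgebra.ι ℂ M +
      (TrivSqZeroExt.inrHom S S).restrictScalars ℂ ∘ₗ SymmetricAlgebra.ι ℂ M ∘ₗ D)
  have hΦ : ∀ a, (Φ a).fst = a := fun a => by
    have : (TrivSqZeroExt.fstHom ℂ S S).comp Φ = AlgHom.id ℂ S := by
      apply SymmetricAlgebra.algHom_ext
      ext m
      simp [Φ, S]
    exact DFunLike.congr_fun this a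
  Derivation.mk' ((TrivSqZeroExt.sndHom S S).restrictScalars ℂ ∘ₗ Φ.toLinearMap) fun a b => by
    simp [hΦ, mul_comm]

theorem symDerivation_ι {M : Type u} [AddCommGroup M] [Module ℂ M] (D : M →ₗ[ℂ] M) (m : M) :
    symDerivation D (SymmetricAlgebra.ι ℂ M m) = SymmetricAlgebra.ι ℂ M (D m) := by
  simp [symDerivation]

/-- The underlying space `S(ℂ[∂] ⊗ U)` of the free commutative differential algebra over `U`. -/
abbrev FCD (U : Type u) [AddCommGroup U] [Module ℂ U] : Type u :=
  SymmetricAlgebra ℂ (Polynomial ℂ ⊗[ℂ] U)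

/-- The derivation `∂` of `FCD(U)`, which extends multiplication by `∂` on `ℂ[∂] ⊗ U`. -/
def FCD.partialD (U : Type u) [AddCommGroup U] [Module ℂ U] :
    Derivation ℂ (FCD U) (FCD U) :=
  symDerivation (LinearMap.rTensor U (LinearMap.mulLeft ℂ (Polynomial.X : Polynomial ℂ)))

/-- `FCD(U)`, viewed as a vertex algebra. -/
def FCD.data (U : Type u) [AddCommGroup U] [Module ℂ U] : VertexData (FCD U) :=
  ofDifferentialAlgebra (FCD.partialD U)

end QVA

end

/-!
Nondegeneracy is proved first for `FCD(U)` and then carried to `V` along the filtration. A linear map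
`U → ℂ[x]` extends to a homomorphism of differential algebras `FCD(U) → (ℂ[x], d/dx)`; followed by
evaluation at `0` it sends the correlator `Y(a₁,x₁) ⋯ Y(aₙ,xₙ) 1` to a product of polynomials in one
variable each. A relation over `ℂ((x₁))⋯((xₙ))` between correlators of independent vectors thus gives
relations between such products, whose coefficients may be taken to be polynomials
(`exists_relation_of_relation`). At a point with distinct coordinates, Hermite interpolation realizes
all tuples of characters of `FCD(U)` in this way (`FCD.exists_toPolynomial_eval`), and characters
separate points; so the relation is trivial (`FCD.linearIndependent_correlatorMap`). A basis of `V`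
adapted to the filtration has correlators whose leading terms are those of `gr_E(V)`
(`exists_basis_linearIndependent`), and this gives the injectivity of `Zₙ`
(`VertexData.nondegenerate_of_basis`).

The operator `𝒮` is governed by the correlators of three vectors. By locality and the creation
property, every matrix coefficient of `Y(a,x₁) Y(b,x₂) Y(c,x₃) 𝟏` is the expansion of an element of
`ℂ[[x₁,x₂,x₃]]` with the differences `xᵢ - xⱼ` inverted (`VertexData.threePoint_mem_range`), a ring on
which permutations of the variables act. In these terms the `𝒮`-Jacobi identity says that exchanging
two neighbouring operators amounts to applying `𝒮` and exchanging the two variables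
(`VertexData.corr_left`, `VertexData.corr_right`). By linear independence of the correlators for
`n = 3`, the matrix coefficients separate the tensors (`VertexData.eq_of_corrExt`). Hence the tensor in
the `𝒮`-Jacobi identity is unique, and it depends linearly on the two vectors
(`VertexData.SJacobi.unique`, `VertexData.exists_linear_sJacobi`). Exchanging two operators twice gives
unitarity, and reversing the order of three operators in two ways gives the Yang–Baxter equation in
the variables `x₁ - x₂`, `x₁ - x₃`, `x₂ - x₃`; the substitution `x₁ = x + z`, `x₂ = z`, `x₃ = 0`,
which makes sense in `ℂ((x))((z))`, turns it into the equation required.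
-/

open scoped TensorProduct

noncomputable section

namespace QVA

universe u v w

/-! ### Iterated Laurent series -/

theorem finsum_eq_of_support_subset_range {α β M : Type*} [AddCommMonoid M] (f : α → M)
    {g : β → α} (hg : Function.Injective g) (h : Function.support f ⊆ Set.range g) :
    ∑ᶠ a, f a = ∑ᶠ b, f (g b) := by
  rw [← finsum_mem_range hg, finsum_mem_def]
  refine finsum_congr fun a => ?_
  rw [Set.indicator_eq_self.mpr h]

section HahnModule

variable {Γ : Type*} [AddCommGroup Γ] [LinearOrder Γ] [IsOrderedAddMonoid Γ]
  {V : Type*} [AddCommGroup V] [Module ℂ V] {W : Type*} [AddCommGroup W] [Module ℂ W]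

theorem HahnSeries.coeff_mul_eq_finsum (x y : HahnSeries Γ ℂ) (a : Γ) :
    (x * y).coeff a = ∑ᶠ u, x.coeff u * y.coeff (a - u) := by
  classical
  rw [HahnSeries.coeff_mul]
  rw [finsum_eq_sum_of_support_subset (s := (Finset.antidiagonal x.isPWO_support
    y.isPWO_support a).image Prod.fst)]
  · rw [Finset.sum_image]
    · refine Finset.sum_congr rfl fun p hp => ?_
      rw [Finset.mem_antidiagonal] at hp
      rw [← hp.2.2, add_sub_cancel_left]
    · intro p hp q hq h
      simp only [Finset.mem_coe, Finset.mem_antidiagonal] at hp hq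
      refine Prod.ext h ?_
      have := hp.2.2.trans hq.2.2.symm
      rw [h] at this
      exact add_left_cancel this
  · intro u hu
    rw [Function.mem_support] at hu
    rw [Finset.mem_coe, Finset.mem_image]
    refine ⟨(u, a - u), ?_, rfl⟩
    rw [Finset.mem_antidiagonal]
    exact ⟨left_ne_zero_of_mul hu, right_ne_zero_of_mul hu, add_sub_cancel _ _⟩

variable (Γ) in
/-- Applying a linear map to the coefficients is linear over the Hahn series. -/
def hahnMap (T : V →ₗ[ℂ] W) : HahnModule Γ ℂ V →ₗ[HahnSeries Γ ℂ] HahnModule Γ ℂ W where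
  toFun x := HahnModule.of ℂ (((HahnModule.of ℂ).symm x).map T)
  map_add' x y := by
    apply (HahnModule.of ℂ).symm.injective
    ext e
    simp
  map_smul' f x := by
    apply (HahnModule.of ℂ).symm.injective
    ext e
    rw [RingHom.id_apply, HahnModule.coeff_smul_right ((HahnModule.of ℂ).symm x).isPWO_support]
    · rw [Equiv.symm_apply_apply, HahnSeries.map_coeff, HahnModule.coeff_smul, map_sum]
      simp
    · intro a ha h
      apply ha
      simp [h]

@[simp]
theorem hahnMap_coeff (T : V →ₗ[ℂ] W) (x : HahnModule Γ ℂ V) (e : Γ) :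
    ((HahnModule.of ℂ).symm (hahnMap Γ T x)).coeff e = T (((HahnModule.of ℂ).symm x).coeff e) :=
  rfl

variable (Γ) in
/-- Applying a linear functional to the coefficients. -/
def hahnPair (T : V →ₗ[ℂ] ℂ) : HahnModule Γ ℂ V →ₗ[HahnSeries Γ ℂ] HahnSeries Γ ℂ where
  toFun x := ((HahnModule.of ℂ).symm x).map T
  map_add' x y := by
    ext e
    simp
  map_smul' f x := congrArg (HahnModule.of ℂ).symm ((hahnMap Γ T).map_smul f x)

@[simp]
theorem hahnPair_coeff (T : V →ₗ[ℂ] ℂ) (x : HahnModule Γ ℂ V) (e : Γ) :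
    (hahnPair Γ T x).coeff e = T (((HahnModule.of ℂ).symm x).coeff e) :=
  rfl

/-- Linear functionals, applied coefficientwise, separate the elements of a Hahn module. -/
theorem eq_zero_of_hahnPair (x : HahnModule Γ ℂ V) (h : ∀ T : V →ₗ[ℂ] ℂ, hahnPair Γ T x = 0) :
    x = 0 := by
  apply (HahnModule.of ℂ).symm.injective
  ext e
  refine (Module.forall_dual_apply_eq_zero_iff ℂ _).mp ?_
  intro T
  rw [← hahnPair_coeff, h T, HahnSeries.coeff_zero]

end HahnModule

/-- The exponent with given entries. -/
def expoOf {n : ℕ} : (Fin n → ℤ) ≃+ Expo n where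
  toFun g := toLex fun i => g (OrderDual.ofDual i)
  invFun e i := ofLex e (OrderDual.toDual i)
  left_inv _ := rfl
  right_inv _ := rfl
  map_add' _ _ := rfl

/-- The exponents of a monomial in `ℂ[[x₁,…,xₙ]]`. -/
def natExpo {n : ℕ} (m : Fin n →₀ ℕ) : Expo n := expoOf fun i => (m i : ℤ)

theorem natExpo_injective {n : ℕ} : Function.Injective (natExpo (n := n)) := by
  intro m m' h
  ext i
  have := congrFun (expoOf.injective h) i
  exact_mod_cast this

theorem natExpo_add {n : ℕ} (m m' : Fin n →₀ ℕ) : natExpo (m + m') = natExpo m + natExpo m' := by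
  simp only [natExpo, ← map_add]
  congr 1

theorem mem_range_natExpo {n : ℕ} (g : Fin n → ℤ) :
    expoOf g ∈ Set.range (natExpo (n := n)) ↔ ∀ i, 0 ≤ g i := by
  constructor
  · rintro ⟨m, hm⟩ i
    rw [← expoOf.injective hm]
    exact Int.natCast_nonneg _
  · intro h
    refine ⟨Finsupp.equivFunOnFinite.symm fun i => (g i).toNat, ?_⟩
    rw [natExpo]
    congr 1
    funext i
    simpa using h i

/-- The series with coefficients those of a power series, as an element of the field of iterated
Laurent series. -/
def powerToIterFun {n : ℕ} (F : MvPowerSeries (Fin n) ℂ) : IterLaurent n where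
  coeff := Function.extend natExpo (fun m => MvPowerSeries.coeff m F) 0
  isPWO_support' := by
    apply expo_isPWO
    intro i g
    refine ⟨0, fun e he _ => ?_⟩
    by_contra hlt
    apply he
    apply Function.extend_apply'
    intro hm
    exact hlt ((mem_range_natExpo (expoOf.symm e)).mp hm i)

theorem powerToIterFun_coeff {n : ℕ} (F : MvPowerSeries (Fin n) ℂ) (m : Fin n →₀ ℕ) :
    (powerToIterFun F).coeff (natExpo m) = MvPowerSeries.coeff m F :=
  natExpo_injective.extend_apply _ _ _

theorem powerToIterFun_coeff_of_notMem {n : ℕ} (F : MvPowerSeries (Fin n) ℂ) (e : Expo n)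
    (he : e ∉ Set.range (natExpo (n := n))) : (powerToIterFun F).coeff e = 0 :=
  Function.extend_apply' _ _ _ he

theorem powerToIterFun_mul_coeff {n : ℕ} (F : MvPowerSeries (Fin n) ℂ) (W : IterLaurent n)
    (e : Expo n) : (powerToIterFun F * W).coeff e =
      ∑ᶠ m : Fin n →₀ ℕ, MvPowerSeries.coeff m F * W.coeff (e - natExpo m) := by
  rw [HahnSeries.coeff_mul_eq_finsum, finsum_eq_of_support_subset_range _ natExpo_injective]
  · simp only [powerToIterFun_coeff]
  · intro u hu
    by_contra h
    exact hu (by simp only [powerToIterFun_coeff_of_notMem F u h, zero_mul])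

/-- The embedding `ℂ[[x₁,…,xₙ]] → ℂ((x₁))⋯((xₙ))`. -/
def powerToIter (n : ℕ) : MvPowerSeries (Fin n) ℂ →+* IterLaurent n where
  toFun := powerToIterFun
  map_zero' := by
    ext e
    by_cases h : e ∈ Set.range (natExpo (n := n))
    · obtain ⟨m, rfl⟩ := h
      simp [powerToIterFun_coeff]
    · simp [powerToIterFun_coeff_of_notMem _ e h]
  map_one' := by
    classical
    ext e
    rw [HahnSeries.coeff_one]
    have h0 : natExpo (0 : Fin n →₀ ℕ) = 0 := rfl
    by_cases h : e ∈ Set.range (natExpo (n := n))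
    · obtain ⟨m, rfl⟩ := h
      rw [powerToIterFun_coeff, MvPowerSeries.coeff_one]
      simp only [← h0, natExpo_injective.eq_iff]
    · rw [powerToIterFun_coeff_of_notMem _ e h, if_neg]
      rintro rfl
      exact h ⟨0, h0⟩
  map_add' F G := by
    ext e
    by_cases h : e ∈ Set.range (natExpo (n := n))
    · obtain ⟨m, rfl⟩ := h
      simp [powerToIterFun_coeff]
    · simp [powerToIterFun_coeff_of_notMem _ e h]
  map_mul' F G := by
    classical
    ext e
    rw [powerToIterFun_mul_coeff]
    have key : ∀ m : Fin n →₀ ℕ, (powerToIterFun G).coeff (e - natExpo m) ≠ 0 →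
        ∃ m', natExpo (m + m') = e ∧
          (powerToIterFun G).coeff (e - natExpo m) = MvPowerSeries.coeff m' G := by
      intro m hm
      by_cases h : e - natExpo m ∈ Set.range (natExpo (n := n))
      · obtain ⟨m', hm'⟩ := h
        refine ⟨m', ?_, ?_⟩
        · rw [natExpo_add, hm', add_sub_cancel]
        · rw [← hm', powerToIterFun_coeff]
      · exact absurd (powerToIterFun_coeff_of_notMem _ _ h) hm
    by_cases h : e ∈ Set.range (natExpo (n := n))
    · obtain ⟨d, rfl⟩ := h
      rw [powerToIterFun_coeff, MvPowerSeries.coeff_mul]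
      rw [finsum_eq_sum_of_support_subset (s := (Finset.HasAntidiagonal.antidiagonal d).image Prod.fst)]
      · rw [Finset.sum_image]
        · refine Finset.sum_congr rfl fun p hp => ?_
          rw [← Finset.HasAntidiagonal.mem_antidiagonal.mp hp, natExpo_add, add_sub_cancel_left,
            powerToIterFun_coeff]
        · intro p hp q hq h
          have hp' := Finset.HasAntidiagonal.mem_antidiagonal.mp hp
          have hq' := Finset.HasAntidiagonal.mem_antidiagonal.mp hq
          refine Prod.ext h ?_
          rw [← hq', h] at hp'
          exact add_left_cancel hp'
      · intro m hm
        obtain ⟨m', hm', _⟩ := key m (right_ne_zero_of_mul hm)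
        rw [Finset.mem_coe, Finset.mem_image]
        exact ⟨(m, m'), Finset.HasAntidiagonal.mem_antidiagonal.mpr (natExpo_injective hm'), rfl⟩
    · rw [powerToIterFun_coeff_of_notMem _ e h, finsum_eq_zero_of_forall_eq_zero]
      intro m
      by_contra hm
      obtain ⟨m', hm', _⟩ := key m (right_ne_zero_of_mul hm)
      exact h ⟨_, hm'⟩

theorem powerToIter_coeff {n : ℕ} (F : MvPowerSeries (Fin n) ℂ) (m : Fin n →₀ ℕ) :
    (powerToIter n F).coeff (natExpo m) = MvPowerSeries.coeff m F :=
  powerToIterFun_coeff F m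

theorem powerToIter_coeff_of_notMem {n : ℕ} (F : MvPowerSeries (Fin n) ℂ) (e : Expo n)
    (he : e ∉ Set.range (natExpo (n := n))) : (powerToIter n F).coeff e = 0 :=
  powerToIterFun_coeff_of_notMem F e he

theorem powerToIter_mul_coeff {n : ℕ} (F : MvPowerSeries (Fin n) ℂ) (W : IterLaurent n)
    (e : Expo n) : (powerToIter n F * W).coeff e =
      ∑ᶠ m : Fin n →₀ ℕ, MvPowerSeries.coeff m F * W.coeff (e - natExpo m) :=
  powerToIterFun_mul_coeff F W e

theorem powerToIter_injective (n : ℕ) : Function.Injective (powerToIter n) := by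
  intro F G h
  ext m
  rw [← powerToIter_coeff, h, powerToIter_coeff]

theorem mem_range_powerToIter {n : ℕ} (f : IterLaurent n)
    (h : ∀ e, e ∉ Set.range (natExpo (n := n)) → f.coeff e = 0) :
    f ∈ Set.range (powerToIter n) := by
  let F : MvPowerSeries (Fin n) ℂ := fun m => f.coeff (natExpo m)
  refine ⟨F, ?_⟩
  ext e
  by_cases he : e ∈ Set.range (natExpo (n := n))
  · obtain ⟨m, rfl⟩ := he
    exact powerToIter_coeff _ m
  · rw [powerToIter_coeff_of_notMem _ e he, h e he]

theorem powerToIter_C {n : ℕ} (c : ℂ) : powerToIter n (MvPowerSeries.C c) = HahnSeries.C c := by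
  classical
  ext e
  by_cases h : e ∈ Set.range (natExpo (n := n))
  · obtain ⟨m, rfl⟩ := h
    have h0 : natExpo (0 : Fin n →₀ ℕ) = 0 := rfl
    rw [powerToIter_coeff, MvPowerSeries.coeff_C, HahnSeries.C_apply, HahnSeries.coeff_single]
    simp only [← h0, natExpo_injective.eq_iff]
  · rw [powerToIter_coeff_of_notMem _ e h, HahnSeries.C_apply, HahnSeries.coeff_single_of_ne]
    rintro rfl
    exact h ⟨0, rfl⟩

/-! ### Relations between products of values in one variable each -/

/-- If the functionals `ev θ` separate the points of `R`, then products of `n` values of linearly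
independent elements, taken at independent points `θ₁,…,θₙ`, are linearly independent. -/
theorem coeff_eq_zero_of_sum_prod_eq_zero {R Θ ι : Type*} [AddCommGroup R] [Module ℂ R]
    (ev : Θ → R →ₗ[ℂ] ℂ) (hev : ∀ r, (∀ θ, ev θ r = 0) → r = 0) {b : ι → R}
    (hb : LinearIndependent ℂ b) : ∀ (n : ℕ) (s : Finset (Fin n → ι)) (c : (Fin n → ι) → ℂ),
      (∀ θ : Fin n → Θ, ∑ I ∈ s, c I * ∏ i, ev (θ i) (b (I i)) = 0) → ∀ I ∈ s, c I = 0 := by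
  classical
  intro n
  induction n with
  | zero =>
    intro s c h I hI
    have hs : s = {I} := by
      ext J
      simp [Subsingleton.elim J I, hI]
    have := h (fun i => i.elim0)
    simpa [hs] using this
  | succ n ih =>
    intro s c h I hI
    -- group the sum by the first index; independence of `b` then makes each group vanish
    let t : Finset ι := s.image fun J => J 0
    let d : (Fin n → Θ) → ι → ℂ := fun θ j =>
      ∑ I ∈ s with I 0 = j, c I * ∏ i, ev (θ i) (b (I i.succ))
    have h1 : ∀ θ : Fin n → Θ, ∑ j ∈ t, d θ j • b j = 0 := by
      intro θ
      apply hev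
      intro θ₀
      rw [map_sum, ← h (Fin.cons θ₀ θ : Fin (n + 1) → Θ)]
      rw [← Finset.sum_fiberwise_of_maps_to (t := t) (g := fun J : Fin (n + 1) → ι => J 0)
        (fun J hJ => Finset.mem_image_of_mem (fun J : Fin (n + 1) → ι => J 0) hJ)]
      refine Finset.sum_congr rfl fun j _ => ?_
      rw [map_smul, smul_eq_mul, Finset.sum_mul]
      refine Finset.sum_congr rfl fun I hI => ?_
      rw [Fin.prod_univ_succ, ← (Finset.mem_filter.mp hI).2]
      simp only [Fin.cons_zero, Fin.cons_succ]
      ring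
    have h2 : ∀ θ : Fin n → Θ, d θ (I 0) = 0 := fun θ =>
      linearIndependent_iff'.mp hb t (d θ) (h1 θ) (I 0)
        (Finset.mem_image_of_mem (fun J : Fin (n + 1) → ι => J 0) hI)
    let tl : (Fin (n + 1) → ι) → Fin n → ι := fun J i => J i.succ
    have hcons : ∀ J : Fin (n + 1) → ι, Fin.cons (J 0) (tl J) = J := Fin.cons_self_tail
    have hmem : tl I ∈ (s.filter fun J => J 0 = I 0).image tl :=
      Finset.mem_image_of_mem tl (Finset.mem_filter.mpr ⟨hI, rfl⟩)
    have h3 := ih ((s.filter fun J => J 0 = I 0).image tl)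
      (fun J => c (Fin.cons (I 0) J)) (fun θ => by
        rw [← h2 θ, Finset.sum_image]
        · refine Finset.sum_congr rfl fun J hJ => ?_
          rw [← (Finset.mem_filter.mp hJ).2, hcons]
        · intro J hJ J' hJ' h
          rw [← hcons J, ← hcons J', h, (Finset.mem_filter.mp hJ).2,
            (Finset.mem_filter.mp hJ').2]) (tl I) hmem
    rwa [hcons] at h3

/-- A linear relation over a field extension `K` of the fraction field of `P`, between vectors with
entries in `P`, can be replaced by a relation with coefficients in `P`. -/
theorem exists_relation_of_relation {P K J T : Type*} [CommRing P] [IsDomain P] [Field K]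
    (φ : P →+* K) (hφ : Function.Injective φ) (s : Finset J) (f : J → K) (q : T → J → P)
    (h : ∀ t, ∑ I ∈ s, f I * φ (q t I) = 0) {I₀ : J} (hI₀ : I₀ ∈ s) (hf : f I₀ ≠ 0) :
    ∃ p : J → P, p I₀ ≠ 0 ∧ ∀ t, ∑ I ∈ s, p I * q t I = 0 := by
  classical
  -- apply an `F`-linear functional on `K` to the coefficients, then clear denominators
  let F := FractionRing P
  let _ : Algebra F K := (IsFractionRing.lift (A := P) (K := F) hφ).toAlgebra
  have hal : ∀ x : P, algebraMap F K (algebraMap P F x) = φ x := fun x =>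
    IsFractionRing.lift_algebraMap hφ x
  obtain ⟨T, hT⟩ : ∃ T : Module.Dual F K, T (f I₀) ≠ 0 := by
    by_contra hcon
    push Not at hcon
    exact hf ((Module.forall_dual_apply_eq_zero_iff F _).mp hcon)
  obtain ⟨⟨d, hd⟩, hdi⟩ := IsLocalization.exist_integer_multiples_of_finset (nonZeroDivisors P)
    (s.image fun I => T (f I))
  have hch : ∀ I, ∃ x : P, I ∈ s → algebraMap P F x = d • T (f I) := by
    intro I
    by_cases hI : I ∈ s
    · obtain ⟨x, hx⟩ := hdi _ (Finset.mem_image_of_mem _ hI)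
      exact ⟨x, fun _ => hx⟩
    · exact ⟨0, fun h => absurd h hI⟩
  choose p hp using hch
  refine ⟨p, ?_, ?_⟩
  · intro h0
    have := hp I₀ hI₀
    rw [h0, map_zero, Algebra.smul_def] at this
    rcases mul_eq_zero.mp this.symm with h | h
    · exact nonZeroDivisors.ne_zero hd (IsFractionRing.injective P F (by rw [h, map_zero]))
    · exact hT h
  · intro t
    apply IsFractionRing.injective P F
    rw [map_sum, map_zero]
    have h1 := congrArg T (h t)
    rw [map_sum, map_zero] at h1
    calc ∑ I ∈ s, algebraMap P F (p I * q t I)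
        = ∑ I ∈ s, algebraMap P F d * T (f I * φ (q t I)) := by
          refine Finset.sum_congr rfl fun I hI => ?_
          rw [map_mul, hp I hI, Algebra.smul_def, mul_comm (f I), ← hal,
            ← Algebra.smul_def (A := K), map_smul, smul_eq_mul]
          ring
      _ = 0 := by rw [← Finset.mul_sum, h1, mul_zero]

/-! ### Hermite interpolation -/

theorem eval_iterate_derivative_eq_zero {p : Polynomial ℂ} {z : ℂ} {N l : ℕ} (hl : l < N)
    (h : (Polynomial.X - Polynomial.C z) ^ N ∣ p) :
    (Polynomial.derivative^[l] p).eval z = 0 := by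
  have h1 := Polynomial.pow_sub_dvd_iterate_derivative_of_pow_dvd l h
  have h2 : (Polynomial.X - Polynomial.C z) ∣ Polynomial.derivative^[l] p :=
    (dvd_pow_self _ (by omega)).trans h1
  exact Polynomial.dvd_iff_isRoot.mp h2

theorem eval_iterate_derivative_X_sub_C_pow (z : ℂ) (k l : ℕ) :
    (Polynomial.derivative^[l] ((Polynomial.X - Polynomial.C z) ^ k)).eval z =
      if k = l then (k.factorial : ℂ) else 0 := by
  rw [Polynomial.iterate_derivative_X_sub_pow]
  rcases lt_trichotomy k l with h | h | h
  · simp [Nat.descFactorial_of_lt h, h.ne]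
  · subst h
    simp [Nat.descFactorial_self]
  · rw [if_neg h.ne']
    simp [zero_pow (Nat.sub_ne_zero_of_lt h)]

/-- The fundamental polynomials of Hermite interpolation at distinct points `zᵢ`. -/
theorem exists_hermite {n : ℕ} (z : Fin n → ℂ) (hz : Function.Injective z) (N : ℕ) :
    ∃ G : Fin n → ℕ → Polynomial ℂ, ∀ i k j l, k < N → l < N →
      (Polynomial.derivative^[l] (G i k)).eval (z j) = if i = j ∧ k = l then 1 else 0 := by
  let D : Fin n → Ideal (Polynomial ℂ) := fun i =>
    Ideal.span {(Polynomial.X - Polynomial.C (z i)) ^ N}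
  have hI : Pairwise (Function.onFun IsCoprime D) := by
    intro i j hij
    rw [Function.onFun, Ideal.isCoprime_span_singleton_iff]
    exact (Polynomial.pairwise_coprime_X_sub_C hz hij).pow
  -- the Chinese remainder theorem for the ideals `((x - zⱼ)^N)`
  have hex : ∀ (i : Fin n) (k : ℕ), ∃ r : Polynomial ℂ, ∀ j,
      r - (if i = j then ((k.factorial : ℂ)⁻¹) • (Polynomial.X - Polynomial.C (z i)) ^ k else 0)
        ∈ D j := fun i k => Ideal.exists_forall_sub_mem_ideal hI _
  choose G hG using hex
  refine ⟨G, fun i k j l hk hl => ?_⟩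
  have h1 := eval_iterate_derivative_eq_zero hl (Ideal.mem_span_singleton.mp (hG i k j))
  rw [Polynomial.iterate_derivative_sub, Polynomial.eval_sub, sub_eq_zero] at h1
  rw [h1]
  by_cases hij : i = j
  · subst hij
    rw [if_pos rfl, Polynomial.iterate_derivative_smul, Polynomial.eval_smul,
      eval_iterate_derivative_X_sub_C_pow]
    by_cases hkl : k = l
    · subst hkl
      simp [Nat.factorial_ne_zero]
    · simp [hkl]
  · simp [hij]

/-! ### Correlators of a commutative differential algebra -/

theorem coeff_prod_aeval_X {n : ℕ} (P : Fin n → Polynomial ℂ) (m : Fin n →₀ ℕ) :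
    MvPolynomial.coeff m (∏ i, Polynomial.aeval (MvPolynomial.X i : MvPolynomial (Fin n) ℂ) (P i))
      = ∏ i, (P i).coeff (m i) := by
  classical
  let N : ℕ := (Finset.univ.sup fun i => (P i).natDegree) + (Finset.univ.sup fun i => m i) + 1
  have h1 : ∀ i, (P i).natDegree < N := fun i => by
    have := Finset.le_sup (f := fun i => (P i).natDegree) (Finset.mem_univ i)
    simp only [N]
    omega
  have h2 : ∀ i, m i < N := fun i => by
    have := Finset.le_sup (f := fun i => m i) (Finset.mem_univ i)
    simp only [N]
    omega
  have h3 : ∀ x : Fin n → ℕ, ∏ i, (P i).coeff (x i) • (MvPolynomial.X i : MvPolynomial (Fin n) ℂ)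
      ^ x i = MvPolynomial.monomial (Finsupp.equivFunOnFinite.symm x) (∏ i, (P i).coeff (x i)) := by
    intro x
    rw [MvPolynomial.monomial_eq, Finsupp.prod_fintype _ _ (by simp), map_prod,
      ← Finset.prod_mul_distrib]
    refine Finset.prod_congr rfl fun i _ => ?_
    rw [MvPolynomial.smul_eq_C_mul]
    rfl
  rw [Finset.prod_congr rfl fun i _ => Polynomial.aeval_eq_sum_range' (h1 i) _,
    Finset.prod_univ_sum, MvPolynomial.coeff_sum, Finset.sum_eq_single (fun i => m i)]
  · rw [h3, MvPolynomial.coeff_monomial, if_pos]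
    ext i
    rfl
  · intro x _ hx
    rw [h3, MvPolynomial.coeff_monomial, if_neg]
    rintro rfl
    exact hx rfl
  · intro h
    exact absurd (Fintype.mem_piFinset.mpr fun i => Finset.mem_range.mpr (h2 i)) h

/-- Coefficients of a polynomial at integer exponents. -/
def intCoeff (P : Polynomial ℂ) (k : ℤ) : ℂ := if 0 ≤ k then P.coeff k.toNat else 0

/-- A homomorphism `χ` of differential algebras to `(ℂ[x], d/dx)`, followed by evaluation at `0`,
sends `Y(a₁,x₁) ⋯ Y(aₙ,xₙ) 1` to `χ(a₁)(x₁) ⋯ χ(aₙ)(xₙ)`, by Taylor's formula. -/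
theorem eval_zero_correlator {R : Type*} [CommRing R] [Algebra ℂ R] (d : Derivation ℂ R R)
    (χ : R →ₐ[ℂ] Polynomial ℂ) (hχ : ∀ r, χ (d r) = Polynomial.derivative (χ r)) :
    ∀ (n : ℕ) (a : Fin n → R) (g : Fin n → ℤ),
      (χ ((ofDifferentialAlgebra d).correlator n a g)).eval 0 = ∏ i, intCoeff (χ (a i)) (g i) := by
  have hk : ∀ (k : ℕ) (r : R), χ (((d : R →ₗ[ℂ] R) ^ k) r) = Polynomial.derivative^[k] (χ r) := by
    intro k
    induction k with
    | zero => intro r; simp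
    | succ k ih =>
      intro r
      rw [pow_succ, Module.End.mul_apply, ih, Function.iterate_succ_apply]
      congr 1
      exact hχ r
  intro n
  induction n with
  | zero => intro a g; simp [VertexData.correlator, ofDifferentialAlgebra]
  | succ n ih =>
    intro a g
    rw [Fin.prod_univ_succ]
    by_cases h0 : 0 ≤ g 0
    · have h1 : ¬ (0 ≤ -g 0 - 1) := by omega
      have h2 : (-(-g 0 - 1) - 1).toNat = (g 0).toNat := by congr 1; ring
      have h3 : (χ ((ofDifferentialAlgebra d).correlator (n + 1) a g)) =
          (((g 0).toNat.factorial : ℂ)⁻¹) • (Polynomial.derivative^[(g 0).toNat] (χ (a 0)) *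
            χ ((ofDifferentialAlgebra d).correlator n (Fin.tail a) (Fin.tail g))) := by
        rw [← hk, ← map_mul, ← map_smul]
        congr 1
        simp only [VertexData.correlator]
        conv_lhs => rw [ofDifferentialAlgebra]
        simp only [h1, if_false, h2]
        rfl
      rw [h3, Polynomial.eval_smul, Polynomial.eval_mul, ih, intCoeff, if_pos h0,
        ← Polynomial.coeff_zero_eq_eval_zero, Polynomial.coeff_iterate_derivative]
      simp only [zero_add, Nat.descFactorial_self, nsmul_eq_mul, smul_eq_mul]
      have hf : ((g 0).toNat.factorial : ℂ) ≠ 0 := by exact_mod_cast Nat.factorial_ne_zero _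
      field_simp
      rfl
    · have h1 : 0 ≤ -g 0 - 1 := by omega
      rw [intCoeff, if_neg h0, zero_mul]
      have h3 : (ofDifferentialAlgebra d).prod (-g 0 - 1) = 0 := by
        rw [ofDifferentialAlgebra]
        simp only [h1, if_true]
      simp [VertexData.correlator, h3]

/-- `eval_zero_correlator` as an identity in `ℂ((x₁))⋯((xₙ))`. -/
theorem hahnPair_correlator {R : Type*} [CommRing R] [Algebra ℂ R] (d : Derivation ℂ R R)
    (χ : R →ₐ[ℂ] Polynomial ℂ) (hχ : ∀ r, χ (d r) = Polynomial.derivative (χ r))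
    (n : ℕ) (a : Fin n → R) :
    hahnPair (Expo n) ((Polynomial.aeval (0 : ℂ)).comp χ).toLinearMap
        ((ofDifferentialAlgebra d).correlatorMap n a) =
      powerToIter n (∏ i, Polynomial.aeval (MvPolynomial.X i : MvPolynomial (Fin n) ℂ) (χ (a i)) :
        MvPolynomial (Fin n) ℂ) := by
  ext e
  obtain ⟨g, rfl⟩ := expoOf.surjective e
  have h1 : (hahnPair (Expo n) ((Polynomial.aeval (0 : ℂ)).comp χ).toLinearMap
        ((ofDifferentialAlgebra d).correlatorMap n a)).coeff (expoOf g) =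
      (χ ((ofDifferentialAlgebra d).correlator n a g)).eval 0 := by
    rw [hahnPair_coeff, AlgHom.toLinearMap_apply, AlgHom.comp_apply,
      Polynomial.coe_aeval_eq_eval]
    rfl
  rw [h1, eval_zero_correlator d χ hχ]
  by_cases he : expoOf g ∈ Set.range (natExpo (n := n))
  · obtain ⟨m, hm⟩ := he
    rw [← hm, powerToIter_coeff, MvPolynomial.coeff_coe, coeff_prod_aeval_X]
    rw [← expoOf.injective hm]
    simp [intCoeff]
  · rw [powerToIter_coeff_of_notMem _ _ he]
    rw [mem_range_natExpo] at he
    push Not at he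
    obtain ⟨i, hi⟩ := he
    apply Finset.prod_eq_zero (Finset.mem_univ i)
    rw [intCoeff, if_neg (by omega)]

/-! ### Free commutative differential algebras -/

section FCD

variable {U : Type*} [AddCommGroup U] [Module ℂ U]

/-- The homomorphism of differential algebras from `FCD(U)` to `(ℂ[x], d/dx)` which extends a
linear map `g : U → ℂ[x]`. -/
def FCD.toPolynomial (g : U →ₗ[ℂ] Polynomial ℂ) : FCD U →ₐ[ℂ] Polynomial ℂ :=
  SymmetricAlgebra.lift (TensorProduct.lift
    ((LinearMap.lcomp ℂ (Polynomial ℂ) g) ∘ₗ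
      (Polynomial.aeval (Polynomial.derivative : Module.End ℂ (Polynomial ℂ))).toLinearMap))

theorem FCD.toPolynomial_ι (g : U →ₗ[ℂ] Polynomial ℂ) (p : Polynomial ℂ) (u : U) :
    FCD.toPolynomial g (SymmetricAlgebra.ι ℂ _ (p ⊗ₜ[ℂ] u)) =
      Polynomial.aeval (Polynomial.derivative : Module.End ℂ (Polynomial ℂ)) p (g u) := by
  simp [FCD.toPolynomial]

theorem FCD.toPolynomial_partialD (g : U →ₗ[ℂ] Polynomial ℂ) (r : FCD U) :
    FCD.toPolynomial g (FCD.partialD U r) = Polynomial.derivative (FCD.toPolynomial g r) := by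
  induction r using SymmetricAlgebra.induction with
  | algebraMap c => simp
  | ι m =>
    rw [FCD.partialD, symDerivation_ι]
    induction m using TensorProduct.induction_on with
    | zero => simp
    | tmul p u =>
      rw [LinearMap.rTensor_tmul, FCD.toPolynomial_ι, FCD.toPolynomial_ι]
      simp
    | add x y hx hy => simp only [map_add, hx, hy]
  | mul a b ha hb =>
    rw [Derivation.leibniz, map_add, map_mul, Polynomial.derivative_mul, smul_eq_mul, smul_eq_mul,
      map_mul, map_mul, ha, hb]
    ring
  | add a b ha hb => simp only [map_add, ha, hb]

/-- The value of a character at an element of `FCD(U)` depends only on its values at `∂^k u` for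
finitely many `k`. -/
theorem FCD.exists_order_bound (r : FCD U) : ∃ N : ℕ, ∀ θ θ' : FCD U →ₐ[ℂ] ℂ,
    (∀ k < N, ∀ u : U, θ (SymmetricAlgebra.ι ℂ _ (((Polynomial.X : Polynomial ℂ) ^ k) ⊗ₜ[ℂ] u)) =
      θ' (SymmetricAlgebra.ι ℂ _ (((Polynomial.X : Polynomial ℂ) ^ k) ⊗ₜ[ℂ] u))) →
    θ r = θ' r := by
  induction r using SymmetricAlgebra.induction with
  | algebraMap c => exact ⟨0, fun θ θ' _ => by simp⟩
  | ι m =>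
    induction m using TensorProduct.induction_on with
    | zero => exact ⟨0, fun θ θ' _ => by simp⟩
    | tmul p u =>
      refine ⟨p.natDegree + 1, fun θ θ' h => ?_⟩
      rw [p.as_sum_range_C_mul_X_pow, TensorProduct.sum_tmul]
      simp only [map_sum]
      refine Finset.sum_congr rfl fun k hk => ?_
      rw [← Polynomial.smul_eq_C_mul, ← TensorProduct.smul_tmul']
      simp only [map_smul]
      rw [h k (Finset.mem_range.mp hk)]
    | add x y hx hy =>
      obtain ⟨N, hN⟩ := hx
      obtain ⟨M, hM⟩ := hy
      refine ⟨max N M, fun θ θ' h => ?_⟩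
      simp only [map_add]
      rw [hN θ θ' fun k hk => h k (lt_max_of_lt_left hk),
        hM θ θ' fun k hk => h k (lt_max_of_lt_right hk)]
  | mul a b ha hb =>
    obtain ⟨N, hN⟩ := ha
    obtain ⟨M, hM⟩ := hb
    refine ⟨max N M, fun θ θ' h => ?_⟩
    rw [map_mul, map_mul, hN θ θ' fun k hk => h k (lt_max_of_lt_left hk),
      hM θ θ' fun k hk => h k (lt_max_of_lt_right hk)]
  | add a b ha hb =>
    obtain ⟨N, hN⟩ := ha
    obtain ⟨M, hM⟩ := hb
    refine ⟨max N M, fun θ θ' h => ?_⟩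
    rw [map_add, map_add, hN θ θ' fun k hk => h k (lt_max_of_lt_left hk),
      hM θ θ' fun k hk => h k (lt_max_of_lt_right hk)]

/-- The characters of a symmetric algebra separate its elements. -/
theorem symmetricAlgebra_eq_zero {M : Type*} [AddCommGroup M] [Module ℂ M]
    (r : SymmetricAlgebra ℂ M) (h : ∀ θ : SymmetricAlgebra ℂ M →ₐ[ℂ] ℂ, θ r = 0) : r = 0 := by
  let B := Module.Basis.ofVectorSpace ℂ M
  let e := SymmetricAlgebra.equivMvPolynomial B
  apply e.injective
  rw [map_zero]
  apply MvPolynomial.funext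
  intro x
  rw [map_zero, ← h ((MvPolynomial.aeval x).comp e.toAlgHom)]
  simp [MvPolynomial.aeval_eq_eval]

/-- The differential homomorphisms `FCD(U) → ℂ[x]` followed by evaluation at distinct points
`z₁,…,zₙ` give arbitrary tuples of characters on any finite set of elements. -/
theorem FCD.exists_toPolynomial_eval {n : ℕ} (z : Fin n → ℂ) (hz : Function.Injective z)
    (t : Finset (FCD U)) (θ : Fin n → FCD U →ₐ[ℂ] ℂ) :
    ∃ g : U →ₗ[ℂ] Polynomial ℂ, ∀ r ∈ t, ∀ i, (FCD.toPolynomial g r).eval (z i) = θ i r := by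
  choose B hB using FCD.exists_order_bound (U := U)
  let N := t.sup B
  obtain ⟨G, hG⟩ := exists_hermite z hz N
  let g : U →ₗ[ℂ] Polynomial ℂ := ∑ i : Fin n, ∑ k ∈ Finset.range N,
    ((θ i).toLinearMap ∘ₗ SymmetricAlgebra.ι ℂ (Polynomial ℂ ⊗[ℂ] U) ∘ₗ
      TensorProduct.mk ℂ (Polynomial ℂ) U (Polynomial.X ^ k)).smulRight (G i k)
  refine ⟨g, fun r hr j => ?_⟩
  have h1 := hB r ((Polynomial.aeval (z j)).comp (FCD.toPolynomial g)) (θ j) (fun l hl u => ?_)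
  · rw [← h1]
    simp [Polynomial.coe_aeval_eq_eval]
  · have hlN : l < N := lt_of_lt_of_le hl (Finset.le_sup (f := B) hr)
    rw [AlgHom.comp_apply, FCD.toPolynomial_ι, map_pow, Polynomial.aeval_X, Module.End.pow_apply,
      Polynomial.coe_aeval_eq_eval]
    simp only [g, LinearMap.sum_apply, LinearMap.smulRight_apply, Polynomial.iterate_derivative_sum,
      Polynomial.iterate_derivative_smul, Polynomial.eval_finsetSum, Polynomial.eval_smul]
    rw [Finset.sum_eq_single j, Finset.sum_eq_single l]
    · rw [hG j l j l hlN hlN]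
      simp
    · intro k hk hkl
      rw [hG j k j l (Finset.mem_range.mp hk) hlN]
      simp [hkl]
    · intro h
      exact absurd (Finset.mem_range.mpr hlN) h
    · intro i _ hij
      refine Finset.sum_eq_zero fun k hk => ?_
      rw [hG i k j l (Finset.mem_range.mp hk) hlN]
      simp [hij]
    · simp

/-- The correlators of linearly independent elements of `FCD(U)` are linearly independent over
`ℂ((x₁))⋯((xₙ))`. -/
theorem FCD.linearIndependent_correlatorMap {ι : Type*} {b : ι → FCD U}
    (hb : LinearIndependent ℂ b) (n : ℕ) :
    LinearIndependent (IterLaurent n)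
      (fun I : Fin n → ι => (FCD.data U).correlatorMap n (fun i => b (I i))) := by
  classical
  rw [linearIndependent_iff']
  intro s f hf I₀ hI₀
  by_contra hne
  -- the differential homomorphisms to `ℂ[x]` turn a relation between correlators into relations
  -- between polynomials, whose coefficients may then be taken to be polynomials too
  let φ : MvPolynomial (Fin n) ℂ →+* IterLaurent n :=
    (powerToIter n).comp MvPolynomial.coeToMvPowerSeries.ringHom
  have hφ : Function.Injective φ :=
    (powerToIter_injective n).comp (MvPolynomial.coe_injective (Fin n) ℂ)
  obtain ⟨p, hp0, hp⟩ := exists_relation_of_relation φ hφ s f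
    (fun (g : U →ₗ[ℂ] Polynomial ℂ) I => ∏ i, Polynomial.aeval
      (MvPolynomial.X i : MvPolynomial (Fin n) ℂ) (FCD.toPolynomial g (b (I i)))) (fun g => by
      have h1 := congrArg (hahnPair (Expo n)
        ((Polynomial.aeval (0 : ℂ)).comp (FCD.toPolynomial g)).toLinearMap) hf
      rw [map_sum, map_zero] at h1
      rw [← h1]
      refine Finset.sum_congr rfl fun I _ => ?_
      rw [map_smul, smul_eq_mul]
      congr 1
      exact (hahnPair_correlator (FCD.partialD U) (FCD.toPolynomial g)
        (FCD.toPolynomial_partialD g) n fun i => b (I i)).symm) hI₀ hne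
  -- choose a point with distinct coordinates at which the coefficient `p I₀` does not vanish
  let D : MvPolynomial (Fin n) ℂ := p I₀ *
    ∏ ij : Fin n × Fin n with ij.1 ≠ ij.2, (MvPolynomial.X ij.1 - MvPolynomial.X ij.2)
  have hD : D ≠ 0 := by
    refine mul_ne_zero hp0 (Finset.prod_ne_zero_iff.mpr fun ij hij => ?_)
    rw [sub_ne_zero]
    exact fun h => (Finset.mem_filter.mp hij).2 (MvPolynomial.X_injective h)
  obtain ⟨z, hz⟩ : ∃ z, MvPolynomial.eval z D ≠ 0 := by
    by_contra hcon
    push Not at hcon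
    exact hD (MvPolynomial.funext fun z => by rw [hcon z, map_zero])
  rw [map_mul, map_prod] at hz
  have hzinj : Function.Injective z := by
    intro i j hij
    by_contra hne
    apply right_ne_zero_of_mul hz
    refine Finset.prod_eq_zero (i := (i, j)) (by simp [hne]) ?_
    simp [hij]
  apply left_ne_zero_of_mul hz
  refine coeff_eq_zero_of_sum_prod_eq_zero (fun θ : FCD U →ₐ[ℂ] ℂ => θ.toLinearMap)
    symmetricAlgebra_eq_zero hb n s (fun I => MvPolynomial.eval z (p I)) (fun θ => ?_) I₀ hI₀
  obtain ⟨g, hg⟩ := FCD.exists_toPolynomial_eval z hzinj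
    (s.biUnion fun I => Finset.univ.image fun i => b (I i)) θ
  have h1 := congrArg (MvPolynomial.eval z) (hp g)
  rw [map_sum, map_zero] at h1
  rw [← h1]
  refine Finset.sum_congr rfl fun I hI => ?_
  rw [map_mul, map_prod]
  congr 1
  refine Finset.prod_congr rfl fun i _ => ?_
  rw [AlgHom.toLinearMap_apply, ← hg (b (I i)) (Finset.mem_biUnion.mpr
    ⟨I, hI, Finset.mem_image_of_mem _ (Finset.mem_univ i)⟩) i, ← MvPolynomial.coe_aeval_eq_eval,
    RingHom.coe_coe, ← Polynomial.aeval_algHom_apply, MvPolynomial.aeval_X,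
    Polynomial.coe_aeval_eq_eval]

end FCD

/-! ### Passing from the associated graded structure to the filtered one -/

/-- If the leading terms `w'` of a family `w` are linearly independent, so is `w`: a nontrivial
relation would give one between the leading terms of top degree. -/
theorem linearIndependent_of_leading {R M N J : Type*} [Ring R] [AddCommGroup M] [Module R M]
    [AddCommGroup N] [Module R N] (deg : J → ℤ) (w : J → M) (w' : J → N) (π : ℤ → M →ₗ[R] N)
    (hlead : ∀ I, π (deg I) (w I) = w' I) (hlow : ∀ I D, deg I < D → π D (w I) = 0)
    (hw' : LinearIndependent R w') : LinearIndependent R w := by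
  classical
  rw [linearIndependent_iff']
  intro s f hf
  by_contra! hcon
  obtain ⟨I₀, hI₀, hne⟩ := hcon
  obtain ⟨I₁, hI₁, hmax⟩ := (s.filter fun I => f I ≠ 0).exists_max_image deg
    ⟨I₀, Finset.mem_filter.mpr ⟨hI₀, hne⟩⟩
  have h1 := congrArg (π (deg I₁)) hf
  rw [map_sum, map_zero] at h1
  have h2 : ∑ I ∈ s with deg I = deg I₁, f I • w' I = 0 := by
    rw [← h1, Finset.sum_filter]
    refine Finset.sum_congr rfl fun I hI => ?_
    rw [map_smul]
    by_cases hd : deg I = deg I₁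
    · rw [if_pos hd, ← hd, hlead]
    · rw [if_neg hd]
      by_cases hfI : f I = 0
      · rw [hfI, zero_smul]
      · rw [hlow I _ (lt_of_le_of_ne (hmax I (Finset.mem_filter.mpr ⟨hI, hfI⟩)) hd), smul_zero]
  exact (Finset.mem_filter.mp hI₁).2 (linearIndependent_iff'.mp hw' _ f h2 I₁
    (Finset.mem_filter.mpr ⟨(Finset.mem_filter.mp hI₁).1, rfl⟩))

section Filtration

variable {V : Type u} [AddCommGroup V] [Module ℂ V] {A : VertexData V} {E : ℤ → Submodule ℂ V}

theorem grClass_congr {m m' : ℤ} (h : m = m') (x : V) (hx : x ∈ E m) (hx' : x ∈ E m') :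
    grClass E m ⟨x, hx⟩ = grClass E m' ⟨x, hx'⟩ := by
  subst h
  rfl

/-- The correlators of `gr_E(V)` are the leading terms of those of `V`. -/
theorem grData_correlator (hE : A.IsFiltration E) : ∀ (n : ℕ) (m : Fin n → ℤ)
    (a : ∀ i, E (m i)) (g : Fin n → ℤ),
    ∃ h : A.correlator n (fun i => (a i : V)) g ∈ E (∑ i, m i),
      (grData hE).correlator n (fun i => grClass E (m i) (a i)) g =
        grClass E (∑ i, m i) ⟨_, h⟩ := by
  intro n
  induction n with
  | zero =>
    intro m a g
    exact ⟨hE.vac_mem, rfl⟩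
  | succ n ih =>
    intro m a g
    obtain ⟨h, hh⟩ := ih (fun i => m i.succ) (fun i => a i.succ) (Fin.tail g)
    have h1 : A.correlator (n + 1) (fun i => (a i : V)) g ∈ E (m 0 + ∑ i : Fin n, m i.succ) :=
      hE.prod_mem _ _ _ _ _ (a 0).2 h
    have hm : m 0 + ∑ i : Fin n, m i.succ = ∑ i, m i := (Fin.sum_univ_succ m).symm
    refine ⟨hm ▸ h1, ?_⟩
    rw [← grClass_congr hm _ h1]
    change grProd hE (-g 0 - 1) (grClass E (m 0) (a 0)) ((grData hE).correlator n
      (fun i => grClass E (m i.succ) (a i.succ)) (Fin.tail g)) = _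
    rw [hh, grProd_class]
    rfl

/-- The class in degree `D`, extended in some way to a linear map on all of `V`. -/
theorem exists_leading_map (E : ℤ → Submodule ℂ V) (D : ℤ) :
    ∃ T : V →ₗ[ℂ] Gr E, ∀ a : E D, T a = grClass E D a := by
  obtain ⟨T, hT⟩ := LinearMap.exists_extend (grClass E D)
  exact ⟨T, fun a => DFunLike.congr_fun hT a⟩

theorem VertexIso.map_correlator {W : Type v} [AddCommGroup W] [Module ℂ W] {A : VertexData V}
    {B : VertexData W} (e : VertexIso A B) : ∀ (n : ℕ) (a : Fin n → V) (g : Fin n → ℤ),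
    e.toEquiv (A.correlator n a g) = B.correlator n (fun i => e.toEquiv (a i)) g := by
  intro n
  induction n with
  | zero => intro a g; exact e.map_vac
  | succ n ih =>
    intro a g
    simp only [VertexData.correlator]
    rw [e.map_prod, ih]
    rfl

/-- The correlators of the elements of a suitable basis of `V` are linearly independent. The basis is
one whose elements have classes forming a homogeneous basis of `gr_E(V)`, so that the leading terms
of its correlators are the correlators of linearly independent elements of `FCD(U)`. -/
theorem exists_basis_linearIndependent (hE : A.IsFiltration E) {U : Type v} [AddCommGroup U]
    [Module ℂ U] (e : VertexIso (grData hE) (FCD.data U)) :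
    ∃ (ι : Type u) (b : Module.Basis ι ℂ V), ∀ n : ℕ, LinearIndependent (IterLaurent n)
      (fun I : Fin n → ι => A.correlatorMap n (fun i => b (I i))) := by
  classical
  let B : ∀ m, Module.Basis _ ℂ (GrPiece E m) := fun m => Module.Basis.ofVectorSpace ℂ (GrPiece E m)
  let BG : Module.Basis _ ℂ (Gr E) := DFinsupp.basis B
  have hBG : ∀ j, BG j = DirectSum.lof ℂ ℤ (GrPiece E) j.1 (B j.1 j.2) := fun j => by
    apply BG.repr.injective
    rw [BG.repr_self]
    ext i
    simp only [BG, DFinsupp.basis]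
    obtain ⟨j1, j2⟩ := j
    obtain ⟨i1, i2⟩ := i
    change _ = ((sigmaFinsuppLequivDFinsupp ℂ).symm
      (DFinsupp.mapRange.linearEquiv (fun i => (B i).repr) (DFinsupp.single j1 (B j1 j2)))) ⟨i1, i2⟩
    by_cases h : j1 = i1
    · subst h
      simp [Finsupp.single_apply]
    · simp [h]
  choose v hv using fun j : (Σ m, Module.Basis.ofVectorSpaceIndex ℂ (GrPiece E m)) =>
    GrPiece.mk_surjective E j.1 (B j.1 j.2)
  have hclass : ∀ j, grClass E j.1 (v j) = BG j := fun j => by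
    rw [hBG, ← hv]
    rfl
  choose T hT using exists_leading_map E
  have hTlow : ∀ m D (x : V), x ∈ E m → m < D → T D x = 0 := fun m D x hx hlt => by
    have hx' : x ∈ E (D - 1) := hE.mono (by omega) hx
    rw [hT D ⟨x, hE.mono (by omega) hx⟩]
    exact grClass_eq_zero E D _ hx'
  have hind : LinearIndependent ℂ (fun j => (v j : V)) :=
    linearIndependent_of_leading (fun j => j.1) _ BG T (fun j => by rw [hT, hclass])
      (fun j D hlt => hTlow _ D _ (v j).2 hlt) BG.linearIndependent
  have hspan : ∀ k : ℕ, E (k - 1) ≤ Submodule.span ℂ (Set.range fun j => (v j : V)) := by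
    intro k
    induction k with
    | zero => simp [hE.neg]
    | succ k ih =>
      intro x hx
      rw [Nat.cast_succ, add_sub_cancel_right] at hx
      let c := (B k).repr (GrPiece.mk E k ⟨x, hx⟩)
      let y : E k := c.sum fun j r => r • v ⟨k, j⟩
      have hvk : ∀ j, GrPiece.mk E k (v ⟨k, j⟩) = B k j := fun j => hv ⟨k, j⟩
      have h1 : GrPiece.mk E k y = GrPiece.mk E k ⟨x, hx⟩ := by
        rw [← (B k).linearCombination_repr (GrPiece.mk E k ⟨x, hx⟩),
          Finsupp.linearCombination_apply]
        simp only [y, Finsupp.sum, map_sum, map_smul, hvk]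
        rfl
      have h2 : x - y ∈ E (k - 1) :=
        (GrPiece.mk_eq_zero E k (⟨x, hx⟩ - y)).mp (by rw [map_sub, h1, sub_self])
      have h3 : (y : V) ∈ Submodule.span ℂ (Set.range fun j => (v j : V)) := by
        simp only [y, Finsupp.sum, Submodule.coe_sum, Submodule.coe_smul]
        exact Submodule.sum_mem _ fun j _ => Submodule.smul_mem _ _
          (Submodule.subset_span ⟨⟨k, j⟩, rfl⟩)
      rw [← sub_add_cancel x (y : V)]
      exact Submodule.add_mem _ (ih h2) h3
  let b : Module.Basis _ ℂ V := Module.Basis.mk hind (by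
    intro x _
    obtain ⟨n, hn⟩ := hE.exhaustive x
    exact hspan (n + 1).toNat (hE.mono (by omega) hn))
  have hb : ∀ j, b j = v j := fun j => Module.Basis.mk_apply _ _ j
  refine ⟨_, b, fun n => ?_⟩
  have hgr : LinearIndependent (IterLaurent n) (fun I : Fin n → _ =>
      (grData hE).correlatorMap n (fun i => BG (I i))) := by
    refine LinearIndependent.of_comp (hahnMap (Expo n) e.toEquiv.toLinearMap) ?_
    have h1 := FCD.linearIndependent_correlatorMap (b := fun j => e.toEquiv (BG j))
      (BG.linearIndependent.map' e.toEquiv.toLinearMap e.toEquiv.ker) n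
    convert h1 using 1
    funext I
    apply (HahnModule.of ℂ).symm.injective
    ext g
    exact e.map_correlator n _ _
  refine linearIndependent_of_leading (fun I : Fin n → _ => ∑ i, (I i).1) _ _
    (fun D => hahnMap (Expo n) (T D)) (fun I => ?_) (fun I D hlt => ?_) hgr
  · apply (HahnModule.of ℂ).symm.injective
    refine HahnSeries.ext (funext fun g => ?_)
    obtain ⟨g, rfl⟩ := expoOf.surjective g
    obtain ⟨h, hh⟩ := grData_correlator hE n (fun i => (I i).1) (fun i => v (I i)) g
    rw [hahnMap_coeff]
    simp only [hclass] at hh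
    have h2 := hT _ ⟨_, h⟩
    simp only [hb]
    exact h2.trans hh.symm
  · apply (HahnModule.of ℂ).symm.injective
    refine HahnSeries.ext (funext fun g => ?_)
    obtain ⟨g, rfl⟩ := expoOf.surjective g
    obtain ⟨h, hh⟩ := grData_correlator hE n (fun i => (I i).1) (fun i => v (I i)) g
    rw [hahnMap_coeff]
    simp only [hb]
    exact hTlow _ D _ h hlt

end Filtration

/-- Nondegeneracy in terms of a basis of `V`. -/
theorem VertexData.nondegenerate_of_basis {V : Type u} [AddCommGroup V] [Module ℂ V]
    (A : VertexData V) {ι : Type v} (b : Module.Basis ι ℂ V)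
    (h : ∀ n : ℕ, LinearIndependent (IterLaurent n)
      (fun I : Fin n → ι => A.correlatorMap n (fun i => b (I i)))) : A.Nondegenerate := by
  classical
  intro n _
  let B := Basis.piTensorProduct (fun _ : Fin n => b)
  let eq := TensorProduct.equivFinsuppOfBasisLeft (N := IterLaurent n) B
  have key : ∀ c, A.Z n (eq.symm c) = Finsupp.linearCombination (IterLaurent n)
      (fun I : Fin n → ι => A.correlatorMap n (fun i => b (I i))) c := by
    intro c
    rw [TensorProduct.equivFinsuppOfBasisLeft_symm_apply, Finsupp.linearCombination_apply,
      Finsupp.sum, Finsupp.sum, map_sum]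
    refine Finset.sum_congr rfl fun I _ => ?_
    simp [VertexData.Z, B]
  intro t t' htt'
  apply eq.injective
  apply h n
  rw [← key, ← key, eq.symm_apply_apply, eq.symm_apply_apply, htt']

theorem vac_ne_zero {V : Type u} [AddCommGroup V] [Module ℂ V] {A : VertexData V}
    {E : ℤ → Submodule ℂ V} (hE : A.IsFiltration E) {U : Type v} [AddCommGroup U]
    [Module ℂ U] (e : VertexIso (grData hE) (FCD.data U)) : A.vac ≠ 0 := by
  intro h
  have h1 : (1 : FCD U) = 0 := by
    have h2 : (FCD.data U).vac = 1 := rfl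
    rw [← h2, ← e.map_vac]
    have h3 : (grData hE).vac = 0 := grClass_eq_zero E 0 _ (by simp [h])
    rw [h3, map_zero]
  exact one_ne_zero h1

/-! ### Power series in three variables with inverted differences -/

/-- `ℂ[[x₁,x₂,x₃]]`. -/
abbrev ThreeSeries : Type := MvPowerSeries (Fin 3) ℂ

/-- `xᵢ - xⱼ`. -/
def varDiff (i j : Fin 3) : ThreeSeries := MvPowerSeries.X i - MvPowerSeries.X j

/-- `(x₁-x₂)(x₁-x₃)(x₂-x₃)`. -/
def discr : ThreeSeries := varDiff 0 1 * varDiff 0 2 * varDiff 1 2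

/-- The ring `ℂ[[x₁,x₂,x₃]]` with the differences `xᵢ - xⱼ` inverted. It contains the common
"analytic continuation" of the correlators of the different orderings of three vectors. -/
def ThreeLoc : Type := Localization.Away discr

instance : CommRing ThreeLoc := inferInstanceAs (CommRing (Localization.Away discr))

instance : Algebra ThreeSeries ThreeLoc :=
  inferInstanceAs (Algebra ThreeSeries (Localization.Away discr))

instance : Algebra ℂ ThreeLoc := inferInstanceAs (Algebra ℂ (Localization.Away discr))

instance : IsScalarTower ℂ ThreeSeries ThreeLoc :=
  inferInstanceAs (IsScalarTower ℂ ThreeSeries (Localization.Away discr))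

instance : IsLocalization.Away discr ThreeLoc :=
  inferInstanceAs (IsLocalization.Away discr (Localization.Away discr))

/-- The map `ℂ[[x₁,x₂,x₃]] → ThreeLoc`. -/
abbrev toLoc : ThreeSeries →+* ThreeLoc := algebraMap ThreeSeries ThreeLoc

theorem toLoc_C (c : ℂ) : toLoc (MvPowerSeries.C c) = algebraMap ℂ ThreeLoc c :=
  (IsScalarTower.algebraMap_apply ℂ ThreeSeries ThreeLoc c).symm

theorem varDiff_swap (i j : Fin 3) : varDiff j i = -varDiff i j := (neg_sub _ _).symm

theorem varDiff_ne_zero {i j : Fin 3} (h : i ≠ j) : varDiff i j ≠ 0 := by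
  rw [varDiff, sub_ne_zero]
  exact fun hX => h (MvPowerSeries.X_inj.mp hX)

theorem discr_ne_zero : discr ≠ 0 :=
  mul_ne_zero (mul_ne_zero (varDiff_ne_zero (by decide)) (varDiff_ne_zero (by decide)))
    (varDiff_ne_zero (by decide))

theorem varDiff_dvd_discr {i j : Fin 3} (h : i ≠ j) : varDiff i j ∣ discr := by
  have h1 : varDiff 0 1 ∣ discr := (Dvd.intro _ rfl : varDiff 0 1 ∣ varDiff 0 1 * _).mul_right _
  have h2 : varDiff 0 2 ∣ discr := (Dvd.intro_left _ rfl : varDiff 0 2 ∣ _ * varDiff 0 2).mul_right _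
  have h3 : varDiff 1 2 ∣ discr := Dvd.intro_left _ rfl
  have hs : ∀ {i j : Fin 3}, varDiff i j ∣ discr → varDiff j i ∣ discr := fun h => by
    rw [varDiff_swap, neg_dvd]
    exact h
  fin_cases i <;> fin_cases j <;> first | exact absurd rfl h | skip
  exacts [h1, h2, hs h1, h3, hs h2, hs h3]

theorem isUnit_toLoc_varDiff {i j : Fin 3} (h : i ≠ j) : IsUnit (toLoc (varDiff i j)) :=
  isUnit_of_dvd_unit (map_dvd toLoc (varDiff_dvd_discr h))
    (IsLocalization.Away.algebraMap_isUnit discr)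

theorem ThreeLoc.ringHom_ext {R : Type*} [CommRing R] {φ ψ : ThreeLoc →+* R}
    (h : ∀ F, φ (toLoc F) = ψ (toLoc F)) : φ = ψ :=
  IsLocalization.ringHom_ext (Submonoid.powers discr) (RingHom.ext h)

theorem ThreeLoc.exists_mul_pow (x : ThreeLoc) (N : ℕ) :
    ∃ n F, N ≤ n ∧ toLoc discr ^ n * x = toLoc F := by
  obtain ⟨n, F, h⟩ := IsLocalization.Away.surj discr x
  refine ⟨n + N, discr ^ N * F, by omega, ?_⟩
  rw [map_mul, map_pow, ← h]
  ring

/-! ### The embedding into iterated Laurent series -/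

theorem isUnit_powerToIter_discr : IsUnit (powerToIter 3 discr) :=
  ((map_ne_zero_iff _ (powerToIter_injective 3)).mpr discr_ne_zero).isUnit

/-- The embedding of `ThreeLoc` into `ℂ((x₁))((x₂))((x₃))`. -/
def locToIter : ThreeLoc →+* IterLaurent 3 :=
  IsLocalization.Away.lift discr isUnit_powerToIter_discr

@[simp]
theorem locToIter_toLoc (F : ThreeSeries) : locToIter (toLoc F) = powerToIter 3 F :=
  IsLocalization.Away.lift_eq discr isUnit_powerToIter_discr F

theorem locToIter_injective : Function.Injective locToIter := by
  rw [injective_iff_map_eq_zero]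
  intro x hx
  obtain ⟨n, F, _, hF⟩ := x.exists_mul_pow 0
  have h1 := congrArg locToIter hF
  rw [map_mul, hx, mul_zero, locToIter_toLoc] at h1
  rw [powerToIter_injective 3 (h1.symm.trans (map_zero _).symm), map_zero] at hF
  exact ((IsLocalization.Away.algebraMap_isUnit (S := ThreeLoc) discr).pow n).mul_right_eq_zero.mp hF

theorem locToIter_smul (c : ℂ) (x : ThreeLoc) : locToIter (c • x) = c • locToIter x := by
  rw [Algebra.smul_def, ← toLoc_C, map_mul, locToIter_toLoc, powerToIter_C,
    HahnSeries.C_mul_eq_smul]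

/-- The embedding of `ThreeLoc` into `ℂ((x₁))((x₂))((x₃))`, as a linear map. -/
def locToIterLinear : ThreeLoc →ₗ[ℂ] IterLaurent 3 where
  toFun := locToIter
  map_add' := map_add _
  map_smul' := locToIter_smul

/-! ### Permutations of the three variables -/

theorem rename_varDiff (σ : Equiv.Perm (Fin 3)) (i j : Fin 3) :
    MvPowerSeries.rename σ (varDiff i j) = varDiff (σ i) (σ j) := by
  simp [varDiff]

theorem isUnit_toLoc_rename_discr (σ : Equiv.Perm (Fin 3)) :
    IsUnit ((toLoc.comp (MvPowerSeries.rename (R := ℂ) σ).toRingHom) discr) := by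
  have h : ∀ i j : Fin 3, i ≠ j → IsUnit (toLoc (varDiff (σ i) (σ j))) := fun i j hij =>
    isUnit_toLoc_varDiff (σ.injective.ne hij)
  simp only [RingHom.comp_apply, AlgHom.toRingHom_eq_coe, RingHom.coe_coe, discr, map_mul,
    rename_varDiff]
  exact ((h _ _ (by decide)).mul (h _ _ (by decide))).mul (h _ _ (by decide))

/-- The action of a permutation of the variables on `ThreeLoc`. -/
def permLoc (σ : Equiv.Perm (Fin 3)) : ThreeLoc →+* ThreeLoc :=
  IsLocalization.Away.lift discr (isUnit_toLoc_rename_discr σ)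

@[simp]
theorem permLoc_toLoc (σ : Equiv.Perm (Fin 3)) (F : ThreeSeries) :
    permLoc σ (toLoc F) = toLoc (MvPowerSeries.rename σ F) :=
  IsLocalization.Away.lift_eq discr (isUnit_toLoc_rename_discr σ) F

theorem permLoc_mul (σ τ : Equiv.Perm (Fin 3)) (x : ThreeLoc) :
    permLoc (σ * τ) x = permLoc σ (permLoc τ x) := by
  have : permLoc (σ * τ) = (permLoc σ).comp (permLoc τ) := ThreeLoc.ringHom_ext fun F => by
    rw [RingHom.comp_apply, permLoc_toLoc, permLoc_toLoc, permLoc_toLoc,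
      MvPowerSeries.rename_rename]
    rfl
  rw [this, RingHom.comp_apply]

theorem permLoc_one (x : ThreeLoc) : permLoc 1 x = x := by
  have : permLoc 1 = RingHom.id ThreeLoc := ThreeLoc.ringHom_ext fun F => by
    rw [permLoc_toLoc, RingHom.id_apply]
    exact congrArg toLoc (MvPowerSeries.rename_id_apply F)
  rw [this, RingHom.id_apply]

theorem permLoc_injective (σ : Equiv.Perm (Fin 3)) : Function.Injective (permLoc σ) := by
  intro x y h
  rw [← permLoc_one x, ← permLoc_one y, ← inv_mul_cancel σ, permLoc_mul, permLoc_mul, h]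

theorem permLoc_smul (σ : Equiv.Perm (Fin 3)) (c : ℂ) (x : ThreeLoc) :
    permLoc σ (c • x) = c • permLoc σ x := by
  rw [Algebra.smul_def, Algebra.smul_def, map_mul, ← toLoc_C, permLoc_toLoc,
    MvPowerSeries.rename_C]

/-- The action of a permutation of the variables on `ThreeLoc`, as a linear map. -/
def permLocLinear (σ : Equiv.Perm (Fin 3)) : ThreeLoc →ₗ[ℂ] ThreeLoc where
  toFun := permLoc σ
  map_add' := map_add _
  map_smul' := permLoc_smul σ

/-! ### Laurent series in the difference of two variables -/

theorem hasSubst_varDiff (i j : Fin 3) : PowerSeries.HasSubst (varDiff i j) :=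
  PowerSeries.HasSubst.of_constantCoeff_zero (by simp [varDiff])

/-- `F(x) ↦ F(xᵢ - xⱼ)` for power series `F`. -/
def substDiff (i j : Fin 3) : PowerSeries ℂ →ₐ[ℂ] ThreeSeries :=
  PowerSeries.substAlgHom (hasSubst_varDiff i j)

theorem substDiff_apply (i j : Fin 3) (F : PowerSeries ℂ) :
    substDiff i j F = PowerSeries.subst (varDiff i j) F :=
  congrFun (PowerSeries.coe_substAlgHom (hasSubst_varDiff i j)) F

theorem substDiff_X (i j : Fin 3) : substDiff i j PowerSeries.X = varDiff i j := by
  rw [substDiff_apply, PowerSeries.subst_X (hasSubst_varDiff i j)]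

theorem isUnit_toLoc_substDiff {i j : Fin 3} (h : i ≠ j)
    (y : Submonoid.powers (PowerSeries.X : PowerSeries ℂ)) :
    IsUnit ((toLoc.comp (substDiff i j).toRingHom) y) := by
  obtain ⟨_, n, rfl⟩ := y
  have h1 : (toLoc.comp (substDiff i j).toRingHom) PowerSeries.X = toLoc (varDiff i j) :=
    congrArg toLoc (substDiff_X i j)
  rw [map_pow, h1]
  exact (isUnit_toLoc_varDiff h).pow n

/-- `f(x) ↦ f(xᵢ - xⱼ)` for Laurent series `f`. -/
def laurentDiff {i j : Fin 3} (h : i ≠ j) : LaurentSeries ℂ →+* ThreeLoc :=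
  IsLocalization.lift (isUnit_toLoc_substDiff h)

theorem laurentDiff_ofPowerSeries {i j : Fin 3} (h : i ≠ j) (F : PowerSeries ℂ) :
    laurentDiff h (HahnSeries.ofPowerSeries ℤ ℂ F) = toLoc (substDiff i j F) :=
  IsLocalization.lift_eq (isUnit_toLoc_substDiff h) F

theorem laurentDiff_single_one {i j : Fin 3} (h : i ≠ j) :
    laurentDiff h (HahnSeries.single 1 1) = toLoc (varDiff i j) := by
  rw [← HahnSeries.ofPowerSeries_X, laurentDiff_ofPowerSeries, substDiff_X]

theorem laurent_exists_mul_pow (f : LaurentSeries ℂ) :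
    ∃ n : ℕ, ∃ F : PowerSeries ℂ,
      (HahnSeries.single 1 1 : LaurentSeries ℂ) ^ n * f = HahnSeries.ofPowerSeries ℤ ℂ F := by
  obtain ⟨⟨F, _, n, rfl⟩, h⟩ := IsLocalization.surj
    (Submonoid.powers (PowerSeries.X : PowerSeries ℂ)) f
  refine ⟨n, F, ?_⟩
  rw [← HahnSeries.ofPowerSeries_X, ← map_pow, mul_comm]
  exact h

/-- A ring homomorphism on Laurent series which agrees with an additive map on power series agrees
with it everywhere, as soon as the additive map is compatible with multiplication by `x`. -/
theorem laurent_ringHom_eq {R : Type*} [CommRing R] (φ : LaurentSeries ℂ →+* R)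
    (ψ : LaurentSeries ℂ → R)
    (hX : ∀ f, ψ (HahnSeries.single 1 1 * f) = φ (HahnSeries.single 1 1) * ψ f)
    (hpow : ∀ F, φ (HahnSeries.ofPowerSeries ℤ ℂ F) = ψ (HahnSeries.ofPowerSeries ℤ ℂ F))
    (f : LaurentSeries ℂ) : φ f = ψ f := by
  obtain ⟨n, F, h⟩ := laurent_exists_mul_pow f
  have hu : IsUnit (φ (HahnSeries.single 1 1)) := by
    have : IsUnit (HahnSeries.single 1 1 : LaurentSeries ℂ) :=
      (HahnSeries.single_ne_zero one_ne_zero).isUnit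
    exact this.map φ
  have h1 : ∀ n f, ψ ((HahnSeries.single 1 1 : LaurentSeries ℂ) ^ n * f) =
      φ (HahnSeries.single 1 1) ^ n * ψ f := by
    intro n
    induction n with
    | zero => intro f; rw [pow_zero, pow_zero, one_mul, one_mul]
    | succ n ih => intro f; rw [pow_succ, mul_assoc, ih, hX, pow_succ, mul_assoc]
  apply (hu.pow n).mul_left_cancel
  rw [← h1, h, ← hpow, ← h, map_mul, map_pow]

theorem laurentDiff_smul {i j : Fin 3} (h : i ≠ j) (c : ℂ) (f : LaurentSeries ℂ) :
    laurentDiff h (c • f) = c • laurentDiff h f := by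
  rw [← HahnSeries.C_mul_eq_smul, map_mul, ← HahnSeries.ofPowerSeries_C,
    laurentDiff_ofPowerSeries, Algebra.smul_def, ← toLoc_C]
  congr 2
  exact (substDiff i j).commutes c

/-- `f(x) ↦ f(xᵢ - xⱼ)`, as a linear map. -/
def laurentDiffLinear {i j : Fin 3} (h : i ≠ j) : LaurentSeries ℂ →ₗ[ℂ] ThreeLoc where
  toFun := laurentDiff h
  map_add' := map_add _
  map_smul' := laurentDiff_smul h

@[simp]
theorem laurentDiffLinear_apply {i j : Fin 3} (h : i ≠ j) (f : LaurentSeries ℂ) :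
    laurentDiffLinear h f = laurentDiff h f :=
  rfl

theorem laurentDiff_injective {i j : Fin 3} (h : i ≠ j) : Function.Injective (laurentDiff h) :=
  haveI : Nontrivial ThreeLoc := locToIter.domain_nontrivial
  (laurentDiff h).injective

theorem mvSubst_powerSeriesSubst {τ υ : Type*} {a : MvPowerSeries τ ℂ} (ha : PowerSeries.HasSubst a)
    {b : τ → MvPowerSeries υ ℂ} (hb : MvPowerSeries.HasSubst b) (F : PowerSeries ℂ) :
    MvPowerSeries.subst b (PowerSeries.subst a F) =
      PowerSeries.subst (MvPowerSeries.subst b a) F := by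
  rw [PowerSeries.subst_def, PowerSeries.subst_def,
    MvPowerSeries.subst_comp_subst_apply ha.const hb]

theorem permLoc_laurentDiff (σ : Equiv.Perm (Fin 3)) {i j : Fin 3} (h : i ≠ j)
    (f : LaurentSeries ℂ) :
    permLoc σ (laurentDiff h f) = laurentDiff (σ.injective.ne h) f := by
  refine laurent_ringHom_eq ((permLoc σ).comp (laurentDiff h)) (laurentDiff (σ.injective.ne h))
    (fun f => ?_) (fun F => ?_) f
  · rw [map_mul, RingHom.comp_apply, laurentDiff_single_one, laurentDiff_single_one,
      permLoc_toLoc, rename_varDiff]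
  · rw [RingHom.comp_apply, laurentDiff_ofPowerSeries, laurentDiff_ofPowerSeries, permLoc_toLoc,
      substDiff_apply, substDiff_apply, MvPowerSeries.rename_eq_subst,
      mvSubst_powerSeriesSubst (hasSubst_varDiff i j) (MvPowerSeries.HasSubst.X_comp σ),
      ← MvPowerSeries.rename_eq_subst, rename_varDiff]

theorem negVar_single_mul (f : LaurentSeries ℂ) :
    negVar (HahnSeries.single 1 1 * f) = -(HahnSeries.single 1 1 * negVar f) := by
  ext n
  have h : ∀ g : LaurentSeries ℂ, (HahnSeries.single 1 1 * g).coeff n = g.coeff (n - 1) := fun g => by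
    rw [HahnSeries.coeff_single_mul, one_mul]
  rw [HahnSeries.coeff_neg, h]
  change ((n.negOnePow : ℤˣ) : ℤ) • (HahnSeries.single 1 1 * f).coeff n =
    -((((n - 1).negOnePow : ℤˣ) : ℤ) • f.coeff (n - 1))
  rw [h, Int.negOnePow_sub]
  simp

theorem negVar_ofPowerSeries (F : PowerSeries ℂ) :
    negVar (HahnSeries.ofPowerSeries ℤ ℂ F) =
      HahnSeries.ofPowerSeries ℤ ℂ (PowerSeries.rescale (-1) F) := by
  ext n
  change ((n.negOnePow : ℤˣ) : ℤ) • (HahnSeries.ofPowerSeries ℤ ℂ F).coeff n = _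
  rw [PowerSeries.coeff_coe, PowerSeries.coeff_coe]
  split_ifs with hn
  · rw [smul_zero]
  · obtain ⟨m, rfl⟩ := Int.eq_ofNat_of_zero_le (not_lt.mp hn)
    rw [PowerSeries.coeff_rescale, Int.negOnePow_def]
    simp

theorem laurentDiff_negVar {i j : Fin 3} (h : i ≠ j) (f : LaurentSeries ℂ) :
    laurentDiff h (negVar f) = laurentDiff h.symm f := by
  symm
  refine laurent_ringHom_eq (laurentDiff h.symm) (fun f => laurentDiff h (negVar f))
    (fun f => ?_) (fun F => ?_) f
  · rw [negVar_single_mul, map_neg, map_mul, laurentDiff_single_one, laurentDiff_single_one,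
      varDiff_swap i j, map_neg, neg_mul]
  · simp only [negVar_ofPowerSeries]
    rw [laurentDiff_ofPowerSeries, laurentDiff_ofPowerSeries, substDiff_apply, substDiff_apply,
      PowerSeries.rescale_eq_subst, PowerSeries.subst_comp_subst_apply
        (PowerSeries.HasSubst.smul_X' (-1 : ℂ)) (hasSubst_varDiff i j),
      PowerSeries.subst_smul (hasSubst_varDiff i j), PowerSeries.subst_X (hasSubst_varDiff i j),
      varDiff_swap i j, neg_smul, one_smul]

/-! ### Specialization to `ℂ((x))((z))` -/

/-- The embedding of `ℂ[[z,x]]`, with `z` the variable of index `0` and `x` that of index `1`, into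
`ℂ((x))((z))`. -/
def twoSeriesToLaurent : MvPowerSeries (Fin 2) ℂ →+* TwoVarLaurent :=
  (HahnSeries.ofPowerSeries ℤ (LaurentSeries ℂ)).comp
    ((PowerSeries.map ((HahnSeries.ofPowerSeries ℤ ℂ).comp
      (MvPowerSeries.rename (R := ℂ) (fun _ : Fin 1 => ())).toRingHom)).comp
        (MvPowerSeries.finSuccEquiv ℂ 1).toRingEquiv.toRingHom)

theorem coeff_ofPowerSeries_natCast {R : Type*} [Semiring R] (F : PowerSeries R) (n : ℕ) :
    (HahnSeries.ofPowerSeries ℤ R F).coeff n = PowerSeries.coeff n F :=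
  HahnSeries.ofPowerSeries_apply_coeff F n

theorem coeff_ofPowerSeries_of_neg {R : Type*} [Semiring R] (F : PowerSeries R) {n : ℤ}
    (hn : n < 0) : (HahnSeries.ofPowerSeries ℤ R F).coeff n = 0 := by
  rw [PowerSeries.coeff_coe, if_pos hn]

theorem coeff_rename_unit (F : MvPowerSeries (Fin 1) ℂ) (l : ℕ) :
    PowerSeries.coeff l (MvPowerSeries.rename (fun _ : Fin 1 => ()) F) =
      MvPowerSeries.coeff (Finsupp.single 0 l) F := by
  rw [← MvPowerSeries.coeff_embDomain_rename ⟨fun _ : Fin 1 => (), fun _ _ _ =>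
    Subsingleton.elim _ _⟩ F, Finsupp.embDomain_single]
  rfl

theorem twoSeriesToLaurent_coeff_natCast (F : MvPowerSeries (Fin 2) ℂ) (m : ℕ) :
    (twoSeriesToLaurent F).coeff (m : ℤ) = HahnSeries.ofPowerSeries ℤ ℂ
      (PowerSeries.mk fun l => MvPowerSeries.coeff (Finsupp.cons m (Finsupp.single 0 l)) F) := by
  change (HahnSeries.ofPowerSeries ℤ (LaurentSeries ℂ) _).coeff (m : ℤ) = _
  rw [coeff_ofPowerSeries_natCast]
  change (HahnSeries.ofPowerSeries ℤ ℂ) (MvPowerSeries.rename (fun _ : Fin 1 => ())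
    (PowerSeries.coeff m (MvPowerSeries.finSuccEquiv ℂ 1 F))) = _
  congr 1
  ext l
  rw [coeff_rename_unit, MvPowerSeries.coeff_coeff_finSuccEquiv, PowerSeries.coeff_mk]

theorem twoSeriesToLaurent_coeff_of_neg (F : MvPowerSeries (Fin 2) ℂ) {m : ℤ} (hm : m < 0) :
    (twoSeriesToLaurent F).coeff m = 0 :=
  coeff_ofPowerSeries_of_neg _ hm

/-- An element of `ℂ((x))((z))` is the image of a power series if its coefficients are. -/
theorem twoSeriesToLaurent_eq (F : MvPowerSeries (Fin 2) ℂ) (g : TwoVarLaurent)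
    (hneg : ∀ m < 0, g.coeff m = 0) (hneg' : ∀ (m : ℕ), ∀ l < 0, (g.coeff (m : ℤ)).coeff l = 0)
    (h : ∀ m l : ℕ, MvPowerSeries.coeff (Finsupp.cons m (Finsupp.single 0 l)) F =
      (g.coeff (m : ℤ)).coeff (l : ℤ)) : twoSeriesToLaurent F = g := by
  apply HahnSeries.ext
  funext m
  rcases lt_or_ge m 0 with hm | hm
  · rw [twoSeriesToLaurent_coeff_of_neg F hm, hneg m hm]
  obtain ⟨m, rfl⟩ := Int.eq_ofNat_of_zero_le hm
  rw [twoSeriesToLaurent_coeff_natCast]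
  apply HahnSeries.ext
  funext l
  rcases lt_or_ge l 0 with hl | hl
  · rw [coeff_ofPowerSeries_of_neg _ hl, hneg' m l hl]
  obtain ⟨l, rfl⟩ := Int.eq_ofNat_of_zero_le hl
  rw [coeff_ofPowerSeries_natCast, PowerSeries.coeff_mk, h]

theorem inX_coeff_zero (f : LaurentSeries ℂ) : (inX f).coeff 0 = f :=
  HahnSeries.coeff_single_same _ _

theorem inX_coeff_of_ne (f : LaurentSeries ℂ) {m : ℤ} (h : m ≠ 0) : (inX f).coeff m = 0 :=
  HahnSeries.coeff_single_of_ne h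

theorem inZ_coeff (f : LaurentSeries ℂ) (m : ℤ) :
    (inZ f).coeff m = HahnSeries.single 0 (f.coeff m) :=
  rfl

theorem inXplusZ_coeff_natCast (f : LaurentSeries ℂ) (m : ℕ) :
    (inXplusZ f).coeff (m : ℤ) = LaurentSeries.hasseDeriv ℂ m f := by
  change (HahnSeries.ofPowerSeries ℤ (LaurentSeries ℂ) _).coeff (m : ℤ) = _
  rw [coeff_ofPowerSeries_natCast, PowerSeries.coeff_mk]

theorem inXplusZ_coeff_of_neg (f : LaurentSeries ℂ) {m : ℤ} (hm : m < 0) :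
    (inXplusZ f).coeff m = 0 :=
  coeff_ofPowerSeries_of_neg _ hm

/-- The images of `x₁, x₂, x₃` under the substitution `x₁ = x + z`, `x₂ = z`, `x₃ = 0`. -/
def specVars : Fin 3 → MvPowerSeries (Fin 2) ℂ :=
  ![MvPowerSeries.X 0 + MvPowerSeries.X 1, MvPowerSeries.X 0, 0]

theorem hasSubst_specVars : MvPowerSeries.HasSubst specVars := by
  apply MvPowerSeries.hasSubst_of_constantCoeff_zero
  intro s
  fin_cases s <;> simp [specVars]

/-- The substitution `x₁ = x + z`, `x₂ = z`, `x₃ = 0`. -/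
def specSeries : ThreeSeries →+* TwoVarLaurent :=
  twoSeriesToLaurent.comp (MvPowerSeries.substAlgHom hasSubst_specVars).toRingHom

theorem specSeries_apply (F : ThreeSeries) :
    specSeries F = twoSeriesToLaurent (MvPowerSeries.subst specVars F) := by
  rw [← MvPowerSeries.coe_substAlgHom hasSubst_specVars]
  rfl

theorem subst_specVars_varDiff (i j : Fin 3) :
    MvPowerSeries.subst specVars (varDiff i j) = specVars i - specVars j := by
  rw [← MvPowerSeries.coe_substAlgHom hasSubst_specVars, varDiff, map_sub,
    MvPowerSeries.substAlgHom_X, MvPowerSeries.substAlgHom_X]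

theorem subst_specVars_substDiff (i j : Fin 3) (F : PowerSeries ℂ) :
    MvPowerSeries.subst specVars (substDiff i j F) =
      PowerSeries.subst (specVars i - specVars j) F := by
  rw [substDiff_apply, mvSubst_powerSeriesSubst (hasSubst_varDiff i j) hasSubst_specVars,
    subst_specVars_varDiff]

theorem cons_single_apply_zero (m l : ℕ) :
    (Finsupp.cons m (Finsupp.single 0 l) : Fin 2 →₀ ℕ) 0 = m :=
  Finsupp.cons_zero _ _

theorem cons_single_apply_one (m l : ℕ) :
    (Finsupp.cons m (Finsupp.single 0 l) : Fin 2 →₀ ℕ) 1 = l := by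
  have := Finsupp.cons_succ (0 : Fin 1) m (Finsupp.single 0 l)
  simpa using this

theorem twoSeriesToLaurent_subst_X_one (F : PowerSeries ℂ) :
    twoSeriesToLaurent (PowerSeries.subst (MvPowerSeries.X 1 : MvPowerSeries (Fin 2) ℂ) F) =
      inX (HahnSeries.ofPowerSeries ℤ ℂ F) := by
  apply twoSeriesToLaurent_eq
  · intro m hm
    exact inX_coeff_of_ne _ hm.ne
  · intro m l hl
    by_cases hm : m = 0
    · subst hm
      rw [Nat.cast_zero, inX_coeff_zero, coeff_ofPowerSeries_of_neg _ hl]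
    · rw [inX_coeff_of_ne _ (by exact_mod_cast hm), HahnSeries.coeff_zero]
  · intro m l
    rw [PowerSeries.coeff_subst_single, cons_single_apply_one]
    by_cases hm : m = 0
    · subst hm
      rw [if_pos, Nat.cast_zero, inX_coeff_zero, coeff_ofPowerSeries_natCast]
      ext i
      fin_cases i
      · simp
      · simp [cons_single_apply_one]
    · rw [inX_coeff_of_ne _ (by exact_mod_cast hm), HahnSeries.coeff_zero, if_neg]
      intro h
      apply hm
      have := DFunLike.congr_fun h 0
      simpa using this

theorem twoSeriesToLaurent_subst_X_zero (F : PowerSeries ℂ) :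
    twoSeriesToLaurent (PowerSeries.subst (MvPowerSeries.X 0 : MvPowerSeries (Fin 2) ℂ) F) =
      inZ (HahnSeries.ofPowerSeries ℤ ℂ F) := by
  apply twoSeriesToLaurent_eq
  · intro m hm
    rw [inZ_coeff, coeff_ofPowerSeries_of_neg _ hm, HahnSeries.single_eq_zero]
  · intro m l hl
    rw [inZ_coeff, HahnSeries.coeff_single_of_ne hl.ne]
  · intro m l
    rw [PowerSeries.coeff_subst_single, cons_single_apply_zero, inZ_coeff,
      coeff_ofPowerSeries_natCast, HahnSeries.coeff_single]
    congr 1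
    refine propext ⟨fun h => ?_, fun h => ?_⟩
    · have := DFunLike.congr_fun h 1
      rw [cons_single_apply_one] at this
      simp [this]
    · have hl : l = 0 := by exact_mod_cast h
      subst hl
      ext i
      fin_cases i
      · simp
      · exact (cons_single_apply_one m 0).trans (by simp)

theorem twoSeriesToLaurent_subst_add (F : PowerSeries ℂ) :
    twoSeriesToLaurent (PowerSeries.subst
      (MvPowerSeries.X 0 + MvPowerSeries.X 1 : MvPowerSeries (Fin 2) ℂ) F) =
      inXplusZ (HahnSeries.ofPowerSeries ℤ ℂ F) := by
  apply twoSeriesToLaurent_eq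
  · intro m hm
    exact inXplusZ_coeff_of_neg _ hm
  · intro m l hl
    rw [inXplusZ_coeff_natCast, LaurentSeries.hasseDeriv_coeff]
    rcases lt_or_ge (l + m) 0 with h | h
    · rw [coeff_ofPowerSeries_of_neg _ h, smul_zero]
    · obtain ⟨k, hk⟩ := Int.eq_ofNat_of_zero_le h
      rw [hk, Ring.choose_natCast, Nat.choose_eq_zero_of_lt (by omega), Nat.cast_zero, zero_smul]
  · intro m l
    rw [PowerSeries.coeff_subst_X_zero_add_X_one, cons_single_apply_zero, cons_single_apply_one,
      inXplusZ_coeff_natCast, LaurentSeries.hasseDeriv_coeff, ← Nat.cast_add,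
      coeff_ofPowerSeries_natCast, Ring.choose_natCast, add_comm m l]
    simp

theorem specSeries_substDiff_zero_one (F : PowerSeries ℂ) :
    specSeries (substDiff 0 1 F) = inX (HahnSeries.ofPowerSeries ℤ ℂ F) := by
  rw [specSeries_apply, subst_specVars_substDiff, ← twoSeriesToLaurent_subst_X_one]
  simp [specVars]

theorem specSeries_substDiff_one_two (F : PowerSeries ℂ) :
    specSeries (substDiff 1 2 F) = inZ (HahnSeries.ofPowerSeries ℤ ℂ F) := by
  rw [specSeries_apply, subst_specVars_substDiff, ← twoSeriesToLaurent_subst_X_zero]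
  simp [specVars]

theorem specSeries_substDiff_zero_two (F : PowerSeries ℂ) :
    specSeries (substDiff 0 2 F) = inXplusZ (HahnSeries.ofPowerSeries ℤ ℂ F) := by
  rw [specSeries_apply, subst_specVars_substDiff, ← twoSeriesToLaurent_subst_add]
  simp [specVars]

theorem inX_single : inX (HahnSeries.single 1 1) = HahnSeries.single 0 (HahnSeries.single 1 1) :=
  rfl

theorem inZ_single : inZ (HahnSeries.single 1 1) = HahnSeries.single 1 1 := by
  apply HahnSeries.ext
  funext m
  rw [inZ_coeff, HahnSeries.coeff_single, HahnSeries.coeff_single]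
  split_ifs
  · rfl
  · rw [HahnSeries.single_eq_zero]

theorem specSeries_varDiff_zero_one : specSeries (varDiff 0 1) =
    HahnSeries.single 0 (HahnSeries.single 1 1) := by
  rw [← substDiff_X, specSeries_substDiff_zero_one, HahnSeries.ofPowerSeries_X, inX_single]

theorem specSeries_varDiff_one_two : specSeries (varDiff 1 2) = HahnSeries.single 1 1 := by
  rw [← substDiff_X, specSeries_substDiff_one_two, HahnSeries.ofPowerSeries_X, inZ_single]

theorem specSeries_varDiff_zero_two : specSeries (varDiff 0 2) =
    HahnSeries.single 0 (HahnSeries.single 1 1) + HahnSeries.single 1 1 := by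
  rw [← specSeries_varDiff_zero_one, ← specSeries_varDiff_one_two, ← map_add]
  congr 1
  simp [varDiff]

theorem inX_single_mul (f : LaurentSeries ℂ) :
    inX (HahnSeries.single 1 1 * f) = specSeries (varDiff 0 1) * inX f := by
  rw [specSeries_varDiff_zero_one]
  apply HahnSeries.ext
  funext m
  rw [HahnSeries.coeff_single_zero_mul]
  by_cases h : m = 0
  · subst h
    rw [inX_coeff_zero, inX_coeff_zero]
  · rw [inX_coeff_of_ne _ h, inX_coeff_of_ne _ h, mul_zero]

theorem inZ_single_mul (f : LaurentSeries ℂ) :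
    inZ (HahnSeries.single 1 1 * f) = specSeries (varDiff 1 2) * inZ f := by
  rw [specSeries_varDiff_one_two]
  apply HahnSeries.ext
  funext m
  rw [HahnSeries.coeff_single_mul, one_mul, inZ_coeff, inZ_coeff, HahnSeries.coeff_single_mul,
    one_mul]

theorem inXplusZ_single_mul (f : LaurentSeries ℂ) :
    inXplusZ (HahnSeries.single 1 1 * f) = specSeries (varDiff 0 2) * inXplusZ f := by
  rw [specSeries_varDiff_zero_two]
  refine Eq.trans ?_ (@Distrib.right_distrib TwoVarLaurent HahnSeries.instDistrib _ _ _).symm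
  apply HahnSeries.ext
  funext m
  rw [HahnSeries.coeff_add, HahnSeries.coeff_single_zero_mul, HahnSeries.coeff_single_mul, one_mul]
  rcases lt_or_ge m 0 with hm | hm
  · rw [inXplusZ_coeff_of_neg _ hm, inXplusZ_coeff_of_neg _ hm,
      inXplusZ_coeff_of_neg _ (by omega), mul_zero, add_zero]
  obtain ⟨m, rfl⟩ := Int.eq_ofNat_of_zero_le hm
  rw [inXplusZ_coeff_natCast, inXplusZ_coeff_natCast]
  apply HahnSeries.ext
  funext l
  rw [HahnSeries.coeff_add, HahnSeries.coeff_single_mul, LaurentSeries.hasseDeriv_coeff,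
    LaurentSeries.hasseDeriv_coeff, HahnSeries.coeff_single_mul, one_mul, one_mul]
  rcases m with _ | m
  · rw [inXplusZ_coeff_of_neg _ (by simp)]
    simp
  · have h1 : ((m + 1 : ℕ) : ℤ) - 1 = (m : ℤ) := by push_cast; ring
    rw [h1, inXplusZ_coeff_natCast, LaurentSeries.hasseDeriv_coeff]
    have h2 : l + ((m + 1 : ℕ) : ℤ) - 1 = l + m := by push_cast; ring
    have h3 : l - 1 + ((m + 1 : ℕ) : ℤ) = l + m := by push_cast; ring
    have h4 : l + ((m + 1 : ℕ) : ℤ) = (l + m) + 1 := by push_cast; ring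
    rw [h2, h3, h4, Ring.choose_succ_succ, add_smul, add_comm]

/-- `ℂ((x))((z))` as a field. This is a separate type so that its ring structure is always the one
underlying the field structure. -/
def TwoVarField : Type := TwoVarLaurent

instance : Field TwoVarField := inferInstanceAs (Field (HahnSeries ℤ (LaurentSeries ℂ)))

/-- The substitution `x₁ = x + z`, `x₂ = z`, `x₃ = 0`, with values in a field. -/
def specSeriesField : ThreeSeries →+* TwoVarField where
  toFun := specSeries
  map_one' := map_one specSeries
  map_mul' := map_mul specSeries
  map_zero' := map_zero specSeries
  map_add' := map_add specSeries

theorem isUnit_specSeries_discr : IsUnit (specSeriesField discr) := by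
  have hx : specSeriesField (varDiff 0 1) ≠ 0 := by
    change specSeries (varDiff 0 1) ≠ 0
    rw [specSeries_varDiff_zero_one]
    exact HahnSeries.single_ne_zero (HahnSeries.single_ne_zero one_ne_zero)
  have hz : specSeriesField (varDiff 1 2) ≠ 0 := by
    change specSeries (varDiff 1 2) ≠ 0
    rw [specSeries_varDiff_one_two]
    exact HahnSeries.single_ne_zero one_ne_zero
  have hxz : specSeriesField (varDiff 0 2) ≠ 0 := by
    change specSeries (varDiff 0 2) ≠ 0
    rw [specSeries_varDiff_zero_two]
    intro h
    have := congrArg (fun g : TwoVarLaurent => g.coeff 0) h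
    simp only [HahnSeries.coeff_add, HahnSeries.coeff_zero] at this
    rw [HahnSeries.coeff_single_same, HahnSeries.coeff_single_of_ne (by simp), add_zero] at this
    exact HahnSeries.single_ne_zero one_ne_zero this
  rw [discr, map_mul, map_mul]
  exact (mul_ne_zero (mul_ne_zero hx hxz) hz).isUnit

/-- The specialization `x₁ = x + z`, `x₂ = z`, `x₃ = 0` of elements of `ThreeLoc`. -/
def specLoc : ThreeLoc →+* TwoVarField :=
  IsLocalization.Away.lift discr isUnit_specSeries_discr

theorem specLoc_toLoc (F : ThreeSeries) : specLoc (toLoc F) = specSeries F :=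
  IsLocalization.Away.lift_eq discr isUnit_specSeries_discr F

theorem specLoc_laurentDiff_zero_one (h : (0 : Fin 3) ≠ 1) (f : LaurentSeries ℂ) :
    specLoc (laurentDiff h f) = inX f := by
  refine laurent_ringHom_eq (specLoc.comp (laurentDiff h)) inX (fun f => ?_) (fun F => ?_) f
  · rw [RingHom.comp_apply, laurentDiff_single_one, specLoc_toLoc]
    exact inX_single_mul f
  · rw [RingHom.comp_apply, laurentDiff_ofPowerSeries, specLoc_toLoc, specSeries_substDiff_zero_one]

theorem specLoc_laurentDiff_one_two (h : (1 : Fin 3) ≠ 2) (f : LaurentSeries ℂ) :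
    specLoc (laurentDiff h f) = inZ f := by
  refine laurent_ringHom_eq (specLoc.comp (laurentDiff h)) inZ (fun f => ?_) (fun F => ?_) f
  · rw [RingHom.comp_apply, laurentDiff_single_one, specLoc_toLoc]
    exact inZ_single_mul f
  · rw [RingHom.comp_apply, laurentDiff_ofPowerSeries, specLoc_toLoc, specSeries_substDiff_one_two]

theorem specLoc_laurentDiff_zero_two (h : (0 : Fin 3) ≠ 2) (f : LaurentSeries ℂ) :
    specLoc (laurentDiff h f) = inXplusZ f := by
  refine laurent_ringHom_eq (specLoc.comp (laurentDiff h)) inXplusZ (fun f => ?_) (fun F => ?_) f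
  · rw [RingHom.comp_apply, laurentDiff_single_one, specLoc_toLoc]
    exact inXplusZ_single_mul f
  · rw [RingHom.comp_apply, laurentDiff_ofPowerSeries, specLoc_toLoc, specSeries_substDiff_zero_two]

/-- The specialization of elements of `ThreeLoc`, as a linear map. -/
def specLocLinear : ThreeLoc →ₗ[ℂ] TwoVarLaurent where
  toFun := specLoc
  map_add' := map_add specLoc
  map_smul' c x := by
    refine Eq.trans ?_ (twoVar_smul_eq c (specLoc x)).symm
    rw [Algebra.smul_def, ← toLoc_C]
    refine (map_mul specLoc _ _).trans ?_
    have h1 : MvPowerSeries.C c = substDiff 0 1 (PowerSeries.C c) :=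
      ((substDiff 0 1).commutes c).symm
    rw [specLoc_toLoc, h1, specSeries_substDiff_zero_one, HahnSeries.ofPowerSeries_C]
    rfl

/-! ### Locality of a weak quantum vertex algebra -/

/-- The coefficient of `x^α y^β` in `F(x - y) h(x,y)`, for `F` a power series and `h` a series with
coefficients `h α β`. -/
def binomSum (F : PowerSeries ℂ) (h : ℤ → ℤ → ℂ) (α β : ℤ) : ℂ :=
  ∑ᶠ k : ℕ × ℕ, (PowerSeries.coeff (k.1 + k.2) F * (((k.1 + k.2).choose k.1 : ℂ) * (-1) ^ k.1)) *
    h (α - k.2) (β - k.1)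

section Locality

variable {V : Type u} [AddCommGroup V] [Module ℂ V]

/-- The coefficient of `x^α y^β` in the matrix coefficient `μ(Y(a,x) Y(b,y) c)`. -/
def VertexData.twoPoint (A : VertexData V) (μ : V →ₗ[ℂ] ℂ) (a b c : V) (α β : ℤ) : ℂ :=
  μ (A.prod (-α - 1) a (A.prod (-β - 1) b c))

/-- The coefficients of `(x-y)^p Y(a,x) Y(b,y) c` are those of the first term of the Jacobi identity. -/
theorem VertexData.binomSum_X_pow (A : VertexData V) (μ : V →ₗ[ℂ] ℂ) (a b c : V) (p : ℕ)
    (α β : ℤ) : binomSum (PowerSeries.X ^ p) (A.twoPoint μ a b c) α β =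
      μ (A.jacobiFirst a b c p (-α - 1) (-β - 1)) := by
  classical
  rw [binomSum, finsum_eq_sum_of_support_subset (s := Finset.HasAntidiagonal.antidiagonal p),
    VertexData.jacobiFirst, finsum_eq_sum_of_support_subset (s := Finset.range (p + 1)), map_sum,
    Finset.Nat.sum_antidiagonal_eq_sum_range_succ_mk]
  · refine Finset.sum_congr rfl fun i hi => ?_
    have hip : i ≤ p := Nat.lt_succ_iff.mp (Finset.mem_range.mp hi)
    rw [PowerSeries.coeff_X_pow, if_pos (by simp; omega), map_zsmul, VertexData.twoPoint]
    simp only [Nat.add_sub_cancel' hip, Ring.choose_natCast]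
    have h1 : -(α - ((p - i : ℕ) : ℤ)) - 1 = (p : ℤ) + (-α - 1) - i := by
      rw [Nat.cast_sub hip]
      ring
    have h2 : -(β - (i : ℤ)) - 1 = -β - 1 + i := by ring
    rw [h1, h2, zsmul_eq_mul]
    push_cast
    ring
  · intro i hi
    rw [Finset.coe_range, Set.mem_Iio, Nat.lt_succ_iff]
    by_contra hlt
    apply hi
    simp only [Ring.choose_natCast]
    rw [Nat.choose_eq_zero_of_lt (by omega), Nat.cast_zero, mul_zero, zero_smul]
  · intro k hk
    rw [Finset.mem_coe, Finset.HasAntidiagonal.mem_antidiagonal]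
    by_contra hne
    apply hk
    simp only [PowerSeries.coeff_X_pow, if_neg hne, zero_mul]

theorem VertexData.jacobiSecond_finite (A : VertexData V) (b a : V) (f : LaurentSeries ℂ) (c : V)
    (p q r : ℤ) : (Function.support fun k : ℕ × ℤ =>
      (((((-1 : ℤ) ^ k.1 * Ring.choose (p + k.2) k.1 : ℤ) : ℂ)) * f.coeff k.2) •
        A.prod (p + r + k.2 - k.1) b (A.prod (q + k.1) a c)).Finite := by
  obtain ⟨N, hN⟩ := A.trunc a c
  choose M hM using fun k : ℕ => A.trunc b (A.prod (q + k) a c)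
  refine Set.Finite.subset (Finset.finite_toSet ((Finset.range (N - q).toNat).biUnion fun k =>
    (Finset.Ico f.order (M k - p - r + k)).image (Prod.mk k))) ?_
  rintro ⟨k, j⟩ hk
  rw [Function.mem_support] at hk
  have h1 : A.prod (p + r + j - k) b (A.prod (q + k) a c) ≠ 0 := fun h => hk (by
    simp only [h, smul_zero])
  have h2 : f.coeff j ≠ 0 := fun h => hk (by simp only [h, mul_zero, zero_smul])
  have h3 : q + k < N := by
    by_contra hlt
    exact h1 (by rw [hN _ (not_lt.mp hlt), map_zero])
  have h4 : p + r + j - k < M k := by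
    by_contra hlt
    exact h1 (hM k _ (not_lt.mp hlt))
  have h5 : f.order ≤ j := HahnSeries.order_le_of_coeff_ne_zero h2
  rw [Finset.mem_coe, Finset.mem_biUnion]
  refine ⟨k, Finset.mem_range.mpr (by omega), ?_⟩
  rw [Finset.mem_image]
  exact ⟨j, Finset.mem_Ico.mpr ⟨h5, by omega⟩, rfl⟩

/-- The coefficients of `(x-y)^p f(y-x) Y(b,y) Y(a,x) c` are those of the second term of the Jacobi
identity. The series `(x-y)^p f(y-x)` is `G(y-x)` with `G = (-x)^p f(x)`, a power series by `hf`. -/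
theorem VertexData.binomSum_shift (A : VertexData V) (μ : V →ₗ[ℂ] ℂ) (b a c : V)
    (f : LaurentSeries ℂ) (p : ℕ) (hf : ∀ j : ℤ, f.coeff j ≠ 0 → 0 ≤ p + j) (α β : ℤ) :
    binomSum (PowerSeries.mk fun n => (-1) ^ p * f.coeff (n - p)) (A.twoPoint μ b a c) β α =
      μ (A.jacobiSecond b a f c p (-α - 1) (-β - 1)) := by
  have hinj : Function.Injective fun k : ℕ × ℕ => ((k.1, (k.1 + k.2 : ℕ) - (p : ℤ)) : ℕ × ℤ) := by
    rintro ⟨k, m⟩ ⟨k', m'⟩ h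
    simp only [Prod.mk.injEq] at h
    ext <;> simp <;> omega
  have hfin := AddMonoidHom.map_finsum μ.toAddMonoidHom
    (A.jacobiSecond_finite b a f c p (-α - 1) (-β - 1))
  simp only [LinearMap.toAddMonoidHom_coe] at hfin
  rw [VertexData.jacobiSecond, map_zsmul, hfin,
    finsum_eq_of_support_subset_range _ hinj, smul_finsum, binomSum]
  · refine finsum_congr fun k => ?_
    obtain ⟨k, m⟩ := k
    simp only [PowerSeries.coeff_mk, map_smul, VertexData.twoPoint]
    have h0 : (p : ℤ) + (((k + m : ℕ) : ℤ) - (p : ℤ)) = ((k + m : ℕ) : ℤ) := by ring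
    have h1 : (p : ℤ) + (-β - 1) + (((k + m : ℕ) : ℤ) - (p : ℤ)) - k = -(β - m) - 1 := by
      push_cast
      ring
    have h2 : -α - 1 + (k : ℤ) = -(α - k) - 1 := by ring
    rw [h0, h1, h2, Ring.choose_natCast, Int.negOnePow_def]
    simp only [zsmul_eq_mul, smul_eq_mul, zpow_natCast]
    push_cast
    ring
  · rintro ⟨k, j⟩ hk
    rw [Function.mem_support] at hk
    simp only [map_smul] at hk
    have h2 : f.coeff j ≠ 0 := fun h => hk (by simp only [h, mul_zero, zero_smul])
    obtain ⟨n, hn⟩ := Int.eq_ofNat_of_zero_le (hf j h2)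
    have h3 : k ≤ n := by
      by_contra hlt
      apply hk
      rw [hn, Ring.choose_natCast, Nat.choose_eq_zero_of_lt (by omega)]
      simp
    refine ⟨(k, n - k), ?_⟩
    simp only [Prod.mk.injEq, true_and]
    omega

theorem VertexData.jacobiThird_eq_zero (A : VertexData V) (a b c : V) {p : ℤ}
    (hp : ∀ n : ℤ, p ≤ n → A.prod n a b = 0) (q r : ℤ) : A.jacobiThird a b c p q r = 0 := by
  rw [VertexData.jacobiThird]
  refine finsum_eq_zero_of_forall_eq_zero fun i => ?_
  rw [hp _ (by omega)]
  simp

/-- Locality: for large `p`,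
`(x-y)^p Y(a,x) Y(b,y) = ∑ᵢ (x-y)^p fᵢ(y-x) Y(b⁽ⁱ⁾,y) Y(a⁽ⁱ⁾,x)`, where `Gᵢ(y-x)` is the power series
`(x-y)^p fᵢ(y-x)`. -/
theorem VertexData.SJacobi.locality {A : VertexData V} {a b : V} {s : TwoTensorLaurent V}
    (h : A.SJacobi a b s) : ∃ (n : ℕ) (b' a' : Fin n → V) (f : Fin n → LaurentSeries ℂ),
      s = ∑ i, (b' i ⊗ₜ[ℂ] a' i) ⊗ₜ[ℂ] f i ∧
      ∃ p₀ : ℕ, ∀ p ≥ p₀, ∃ G : Fin n → PowerSeries ℂ,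
        (∀ i, HahnSeries.ofPowerSeries ℤ ℂ (G i) = (-HahnSeries.single 1 1) ^ p * f i) ∧
        ∀ (μ : V →ₗ[ℂ] ℂ) (c : V) (α β : ℤ),
          binomSum (PowerSeries.X ^ p) (A.twoPoint μ a b c) α β =
            ∑ i, binomSum (G i) (A.twoPoint μ (b' i) (a' i) c) β α := by
  obtain ⟨n, b', a', f, hs, hJ⟩ := h
  refine ⟨n, b', a', f, hs, ?_⟩
  obtain ⟨N, hN⟩ := A.trunc a b
  let d : ℕ := Finset.univ.sup fun i => (-(f i).order).toNat
  refine ⟨max N.toNat d, fun p hp => ?_⟩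
  have hd : ∀ i (j : ℤ), (f i).coeff j ≠ 0 → 0 ≤ p + j := fun i j hj => by
    have h1 := HahnSeries.order_le_of_coeff_ne_zero hj
    have h2 := Finset.le_sup (f := fun i => (-(f i).order).toNat) (Finset.mem_univ i)
    have h3 : d ≤ p := (le_max_right _ _).trans hp
    simp only [d] at h3
    omega
  refine ⟨fun i => PowerSeries.mk fun n => (-1) ^ p * (f i).coeff (n - p), fun i => ?_, ?_⟩
  · have h1 : (-HahnSeries.single 1 1 : LaurentSeries ℂ) ^ p =
        HahnSeries.single (p : ℤ) ((-1) ^ p) := by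
      rw [← HahnSeries.single_neg, HahnSeries.single_pow]
      simp
    rw [h1]
    ext m
    rw [HahnSeries.coeff_single_mul, PowerSeries.coeff_coe]
    split_ifs with hm
    · by_contra hne
      have := hd i (m - p) fun h => hne (by rw [h, mul_zero])
      omega
    · obtain ⟨m, rfl⟩ := Int.eq_ofNat_of_zero_le (not_lt.mp hm)
      rw [PowerSeries.coeff_mk]
      rfl
  · intro μ c α β
    rw [A.binomSum_X_pow]
    simp only [fun i => A.binomSum_shift μ (b' i) (a' i) c (f i) p (hd i) α β]
    rw [← map_sum, ← sub_eq_zero, ← map_sub, hJ c p (-α - 1) (-β - 1),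
      A.jacobiThird_eq_zero a b c (fun n hn => hN n (by
        have : N.toNat ≤ p := (le_max_left _ _).trans hp
        omega)), map_zero]

end Locality

/-! ### Multiplication by power series in a difference of variables -/

theorem coeff_varDiff_pow (i j : Fin 3) (d : ℕ) (m : Fin 3 →₀ ℕ) :
    MvPowerSeries.coeff m (varDiff i j ^ d) =
      ∑ k ∈ Finset.HasAntidiagonal.antidiagonal d,
        if m = Finsupp.single j k.1 + Finsupp.single i k.2 then
          (d.choose k.1 : ℂ) * (-1) ^ k.1 else 0 := by
  classical
  have h1 : varDiff i j = -MvPowerSeries.X j + MvPowerSeries.X i := by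
    rw [varDiff]
    ring
  rw [h1, (Commute.all _ _).add_pow', map_sum]
  refine Finset.sum_congr rfl fun k _ => ?_
  have h2 : (-MvPowerSeries.X j : ThreeSeries) ^ k.1 * MvPowerSeries.X i ^ k.2 =
      MvPowerSeries.monomial (Finsupp.single j k.1 + Finsupp.single i k.2) ((-1) ^ k.1) := by
    rw [neg_pow, MvPowerSeries.X_pow_eq, MvPowerSeries.X_pow_eq, mul_assoc,
      MvPowerSeries.monomial_mul_monomial, mul_one]
    have h3 : (-1 : ThreeSeries) ^ k.1 = MvPowerSeries.C ((-1) ^ k.1) := by simp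
    rw [h3, ← MvPowerSeries.smul_eq_C_mul, ← map_smul, smul_eq_mul, mul_one]
  rw [h2, map_nsmul, MvPowerSeries.coeff_monomial, nsmul_eq_mul]
  split_ifs <;> simp

theorem coeff_substDiff {i j : Fin 3} (hij : i ≠ j) (G : PowerSeries ℂ) (k : ℕ × ℕ) :
    MvPowerSeries.coeff (Finsupp.single j k.1 + Finsupp.single i k.2) (substDiff i j G) =
      PowerSeries.coeff (k.1 + k.2) G * (((k.1 + k.2).choose k.1 : ℂ) * (-1) ^ k.1) := by
  classical
  have hinj : ∀ k' : ℕ × ℕ, Finsupp.single j k.1 + Finsupp.single i k.2 =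
      Finsupp.single j k'.1 + Finsupp.single i k'.2 ↔ k = k' := by
    intro k'
    refine ⟨fun h => ?_, fun h => by rw [h]⟩
    have h1 := DFunLike.congr_fun h i
    have h2 := DFunLike.congr_fun h j
    simp [hij, hij.symm] at h1 h2
    exact Prod.ext h2 h1
  rw [substDiff_apply, PowerSeries.coeff_subst (hasSubst_varDiff i j)]
  simp only [coeff_varDiff_pow, hinj]
  rw [finsum_eq_single _ (k.1 + k.2)]
  · rw [Finset.sum_ite_eq, if_pos (Finset.HasAntidiagonal.mem_antidiagonal.mpr rfl), smul_eq_mul]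
  · intro d hd
    rw [Finset.sum_ite_eq, if_neg (by
      rw [Finset.HasAntidiagonal.mem_antidiagonal]
      exact hd.symm), smul_zero]

theorem coeff_substDiff_of_ne {i j : Fin 3} (G : PowerSeries ℂ) (m : Fin 3 →₀ ℕ)
    (hm : ∀ k : ℕ × ℕ, m ≠ Finsupp.single j k.1 + Finsupp.single i k.2) :
    MvPowerSeries.coeff m (substDiff i j G) = 0 := by
  rw [substDiff_apply, PowerSeries.coeff_subst (hasSubst_varDiff i j)]
  simp only [coeff_varDiff_pow, hm, if_false, Finset.sum_const_zero, smul_zero, finsum_zero]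

/-- Multiplication of an iterated Laurent series by `G(xᵢ - xⱼ)`. -/
theorem substDiff_mul_coeff {i j : Fin 3} (hij : i ≠ j) (G : PowerSeries ℂ) (W : IterLaurent 3)
    (g : Fin 3 → ℤ) (h : ℤ → ℤ → ℂ)
    (hh : ∀ k : ℕ × ℕ, W.coeff (expoOf (g - Pi.single j (k.1 : ℤ) - Pi.single i (k.2 : ℤ))) =
      h (g i - k.2) (g j - k.1)) :
    (powerToIter 3 (substDiff i j G) * W).coeff (expoOf g) = binomSum G h (g i) (g j) := by
  have hinj : Function.Injective fun k : ℕ × ℕ =>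
      (Finsupp.single j k.1 + Finsupp.single i k.2 : Fin 3 →₀ ℕ) := by
    intro k k' h
    have h1 := DFunLike.congr_fun h i
    have h2 := DFunLike.congr_fun h j
    simp [hij, hij.symm] at h1 h2
    exact Prod.ext h2 h1
  rw [powerToIter_mul_coeff, finsum_eq_of_support_subset_range _ hinj, binomSum]
  · refine finsum_congr fun k => ?_
    rw [coeff_substDiff hij, ← hh]
    congr 2
    have : natExpo (Finsupp.single j k.1 + Finsupp.single i k.2) =
        expoOf (Pi.single j (k.1 : ℤ) + Pi.single i (k.2 : ℤ)) := by
      rw [natExpo]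
      congr 1
      funext l
      simp [Finsupp.single_apply, Pi.single_apply, eq_comm]
    rw [this, ← map_sub, sub_sub]
  · intro m hm
    by_contra hne
    apply hm
    simp only [coeff_substDiff_of_ne G m fun k hk => hne ⟨k, hk.symm⟩, zero_mul]

/-! ### Permuting the variables of iterated Laurent series -/

/-- The series `f` arises from `g` by the permutation `xᵢ ↦ x_{σ i}` of the variables. This is a
relation between formal series: `f` and `g` are in the same field `ℂ((x₁))⋯((xₙ))`, which is not
stable under permutations. -/
def Permuted {n : ℕ} (σ : Equiv.Perm (Fin n)) (f g : IterLaurent n) : Prop :=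
  ∀ e : Fin n → ℤ, f.coeff (expoOf e) = g.coeff (expoOf (e ∘ σ))

/-- The exponents of `xᵢ` in `f` are nonnegative. -/
def NonnegAt {n : ℕ} (i : Fin n) (f : IterLaurent n) : Prop :=
  ∀ e : Fin n → ℤ, e i < 0 → f.coeff (expoOf e) = 0

section Permuted

variable {n : ℕ} {σ : Equiv.Perm (Fin n)} {i : Fin n} {f g f' g' : IterLaurent n}

theorem Permuted.mul (h : Permuted σ f g) (h' : Permuted σ f' g') :
    Permuted σ (f * f') (g * g') := by
  intro e
  rw [HahnSeries.coeff_mul_eq_finsum, HahnSeries.coeff_mul_eq_finsum,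
    ← finsum_comp_equiv expoOf.toEquiv,
    ← finsum_comp_equiv ((Equiv.arrowCongr σ.symm (Equiv.refl ℤ)).trans
      (expoOf (n := n)).toEquiv)]
  refine finsum_congr fun v => congrArg₂ _ (h v) ?_
  change f'.coeff (expoOf e - expoOf v) = g'.coeff (expoOf (e ∘ σ) - expoOf (v ∘ σ))
  rw [← map_sub, ← map_sub, h' (e - v)]
  rfl

theorem NonnegAt.mul (h : NonnegAt i f) (h' : NonnegAt i f') : NonnegAt i (f * f') := by
  intro e he
  rw [HahnSeries.coeff_mul_eq_finsum, ← finsum_comp_equiv expoOf.toEquiv]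
  refine finsum_eq_zero_of_forall_eq_zero fun v => ?_
  change f.coeff (expoOf v) * f'.coeff (expoOf e - expoOf v) = 0
  rw [← map_sub]
  rcases lt_or_ge (v i) 0 with hv | hv
  · rw [h v hv, zero_mul]
  · rw [h' (e - v) (by simp only [Pi.sub_apply]; omega), mul_zero]

theorem NonnegAt.sum {ι : Type*} {s : Finset ι} {f : ι → IterLaurent n}
    (h : ∀ k ∈ s, NonnegAt i (f k)) : NonnegAt i (∑ k ∈ s, f k) := by
  intro e he
  rw [HahnSeries.coeff_sum]
  exact Finset.sum_eq_zero fun k hk => h k hk e he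

theorem NonnegAt.permuted (h : Permuted σ f g) (hg : NonnegAt i g) : NonnegAt (σ i) f :=
  fun e he => (h e).trans (hg _ he)

theorem nonnegAt_powerToIter (i : Fin n) (F : MvPowerSeries (Fin n) ℂ) :
    NonnegAt i (powerToIter n F) := fun e he =>
  powerToIter_coeff_of_notMem F _ fun h => absurd ((mem_range_natExpo e).mp h i) (not_le.mpr he)

theorem mem_range_powerToIter_of_nonnegAt (h : ∀ i, NonnegAt i f) :
    f ∈ Set.range (powerToIter n) := by
  refine mem_range_powerToIter f fun e he => ?_
  obtain ⟨e, rfl⟩ := expoOf.surjective e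
  rw [mem_range_natExpo] at he
  push Not at he
  obtain ⟨i, hi⟩ := he
  exact h i e hi

theorem permuted_powerToIter (σ : Equiv.Perm (Fin n)) (F : MvPowerSeries (Fin n) ℂ) :
    Permuted σ (powerToIter n (MvPowerSeries.rename σ F)) (powerToIter n F) := by
  intro e
  by_cases h : expoOf (e ∘ σ) ∈ Set.range (natExpo (n := n))
  · obtain ⟨m, hm⟩ := h
    have h1 : expoOf e = natExpo (Finsupp.embDomain σ.toEmbedding m) := by
      rw [natExpo]
      congr 1
      funext i
      obtain ⟨i, rfl⟩ := σ.surjective i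
      have h2 := congrFun (expoOf.injective hm) i
      have h3 : Finsupp.embDomain σ.toEmbedding m (σ i) = m i :=
        Finsupp.embDomain_apply_self _ _ _
      rw [h3]
      exact h2.symm
    rw [h1, ← hm, powerToIter_coeff, powerToIter_coeff]
    exact MvPowerSeries.coeff_embDomain_rename σ.toEmbedding F m
  · rw [powerToIter_coeff_of_notMem _ _ h, powerToIter_coeff_of_notMem]
    rw [mem_range_natExpo] at h ⊢
    exact fun h' => h fun i => h' (σ i)

theorem eq_rename_of_permuted {F G : MvPowerSeries (Fin n) ℂ}
    (h : Permuted σ (powerToIter n F) (powerToIter n G)) : F = MvPowerSeries.rename σ G := by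
  apply powerToIter_injective n
  ext e
  obtain ⟨e, rfl⟩ := expoOf.surjective e
  rw [h e, permuted_powerToIter σ G e]

end Permuted

/-- Two elements of `ThreeLoc` whose expansions are related by a permutation of the variables are
themselves so related, although the permutation does not preserve the region of expansion. -/
theorem eq_permLoc_of_permuted {σ : Equiv.Perm (Fin 3)} {x y : ThreeLoc}
    (h : Permuted σ (locToIter x) (locToIter y)) : x = permLoc σ y := by
  obtain ⟨n, F, -, hF⟩ := x.exists_mul_pow 0
  obtain ⟨m, G, -, hG⟩ := y.exists_mul_pow 0
  -- multiplication by `D`, resp. its preimage under `σ`, clears the denominators of `x`, resp. `y`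
  let D' : ThreeSeries := MvPowerSeries.rename σ.symm (discr ^ n) * discr ^ m
  let D : ThreeSeries := MvPowerSeries.rename σ D'
  have hD : D = discr ^ n * MvPowerSeries.rename σ (discr ^ m) := by
    simp only [D, D', map_mul]
    rw [MvPowerSeries.rename_rename]
    congr 1
    have : (σ ∘ σ.symm : Fin 3 → Fin 3) = id := by
      funext i
      simp
    simp [this]
  have hx : toLoc D * x = toLoc (MvPowerSeries.rename σ (discr ^ m) * F) := by
    rw [hD, map_mul, map_mul, ← hF, map_pow]
    ring
  have hy : toLoc D' * y = toLoc (MvPowerSeries.rename σ.symm (discr ^ n) * G) := by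
    rw [map_mul, map_mul, ← hG, map_pow toLoc discr m]
    ring
  have h1 := (permuted_powerToIter σ D').mul h
  rw [← locToIter_toLoc, ← locToIter_toLoc, ← map_mul, ← map_mul, hy] at h1
  change Permuted σ (locToIter (toLoc D * x)) _ at h1
  rw [hx, locToIter_toLoc, locToIter_toLoc] at h1
  have hu : IsUnit (toLoc D) := by
    rw [hD, map_mul, map_pow, map_pow, map_pow]
    exact ((IsLocalization.Away.algebraMap_isUnit discr).pow n).mul
      ((isUnit_toLoc_rename_discr σ).pow m)
  apply hu.mul_left_cancel
  rw [hx, eq_rename_of_permuted h1, ← permLoc_toLoc, ← hy, map_mul, permLoc_toLoc]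

/-- `eq_permLoc_of_permuted` in the form in which locality provides it: both sides are multiplied by
`(xᵢ - xⱼ)^p`, which is invertible in `ThreeLoc`. -/
theorem eq_permLoc_of_permuted_mul {ι : Type*} [Fintype ι] {i j : Fin 3} (hij : i ≠ j) (p : ℕ)
    {x : ThreeLoc} {y : ι → ThreeLoc} {f : ι → LaurentSeries ℂ} {G : ι → PowerSeries ℂ}
    (hG : ∀ k, HahnSeries.ofPowerSeries ℤ ℂ (G k) = (-HahnSeries.single 1 1) ^ p * f k)
    (h : Permuted (Equiv.swap i j) (powerToIter 3 (substDiff i j (PowerSeries.X ^ p)) * locToIter x)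
      (∑ k, powerToIter 3 (substDiff i j (G k)) * locToIter (y k))) :
    x = permLoc (Equiv.swap i j) (∑ k, laurentDiff hij (f k) * y k) := by
  have h1 : Permuted (Equiv.swap i j) (locToIter (toLoc (substDiff i j (PowerSeries.X ^ p)) * x))
      (locToIter (∑ k, toLoc (substDiff i j (G k)) * y k)) := by
    simpa only [map_sum, map_mul, locToIter_toLoc] using h
  have h2 := eq_permLoc_of_permuted h1
  have h3 : ∑ k, toLoc (substDiff i j (G k)) * y k =
      toLoc (varDiff j i) ^ p * ∑ k, laurentDiff hij (f k) * y k := by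
    rw [Finset.mul_sum]
    refine Finset.sum_congr rfl fun k _ => ?_
    rw [← laurentDiff_ofPowerSeries hij, hG, map_mul, map_pow, map_neg, laurentDiff_single_one,
      varDiff_swap i j, map_neg, mul_assoc]
  rw [h3, map_mul, map_pow (permLoc _), permLoc_toLoc, rename_varDiff, Equiv.swap_apply_left,
    Equiv.swap_apply_right, map_pow, substDiff_X, map_pow] at h2
  exact ((isUnit_toLoc_varDiff hij).pow p).mul_left_cancel h2

/-! ### Correlators of three vectors as rational functions -/

section ThreePoint

variable {V : Type u} [AddCommGroup V] [Module ℂ V] (A : VertexData V)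

/-- The matrix coefficient `μ(Y(a,x₁) Y(b,x₂) Y(c,x₃) 𝟏)`. -/
def VertexData.threePoint (μ : V →ₗ[ℂ] ℂ) (a b c : V) : IterLaurent 3 :=
  hahnPair (Expo 3) μ (A.correlatorMap 3 ![a, b, c])

theorem VertexData.threePoint_coeff (μ : V →ₗ[ℂ] ℂ) (a b c : V) (g : Fin 3 → ℤ) :
    (A.threePoint μ a b c).coeff (expoOf g) =
      μ (A.prod (-g 0 - 1) a (A.prod (-g 1 - 1) b (A.prod (-g 2 - 1) c A.vac))) :=
  rfl

theorem VertexData.substDiff_mul_threePoint_left (μ : V →ₗ[ℂ] ℂ) (a b c : V) (G : PowerSeries ℂ)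
    (g : Fin 3 → ℤ) : (powerToIter 3 (substDiff 0 1 G) * A.threePoint μ a b c).coeff (expoOf g) =
      binomSum G (A.twoPoint μ a b (A.prod (-g 2 - 1) c A.vac)) (g 0) (g 1) := by
  refine substDiff_mul_coeff (by decide) G _ g _ fun k => ?_
  rw [VertexData.threePoint_coeff]
  simp [VertexData.twoPoint]

theorem VertexData.substDiff_mul_threePoint_right (μ : V →ₗ[ℂ] ℂ) (a b c : V) (G : PowerSeries ℂ)
    (g : Fin 3 → ℤ) : (powerToIter 3 (substDiff 1 2 G) * A.threePoint μ a b c).coeff (expoOf g) =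
      binomSum G (A.twoPoint (μ ∘ₗ A.prod (-g 0 - 1) a) b c A.vac) (g 1) (g 2) := by
  refine substDiff_mul_coeff (by decide) G _ g _ fun k => ?_
  rw [VertexData.threePoint_coeff]
  simp [VertexData.twoPoint]

variable {A}

/-- Locality of the first two operators in a correlator. -/
theorem VertexData.permuted_left {ι : Type*} [Fintype ι] {a b : V} {b' a' : ι → V} {p : ℕ}
    {G : ι → PowerSeries ℂ} (h : ∀ (μ : V →ₗ[ℂ] ℂ) (c : V) (α β : ℤ),
      binomSum (PowerSeries.X ^ p) (A.twoPoint μ a b c) α β =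
        ∑ i, binomSum (G i) (A.twoPoint μ (b' i) (a' i) c) β α) (μ : V →ₗ[ℂ] ℂ) (c : V) :
    Permuted (Equiv.swap 0 1)
      (powerToIter 3 (substDiff 0 1 (PowerSeries.X ^ p)) * A.threePoint μ a b c)
      (∑ i, powerToIter 3 (substDiff 0 1 (G i)) * A.threePoint μ (b' i) (a' i) c) := by
  intro e
  rw [VertexData.substDiff_mul_threePoint_left, h, HahnSeries.coeff_sum]
  refine Finset.sum_congr rfl fun i _ => ?_
  rw [VertexData.substDiff_mul_threePoint_left]
  rfl

/-- Locality of the last two operators in a correlator. -/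
theorem VertexData.permuted_right {ι : Type*} [Fintype ι] {b c : V} {c' b' : ι → V} {p : ℕ}
    {G : ι → PowerSeries ℂ} (h : ∀ (μ : V →ₗ[ℂ] ℂ) (d : V) (α β : ℤ),
      binomSum (PowerSeries.X ^ p) (A.twoPoint μ b c d) α β =
        ∑ i, binomSum (G i) (A.twoPoint μ (c' i) (b' i) d) β α) (μ : V →ₗ[ℂ] ℂ) (a : V) :
    Permuted (Equiv.swap 1 2)
      (powerToIter 3 (substDiff 1 2 (PowerSeries.X ^ p)) * A.threePoint μ a b c)
      (∑ i, powerToIter 3 (substDiff 1 2 (G i)) * A.threePoint μ a (c' i) (b' i)) := by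
  intro e
  rw [VertexData.substDiff_mul_threePoint_right, h, HahnSeries.coeff_sum]
  refine Finset.sum_congr rfl fun i _ => ?_
  rw [VertexData.substDiff_mul_threePoint_right]
  rfl

variable (hA : A.IsWeakQuantumVertexAlgebra)
include hA

/-- By the creation property, correlators have no pole in the last variable. -/
theorem VertexData.nonnegAt_two (μ : V →ₗ[ℂ] ℂ) (a b c : V) :
    NonnegAt 2 (A.threePoint μ a b c) := by
  intro e he
  rw [VertexData.threePoint_coeff, hA.creation_regular _ c (by omega)]
  simp

/-- The pole in `x₂` is removed by a power of `x₂ - x₃`, because locality moves the second operator to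
the last place. The power does not depend on the first vector. -/
theorem VertexData.nonnegAt_one (b c : V) : ∃ l₀ : ℕ, ∀ l ≥ l₀, ∀ (μ : V →ₗ[ℂ] ℂ) (a : V),
    NonnegAt 1 (powerToIter 3 (varDiff 1 2 ^ l) * A.threePoint μ a b c) := by
  obtain ⟨s, hs⟩ := hA.sJacobi b c
  obtain ⟨n, c', b', f, -, l₀, hl₀⟩ := hs.locality
  refine ⟨l₀, fun l hl μ a => ?_⟩
  obtain ⟨G, -, hG⟩ := hl₀ l hl
  have h := VertexData.permuted_right hG μ a
  rw [map_pow, substDiff_X] at h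
  exact NonnegAt.permuted (i := 2) h (NonnegAt.sum fun i _ =>
    (nonnegAt_powerToIter 2 _).mul (VertexData.nonnegAt_two hA μ a (c' i) (b' i)))

/-- The pole in `x₁` is removed by powers of `x₁ - x₂` and `x₁ - x₃`. -/
theorem VertexData.nonnegAt_zero (a b c : V) : ∃ p l : ℕ, ∀ μ : V →ₗ[ℂ] ℂ,
    NonnegAt 0 (powerToIter 3 (varDiff 0 2 ^ l * varDiff 0 1 ^ p) * A.threePoint μ a b c) := by
  obtain ⟨s, hs⟩ := hA.sJacobi a b
  obtain ⟨n, b', a', f, -, p, hp⟩ := hs.locality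
  obtain ⟨G, -, hG⟩ := hp p le_rfl
  choose l hl using fun i => VertexData.nonnegAt_one hA (a' i) c
  refine ⟨p, Finset.univ.sup l, fun μ => ?_⟩
  have h := (permuted_powerToIter (Equiv.swap 0 1) (varDiff 1 2 ^ Finset.univ.sup l)).mul
    (VertexData.permuted_left hG μ c)
  rw [map_pow, rename_varDiff, map_pow (substDiff 0 1), substDiff_X, ← mul_assoc, ← map_mul,
    Finset.mul_sum] at h
  refine NonnegAt.permuted (i := 1) h (NonnegAt.sum fun i _ => ?_)
  rw [mul_left_comm]
  exact (nonnegAt_powerToIter 1 _).mul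
    (hl i _ (Finset.le_sup (f := l) (Finset.mem_univ i)) μ (b' i))

/-- The matrix coefficients of the correlators of three vectors are expansions of elements of
`ℂ[[x₁,x₂,x₃]][(x₁-x₂)⁻¹,(x₁-x₃)⁻¹,(x₂-x₃)⁻¹]`. -/
theorem VertexData.threePoint_mem_range (μ : V →ₗ[ℂ] ℂ) (a b c : V) :
    A.threePoint μ a b c ∈ Set.range locToIter := by
  obtain ⟨p, l, h0⟩ := VertexData.nonnegAt_zero hA a b c
  obtain ⟨m, h1⟩ := VertexData.nonnegAt_one hA b c
  let D : ThreeSeries := varDiff 1 2 ^ m * (varDiff 0 2 ^ l * varDiff 0 1 ^ p)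
  have hD : ∀ i, NonnegAt i (powerToIter 3 D * A.threePoint μ a b c) := by
    intro i
    fin_cases i
    · simp only [D]
      rw [map_mul, mul_assoc]
      exact (nonnegAt_powerToIter 0 _).mul (h0 μ)
    · simp only [D]
      rw [mul_comm (varDiff 1 2 ^ m), map_mul, mul_assoc]
      exact (nonnegAt_powerToIter 1 _).mul (h1 m le_rfl μ a)
    · exact (nonnegAt_powerToIter 2 _).mul (VertexData.nonnegAt_two hA μ a b c)
  obtain ⟨F, hF⟩ := mem_range_powerToIter_of_nonnegAt hD
  have hu : IsUnit (toLoc D) := by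
    simp only [D, map_mul, map_pow]
    exact ((isUnit_toLoc_varDiff (by decide)).pow m).mul
      (((isUnit_toLoc_varDiff (by decide)).pow l).mul ((isUnit_toLoc_varDiff (by decide)).pow p))
  obtain ⟨x, hx⟩ := hu.dvd (a := toLoc F)
  refine ⟨x, ?_⟩
  apply (hu.map locToIter).mul_left_cancel
  rw [← map_mul, ← hx, locToIter_toLoc, locToIter_toLoc, hF]

end ThreePoint

/-! ### Continuation of the three-point correlators -/

section Continuation

variable {V : Type u} [AddCommGroup V] [Module ℂ V] {A : VertexData V}

variable (A) in
/-- `a ⊗ b ⊗ c ↦ μ(Y(a,x₁) Y(b,x₂) Y(c,x₃) 𝟏)`. -/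
def VertexData.threePointLinear (μ : V →ₗ[ℂ] ℂ) : ThreeTensor V →ₗ[ℂ] IterLaurent 3 :=
  TensorProduct.lift (TensorProduct.lift (LinearMap.mk₂ ℂ
    (fun a b =>
      { toFun := fun c => A.threePoint μ a b c
        map_add' := fun c c' => by
          ext e
          obtain ⟨e, rfl⟩ := expoOf.surjective e
          simp [VertexData.threePoint_coeff]
        map_smul' := fun t c => by
          ext e
          obtain ⟨e, rfl⟩ := expoOf.surjective e
          simp [VertexData.threePoint_coeff] })
    (fun a a' b => by
      ext c e
      obtain ⟨e, rfl⟩ := expoOf.surjective e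
      simp [VertexData.threePoint_coeff])
    (fun t a b => by
      ext c e
      obtain ⟨e, rfl⟩ := expoOf.surjective e
      simp [VertexData.threePoint_coeff])
    (fun a b b' => by
      ext c e
      obtain ⟨e, rfl⟩ := expoOf.surjective e
      simp [VertexData.threePoint_coeff])
    (fun t a b => by
      ext c e
      obtain ⟨e, rfl⟩ := expoOf.surjective e
      simp [VertexData.threePoint_coeff])))

theorem VertexData.threePointLinear_tmul (μ : V →ₗ[ℂ] ℂ) (a b c : V) :
    A.threePointLinear μ ((a ⊗ₜ b) ⊗ₜ c) = A.threePoint μ a b c :=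
  rfl

theorem VertexData.threePointLinear_mem_range (hA : A.IsWeakQuantumVertexAlgebra)
    (μ : V →ₗ[ℂ] ℂ) (t : ThreeTensor V) :
    A.threePointLinear μ t ∈ LinearMap.range locToIterLinear := by
  induction t using TensorProduct.induction_on with
  | zero => rw [map_zero]; exact zero_mem _
  | add x y hx hy => rw [map_add]; exact add_mem hx hy
  | tmul t c =>
    induction t using TensorProduct.induction_on with
    | zero => rw [TensorProduct.zero_tmul, map_zero]; exact zero_mem _
    | add x y hx hy => rw [TensorProduct.add_tmul, map_add]; exact add_mem hx hy
    | tmul a b => exact VertexData.threePoint_mem_range hA μ a b c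

/-- The matrix coefficient `μ(Y(a,x₁) Y(b,x₂) Y(c,x₃) 𝟏)` as an element of `ThreeLoc`, that is,
before its expansion in the region `|x₁| > |x₂| > |x₃|`. -/
def VertexData.corr (hA : A.IsWeakQuantumVertexAlgebra) (μ : V →ₗ[ℂ] ℂ) :
    ThreeTensor V →ₗ[ℂ] ThreeLoc :=
  (LinearEquiv.ofInjective locToIterLinear locToIter_injective).symm.toLinearMap ∘ₗ
    LinearMap.codRestrict _ (A.threePointLinear μ) (VertexData.threePointLinear_mem_range hA μ)

variable (hA : A.IsWeakQuantumVertexAlgebra)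

theorem VertexData.locToIter_corr (μ : V →ₗ[ℂ] ℂ) (t : ThreeTensor V) :
    locToIter (VertexData.corr hA μ t) = A.threePointLinear μ t := by
  have h := (LinearEquiv.ofInjective locToIterLinear locToIter_injective).apply_symm_apply
    (LinearMap.codRestrict _ (A.threePointLinear μ)
      (VertexData.threePointLinear_mem_range hA μ) t)
  exact congrArg Subtype.val h

/-- The `ThreeLoc`-linear extension of `VertexData.corr`. -/
def VertexData.corrExt (μ : V →ₗ[ℂ] ℂ) : ThreeTensor V ⊗[ℂ] ThreeLoc →ₗ[ℂ] ThreeLoc :=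
  LinearMap.mul' ℂ ThreeLoc ∘ₗ LinearMap.rTensor ThreeLoc (VertexData.corr hA μ)

@[simp]
theorem VertexData.corrExt_tmul (μ : V →ₗ[ℂ] ℂ) (t : ThreeTensor V) (r : ThreeLoc) :
    VertexData.corrExt hA μ (t ⊗ₜ r) = VertexData.corr hA μ t * r :=
  rfl

/-- If the correlators of triples of basis vectors are linearly independent, then the functions
`VertexData.corrExt`, for varying `μ`, separate the elements of `V ⊗ V ⊗ V ⊗ ThreeLoc`. -/
theorem VertexData.eq_of_corrExt {ι : Type*} (b : Module.Basis ι ℂ V)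
    (hb : LinearIndependent (IterLaurent 3)
      (fun I : Fin 3 → ι => A.correlatorMap 3 (fun i => b (I i))))
    {x y : ThreeTensor V ⊗[ℂ] ThreeLoc}
    (h : ∀ μ, VertexData.corrExt hA μ x = VertexData.corrExt hA μ y) : x = y := by
  classical
  rw [← sub_eq_zero]
  generalize hz : x - y = z
  replace h : ∀ μ, VertexData.corrExt hA μ z = 0 := fun μ => by
    rw [← hz, map_sub, h μ, sub_self]
  let B := (b.tensorProduct b).tensorProduct b
  let r := TensorProduct.equivFinsuppOfBasisLeft (N := ThreeLoc) B z
  have hzr : z = r.sum fun I s => B I ⊗ₜ[ℂ] s := by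
    rw [← TensorProduct.equivFinsuppOfBasisLeft_symm_apply]
    exact (LinearEquiv.symm_apply_apply _ _).symm
  let J : (ι × ι) × ι → Fin 3 → ι := fun I => ![I.1.1, I.1.2, I.2]
  have hJ : Function.Injective J := by
    rintro ⟨⟨i, j⟩, k⟩ ⟨⟨i', j'⟩, k'⟩ h
    have h0 := congrFun h 0
    have h1 := congrFun h 1
    have h2 := congrFun h 2
    simp only [J, Matrix.cons_val] at h0 h1 h2
    rw [h0, h1, h2]
  have hB : ∀ I μ, locToIter (VertexData.corr hA μ (B I)) =
      hahnPair (Expo 3) μ (A.correlatorMap 3 fun i => b (J I i)) := by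
    rintro ⟨⟨i, j⟩, k⟩ μ
    rw [VertexData.locToIter_corr]
    simp only [B, Module.Basis.tensorProduct_apply]
    rw [VertexData.threePointLinear_tmul, VertexData.threePoint]
    congr 2
  have hsum : ∑ I ∈ r.support, locToIter (r I) • A.correlatorMap 3 (fun i => b (J I i)) = 0 := by
    apply eq_zero_of_hahnPair
    intro μ
    have h1 := congrArg locToIter (h μ)
    rw [hzr, Finsupp.sum, map_sum, map_sum, map_zero] at h1
    rw [map_sum, ← h1]
    refine Finset.sum_congr rfl fun I _ => ?_
    rw [map_smul, VertexData.corrExt_tmul, map_mul, hB, smul_eq_mul, mul_comm]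
  have h0 := linearIndependent_iff'.mp (hb.comp J hJ) r.support (fun I => locToIter (r I)) hsum
  rw [hzr, Finsupp.sum]
  refine Finset.sum_eq_zero fun I hI => ?_
  rw [locToIter_injective ((h0 I hI).trans (map_zero _).symm), TensorProduct.tmul_zero]

end Continuation

/-! ### Operators acting on two of three tensor factors -/

section Legs

variable {V : Type u} [AddCommGroup V] [Module ℂ V] {R R' : Type*} [AddCommMonoid R] [Module ℂ R]
  [AddCommMonoid R'] [Module ℂ R']

/-- `(y ⊗ z) ⊗ f ↦ (y ⊗ z ⊗ c) ⊗ σ(f)`. -/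
def insertRight (σ : LaurentSeries ℂ →ₗ[ℂ] R) (c : V) :
    TwoTensorLaurent V →ₗ[ℂ] ThreeTensor V ⊗[ℂ] R :=
  TensorProduct.map ((TensorProduct.mk ℂ (V ⊗[ℂ] V) V).flip c) σ

@[simp]
theorem insertRight_tmul (σ : LaurentSeries ℂ →ₗ[ℂ] R) (c : V) (t : V ⊗[ℂ] V)
    (f : LaurentSeries ℂ) : insertRight σ c (t ⊗ₜ f) = (t ⊗ₜ c) ⊗ₜ σ f :=
  rfl

/-- `(y ⊗ z) ⊗ f ↦ (a ⊗ y ⊗ z) ⊗ σ(f)`. -/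
def insertLeft (σ : LaurentSeries ℂ →ₗ[ℂ] R) (a : V) :
    TwoTensorLaurent V →ₗ[ℂ] ThreeTensor V ⊗[ℂ] R :=
  TensorProduct.map ((TensorProduct.assoc ℂ V V V).symm.toLinearMap ∘ₗ
    TensorProduct.mk ℂ V (V ⊗[ℂ] V) a) σ

@[simp]
theorem insertLeft_tmul (σ : LaurentSeries ℂ →ₗ[ℂ] R) (a y z : V)
    (f : LaurentSeries ℂ) : insertLeft σ a ((y ⊗ₜ z) ⊗ₜ f) = ((a ⊗ₜ y) ⊗ₜ z) ⊗ₜ σ f :=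
  rfl

/-- `S₁₂`, with the variable of `S` sent to a space `R` by `σ`. -/
def legOneTwo (S : V ⊗[ℂ] V →ₗ[ℂ] TwoTensorLaurent V) (σ : LaurentSeries ℂ →ₗ[ℂ] R) :
    ThreeTensor V →ₗ[ℂ] ThreeTensor V ⊗[ℂ] R :=
  (TensorProduct.rightComm ℂ (V ⊗[ℂ] V) R V).toLinearMap ∘ₗ
    LinearMap.rTensor V (LinearMap.lTensor (V ⊗[ℂ] V) σ ∘ₗ S)

/-- `S₁₃`, with the variable of `S` sent to a space `R` by `σ`. -/
def legOneThree (S : V ⊗[ℂ] V →ₗ[ℂ] TwoTensorLaurent V) (σ : LaurentSeries ℂ →ₗ[ℂ] R) :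
    ThreeTensor V →ₗ[ℂ] ThreeTensor V ⊗[ℂ] R :=
  LinearMap.rTensor R (TensorProduct.rightComm ℂ V V V).toLinearMap ∘ₗ
    legOneTwo S σ ∘ₗ (TensorProduct.rightComm ℂ V V V).toLinearMap

/-- `S₂₃`, with the variable of `S` sent to a space `R` by `σ`. -/
def legTwoThree (S : V ⊗[ℂ] V →ₗ[ℂ] TwoTensorLaurent V) (σ : LaurentSeries ℂ →ₗ[ℂ] R) :
    ThreeTensor V →ₗ[ℂ] ThreeTensor V ⊗[ℂ] R :=
  LinearMap.rTensor R (TensorProduct.assoc ℂ V V V).symm.toLinearMap ∘ₗ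
    (TensorProduct.assoc ℂ V (V ⊗[ℂ] V) R).symm.toLinearMap ∘ₗ
    LinearMap.lTensor V (LinearMap.lTensor (V ⊗[ℂ] V) σ ∘ₗ S) ∘ₗ
    (TensorProduct.assoc ℂ V V V).toLinearMap

variable (S : V ⊗[ℂ] V →ₗ[ℂ] TwoTensorLaurent V) (σ : LaurentSeries ℂ →ₗ[ℂ] R)

theorem legOneTwo_tmul (t : V ⊗[ℂ] V) (c : V) :
    legOneTwo S σ (t ⊗ₜ c) = insertRight σ c (S t) := by
  change TensorProduct.rightComm ℂ (V ⊗[ℂ] V) R V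
    (LinearMap.lTensor (V ⊗[ℂ] V) σ (S t) ⊗ₜ[ℂ] c) = _
  generalize S t = x
  induction x using TensorProduct.induction_on with
  | zero => simp
  | add x y hx hy => rw [map_add, TensorProduct.add_tmul, map_add, hx, hy, map_add]
  | tmul t f => simp

theorem legTwoThree_tmul (a b c : V) :
    legTwoThree S σ ((a ⊗ₜ b) ⊗ₜ c) = insertLeft σ a (S (b ⊗ₜ c)) := by
  change LinearMap.rTensor R (TensorProduct.assoc ℂ V V V).symm.toLinearMap
    ((TensorProduct.assoc ℂ V (V ⊗[ℂ] V) R).symm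
      (a ⊗ₜ[ℂ] LinearMap.lTensor (V ⊗[ℂ] V) σ (S (b ⊗ₜ c)))) = _
  generalize S (b ⊗ₜ c) = x
  induction x using TensorProduct.induction_on with
  | zero => simp
  | add x y hx hy => rw [map_add, TensorProduct.tmul_add, map_add, map_add, hx, hy, map_add]
  | tmul t f => rfl

theorem legOneThree_tmul (a b c : V) :
    legOneThree S σ ((a ⊗ₜ b) ⊗ₜ c) =
      LinearMap.rTensor R (TensorProduct.rightComm ℂ V V V).toLinearMap
        (insertRight σ b (S (a ⊗ₜ c))) := by
  rw [← legOneTwo_tmul]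
  rfl

variable {S σ}

theorem threeTensor_hom_ext {W : Type*} [AddCommMonoid W] [Module ℂ W] {f g : ThreeTensor V →ₗ[ℂ] W}
    (h : ∀ a b c, f ((a ⊗ₜ b) ⊗ₜ c) = g ((a ⊗ₜ b) ⊗ₜ c)) (t : ThreeTensor V) : f t = g t := by
  have : f = g := TensorProduct.ext_threefold h
  rw [this]

theorem twoTensorLaurent_hom_ext {W : Type*} [AddCommMonoid W] [Module ℂ W]
    {f g : TwoTensorLaurent V →ₗ[ℂ] W}
    (h : ∀ a b c, f ((a ⊗ₜ b) ⊗ₜ c) = g ((a ⊗ₜ b) ⊗ₜ c)) (t : TwoTensorLaurent V) : f t = g t := by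
  have : f = g := TensorProduct.ext_threefold h
  rw [this]

theorem lTensor_insertRight (σ : LaurentSeries ℂ →ₗ[ℂ] R) (ρ : R →ₗ[ℂ] R') (c : V) (x : TwoTensorLaurent V) :
    LinearMap.lTensor _ ρ (insertRight σ c x) = insertRight (ρ ∘ₗ σ) c x :=
  twoTensorLaurent_hom_ext (f := LinearMap.lTensor _ ρ ∘ₗ insertRight σ c)
    (g := insertRight (ρ ∘ₗ σ) c) (fun _ _ _ => rfl) x

theorem lTensor_insertLeft (σ : LaurentSeries ℂ →ₗ[ℂ] R) (ρ : R →ₗ[ℂ] R') (c : V) (x : TwoTensorLaurent V) :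
    LinearMap.lTensor _ ρ (insertLeft σ c x) = insertLeft (ρ ∘ₗ σ) c x :=
  twoTensorLaurent_hom_ext (f := LinearMap.lTensor _ ρ ∘ₗ insertLeft σ c)
    (g := insertLeft (ρ ∘ₗ σ) c) (fun _ _ _ => rfl) x

theorem lTensor_legOneTwo (ρ : R →ₗ[ℂ] R') (t : ThreeTensor V) :
    LinearMap.lTensor _ ρ (legOneTwo S σ t) = legOneTwo S (ρ ∘ₗ σ) t := by
  refine threeTensor_hom_ext (f := LinearMap.lTensor _ ρ ∘ₗ legOneTwo S σ) (fun a b c => ?_) t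
  rw [LinearMap.comp_apply, legOneTwo_tmul, legOneTwo_tmul, lTensor_insertRight]

theorem lTensor_legTwoThree (ρ : R →ₗ[ℂ] R') (t : ThreeTensor V) :
    LinearMap.lTensor _ ρ (legTwoThree S σ t) = legTwoThree S (ρ ∘ₗ σ) t := by
  refine threeTensor_hom_ext (f := LinearMap.lTensor _ ρ ∘ₗ legTwoThree S σ) (fun a b c => ?_) t
  rw [LinearMap.comp_apply, legTwoThree_tmul, legTwoThree_tmul, lTensor_insertLeft]

theorem lTensor_legOneThree (ρ : R →ₗ[ℂ] R') (t : ThreeTensor V) :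
    LinearMap.lTensor _ ρ (legOneThree S σ t) = legOneThree S (ρ ∘ₗ σ) t := by
  change LinearMap.lTensor _ ρ (LinearMap.rTensor _ _ (legOneTwo S σ _)) =
    LinearMap.rTensor _ _ (legOneTwo S (ρ ∘ₗ σ) _)
  rw [← lTensor_legOneTwo]
  exact DFunLike.congr_fun ((LinearMap.lTensor_comp_rTensor _ _ _).trans
    (LinearMap.rTensor_comp_lTensor _ _ _).symm) _

end Legs

section ExtendScalars

variable {N : Type*} {M : Type*} {R : Type*} [AddCommGroup N] [Module ℂ N]
  [AddCommGroup M] [Module ℂ M] [CommRing R] [Module ℂ R] [IsScalarTower ℂ R R]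
  [SMulCommClass ℂ R R]
  {N' : Type*} {M' : Type*} {R' : Type*} [AddCommGroup N'] [Module ℂ N']
  [AddCommGroup M'] [Module ℂ M'] [CommRing R'] [Module ℂ R'] [IsScalarTower ℂ R' R']
  [SMulCommClass ℂ R' R']

theorem extendScalars_tmul (T : N →ₗ[ℂ] M ⊗[ℂ] R) (n : N) (r : R) :
    extendScalars T (n ⊗ₜ r) = LinearMap.lTensor M ((LinearMap.mul ℂ R).flip r) (T n) := by
  change LinearMap.lTensor M (LinearMap.mul' ℂ R) (TensorProduct.assoc ℂ M R R (T n ⊗ₜ r)) = _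
  generalize T n = x
  induction x using TensorProduct.induction_on with
  | zero => simp
  | add x y hx hy => rw [TensorProduct.add_tmul, map_add, map_add, hx, hy, map_add]
  | tmul m s => rfl

theorem extendScalars_tmul_one (T : N →ₗ[ℂ] M ⊗[ℂ] R) (n : N) : extendScalars T (n ⊗ₜ 1) = T n := by
  have : (LinearMap.mul ℂ R).flip 1 = LinearMap.id := by
    ext r
    exact mul_one r
  rw [extendScalars_tmul, this, LinearMap.lTensor_id, LinearMap.id_apply]

/-- Naturality of the extension of scalars. -/
theorem map_extendScalars {P : N →ₗ[ℂ] N'} {Q : M →ₗ[ℂ] M'} {s : R →ₗ[ℂ] R'}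
    (hs : ∀ r r', s (r * r') = s r * s r') {T : N →ₗ[ℂ] M ⊗[ℂ] R} {T' : N' →ₗ[ℂ] M' ⊗[ℂ] R'}
    (h : ∀ n, TensorProduct.map Q s (T n) = T' (P n)) (x : N ⊗[ℂ] R) :
    TensorProduct.map Q s (extendScalars T x) = extendScalars T' (TensorProduct.map P s x) := by
  induction x using TensorProduct.induction_on with
  | zero => simp
  | add x y hx hy => rw [map_add, map_add, hx, hy, map_add, map_add]
  | tmul n r =>
    rw [extendScalars_tmul, TensorProduct.map_tmul, extendScalars_tmul, ← h]
    generalize T n = y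
    induction y using TensorProduct.induction_on with
    | zero => simp
    | add x y hx hy => rw [map_add, map_add, hx, hy, map_add, map_add]
    | tmul m r' => simp [hs]

theorem lTensor_extendScalars {s : R →ₗ[ℂ] R'} (hs : ∀ r r', s (r * r') = s r * s r')
    {T : N →ₗ[ℂ] M ⊗[ℂ] R} {T' : N →ₗ[ℂ] M ⊗[ℂ] R'} (h : ∀ n, LinearMap.lTensor M s (T n) = T' n)
    (x : N ⊗[ℂ] R) :
    LinearMap.lTensor M s (extendScalars T x) = extendScalars T' (LinearMap.lTensor N s x) :=
  map_extendScalars (P := LinearMap.id) (Q := LinearMap.id) hs h x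

end ExtendScalars

/-! ### Simultaneous exchange of tensor factors and variables -/

section Exchange

variable {V : Type u} [AddCommGroup V] [Module ℂ V]

theorem zero_ne_one_three : (0 : Fin 3) ≠ 1 := by decide

theorem one_ne_two_three : (1 : Fin 3) ≠ 2 := by decide

theorem zero_ne_two_three : (0 : Fin 3) ≠ 2 := by decide

/-- `f(x) ↦ f(x₁ - x₂)`. -/
abbrev diffOneTwo : LaurentSeries ℂ →ₗ[ℂ] ThreeLoc := laurentDiffLinear zero_ne_one_three

/-- `f(x) ↦ f(x₂ - x₃)`. -/
abbrev diffTwoThree : LaurentSeries ℂ →ₗ[ℂ] ThreeLoc := laurentDiffLinear one_ne_two_three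

/-- `f(x) ↦ f(x₁ - x₃)`. -/
abbrev diffOneThree : LaurentSeries ℂ →ₗ[ℂ] ThreeLoc := laurentDiffLinear zero_ne_two_three

variable (V) in
/-- `a ⊗ b ⊗ c ↦ b ⊗ a ⊗ c`. -/
def flipOneTwo : ThreeTensor V →ₗ[ℂ] ThreeTensor V :=
  LinearMap.rTensor V (TensorProduct.comm ℂ V V).toLinearMap

variable (V) in
/-- `a ⊗ b ⊗ c ↦ a ⊗ c ⊗ b`. -/
def flipTwoThree : ThreeTensor V →ₗ[ℂ] ThreeTensor V :=
  (TensorProduct.rightComm ℂ V V V).toLinearMap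

variable (V) in
/-- The simultaneous exchange of the first two tensor factors and of the first two variables. -/
def exchangeOneTwo : ThreeTensor V ⊗[ℂ] ThreeLoc →ₗ[ℂ] ThreeTensor V ⊗[ℂ] ThreeLoc :=
  TensorProduct.map (flipOneTwo V) (permLocLinear (Equiv.swap 0 1))

variable (V) in
/-- The simultaneous exchange of the last two tensor factors and of the last two variables. -/
def exchangeTwoThree : ThreeTensor V ⊗[ℂ] ThreeLoc →ₗ[ℂ] ThreeTensor V ⊗[ℂ] ThreeLoc :=
  TensorProduct.map (flipTwoThree V) (permLocLinear (Equiv.swap 1 2))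

theorem threeTensorLoc_hom_ext {W : Type*} [AddCommMonoid W] [Module ℂ W]
    {f g : ThreeTensor V ⊗[ℂ] ThreeLoc →ₗ[ℂ] W}
    (h : ∀ a b c r, f (((a ⊗ₜ b) ⊗ₜ c) ⊗ₜ r) = g (((a ⊗ₜ b) ⊗ₜ c) ⊗ₜ r))
    (t : ThreeTensor V ⊗[ℂ] ThreeLoc) : f t = g t := by
  have : f = g := TensorProduct.ext_fourfold h
  rw [this]

theorem exchangeOneTwo_exchangeOneTwo (t : ThreeTensor V ⊗[ℂ] ThreeLoc) :
    exchangeOneTwo V (exchangeOneTwo V t) = t := by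
  refine threeTensorLoc_hom_ext (f := exchangeOneTwo V ∘ₗ exchangeOneTwo V) (g := LinearMap.id)
    (fun a b c r => ?_) t
  change ((a ⊗ₜ b) ⊗ₜ c) ⊗ₜ permLoc _ (permLoc _ r) = ((a ⊗ₜ[ℂ] b) ⊗ₜ[ℂ] c) ⊗ₜ[ℂ] r
  rw [← permLoc_mul, Equiv.swap_mul_self, permLoc_one]

theorem exchangeTwoThree_exchangeTwoThree (t : ThreeTensor V ⊗[ℂ] ThreeLoc) :
    exchangeTwoThree V (exchangeTwoThree V t) = t := by
  refine threeTensorLoc_hom_ext (f := exchangeTwoThree V ∘ₗ exchangeTwoThree V)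
    (g := LinearMap.id) (fun a b c r => ?_) t
  change ((a ⊗ₜ b) ⊗ₜ c) ⊗ₜ permLoc _ (permLoc _ r) = ((a ⊗ₜ[ℂ] b) ⊗ₜ[ℂ] c) ⊗ₜ[ℂ] r
  rw [← permLoc_mul, Equiv.swap_mul_self, permLoc_one]

theorem permLoc_braid (x : ThreeLoc) :
    permLoc (Equiv.swap 0 1) (permLoc (Equiv.swap 1 2) (permLoc (Equiv.swap 0 1) x)) =
      permLoc (Equiv.swap 1 2) (permLoc (Equiv.swap 0 1) (permLoc (Equiv.swap 1 2) x)) := by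
  simp only [← permLoc_mul]
  congr 2
  decide

theorem exchange_braid (t : ThreeTensor V ⊗[ℂ] ThreeLoc) :
    exchangeOneTwo V (exchangeTwoThree V (exchangeOneTwo V t)) =
      exchangeTwoThree V (exchangeOneTwo V (exchangeTwoThree V t)) := by
  refine threeTensorLoc_hom_ext
    (f := exchangeOneTwo V ∘ₗ exchangeTwoThree V ∘ₗ exchangeOneTwo V)
    (g := exchangeTwoThree V ∘ₗ exchangeOneTwo V ∘ₗ exchangeTwoThree V)
    (fun a b c r => ?_) t
  change ((c ⊗ₜ b) ⊗ₜ a) ⊗ₜ permLoc _ (permLoc _ (permLoc _ r)) =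
    ((c ⊗ₜ[ℂ] b) ⊗ₜ[ℂ] a) ⊗ₜ[ℂ] permLoc _ (permLoc _ (permLoc _ r))
  rw [permLoc_braid]

variable (S : V ⊗[ℂ] V →ₗ[ℂ] TwoTensorLaurent V)

/-- `S₁₂(x₁ - x₂)` on `V ⊗ V ⊗ V ⊗ ThreeLoc`. -/
def operatorOneTwo : ThreeTensor V ⊗[ℂ] ThreeLoc →ₗ[ℂ] ThreeTensor V ⊗[ℂ] ThreeLoc :=
  extendScalars (legOneTwo S diffOneTwo)

/-- `S₁₃(x₁ - x₃)` on `V ⊗ V ⊗ V ⊗ ThreeLoc`. -/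
def operatorOneThree : ThreeTensor V ⊗[ℂ] ThreeLoc →ₗ[ℂ] ThreeTensor V ⊗[ℂ] ThreeLoc :=
  extendScalars (legOneThree S diffOneThree)

/-- `S₂₃(x₂ - x₃)` on `V ⊗ V ⊗ V ⊗ ThreeLoc`. -/
def operatorTwoThree : ThreeTensor V ⊗[ℂ] ThreeLoc →ₗ[ℂ] ThreeTensor V ⊗[ℂ] ThreeLoc :=
  extendScalars (legTwoThree S diffTwoThree)

theorem permLocLinear_comp_laurentDiffLinear (σ : Equiv.Perm (Fin 3)) {i j i' j' : Fin 3}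
    (h : i ≠ j) (h' : i' ≠ j') (hi : σ i = i') (hj : σ j = j') :
    permLocLinear σ ∘ₗ laurentDiffLinear h = laurentDiffLinear h' := by
  subst hi hj
  ext f
  exact permLoc_laurentDiff σ h f

/-- The exchange of the last two factors and variables conjugates `S₁₂(x₁-x₂)` to `S₁₃(x₁-x₃)`. -/
theorem operatorOneTwo_exchangeTwoThree (x : ThreeTensor V ⊗[ℂ] ThreeLoc) :
    operatorOneTwo S (exchangeTwoThree V x) = exchangeTwoThree V (operatorOneThree S x) := by
  refine (map_extendScalars (map_mul (permLoc _)) (fun t => ?_) x).symm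
  have h1 : permLocLinear (Equiv.swap 1 2) ∘ₗ diffOneThree = diffOneTwo :=
    permLocLinear_comp_laurentDiffLinear _ _ _ (by decide) (by decide)
  rw [← h1, ← lTensor_legOneTwo]
  change TensorProduct.map (flipTwoThree V) (permLocLinear (Equiv.swap 1 2))
    (LinearMap.rTensor _ (flipTwoThree V) (legOneTwo S diffOneThree (flipTwoThree V t))) = _
  generalize legOneTwo S diffOneThree (flipTwoThree V t) = y
  refine threeTensorLoc_hom_ext (f := TensorProduct.map (flipTwoThree V)
    (permLocLinear (Equiv.swap 1 2)) ∘ₗ LinearMap.rTensor _ (flipTwoThree V)) (fun a b c r => ?_) y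
  rfl

/-- The exchange of the first two factors and variables conjugates `S₁₃(x₁-x₃)` to `S₂₃(x₂-x₃)`. -/
theorem operatorOneThree_exchangeOneTwo (x : ThreeTensor V ⊗[ℂ] ThreeLoc) :
    operatorOneThree S (exchangeOneTwo V x) = exchangeOneTwo V (operatorTwoThree S x) := by
  refine (map_extendScalars (map_mul (permLoc _)) (fun t => ?_) x).symm
  have h1 : permLocLinear (Equiv.swap 0 1) ∘ₗ diffTwoThree = diffOneThree :=
    permLocLinear_comp_laurentDiffLinear _ _ _ (by decide) (by decide)
  refine threeTensor_hom_ext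
    (f := TensorProduct.map (flipOneTwo V) (permLocLinear (Equiv.swap 0 1)) ∘ₗ
      legTwoThree S diffTwoThree)
    (g := legOneThree S diffOneThree ∘ₗ flipOneTwo V) (fun a b c => ?_) t
  rw [LinearMap.comp_apply, LinearMap.comp_apply, legTwoThree_tmul]
  change _ = legOneThree S diffOneThree ((b ⊗ₜ a) ⊗ₜ c)
  rw [legOneThree_tmul, ← h1]
  generalize S (b ⊗ₜ c) = y
  exact twoTensorLaurent_hom_ext
    (f := TensorProduct.map (flipOneTwo V) (permLocLinear (Equiv.swap 0 1)) ∘ₗ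
      insertLeft diffTwoThree a)
    (g := LinearMap.rTensor _ (TensorProduct.rightComm ℂ V V V).toLinearMap ∘ₗ
      insertRight (permLocLinear (Equiv.swap 0 1) ∘ₗ diffTwoThree) a) (fun _ _ _ => rfl) y

/-- The exchange of the first two factors and variables conjugates `S(x₁-x₂)` to `S₂₁(x₂-x₁)`. -/
theorem exchangeOneTwo_operatorOneTwo (x : ThreeTensor V ⊗[ℂ] ThreeLoc) :
    exchangeOneTwo V (operatorOneTwo S x) = operatorOneTwo (opposite S) (exchangeOneTwo V x) := by
  refine map_extendScalars (map_mul (permLoc _)) (fun t => ?_) x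
  have h1 : permLocLinear (Equiv.swap 0 1) ∘ₗ diffOneTwo = diffOneTwo ∘ₗ negVar := by
    rw [permLocLinear_comp_laurentDiffLinear (Equiv.swap 0 1) zero_ne_one_three
      zero_ne_one_three.symm (by decide) (by decide)]
    ext f
    exact (laurentDiff_negVar zero_ne_one_three f).symm
  refine threeTensor_hom_ext
    (f := TensorProduct.map (flipOneTwo V) (permLocLinear (Equiv.swap 0 1)) ∘ₗ
      legOneTwo S diffOneTwo)
    (g := legOneTwo (opposite S) diffOneTwo ∘ₗ flipOneTwo V) (fun a b c => ?_) t
  rw [LinearMap.comp_apply, LinearMap.comp_apply, legOneTwo_tmul]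
  change _ = legOneTwo (opposite S) diffOneTwo ((b ⊗ₜ a) ⊗ₜ c)
  rw [legOneTwo_tmul]
  change _ = insertRight diffOneTwo c
    (TensorProduct.map (TensorProduct.comm ℂ V V).toLinearMap negVar (S (a ⊗ₜ b)))
  generalize S (a ⊗ₜ b) = y
  refine twoTensorLaurent_hom_ext
    (f := TensorProduct.map (flipOneTwo V) (permLocLinear (Equiv.swap 0 1)) ∘ₗ
      insertRight diffOneTwo c)
    (g := insertRight diffOneTwo c ∘ₗ
      TensorProduct.map (TensorProduct.comm ℂ V V).toLinearMap negVar) (fun p q f => ?_) y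
  exact congrArg (fun r => ((q ⊗ₜ[ℂ] p) ⊗ₜ[ℂ] c) ⊗ₜ[ℂ] r) (DFunLike.congr_fun h1 f)

end Exchange

/-- Inserting a nonzero vector as the third tensor factor loses no information. -/
theorem insertRight_injective {V : Type u} [AddCommGroup V] [Module ℂ V] {R : Type*}
    [AddCommGroup R] [Module ℂ R] {σ : LaurentSeries ℂ →ₗ[ℂ] R} (hσ : Function.Injective σ)
    {c : V} (hc : c ≠ 0) : Function.Injective (insertRight σ c) := by
  have h1 : Function.Injective ((TensorProduct.mk ℂ (V ⊗[ℂ] V) V).flip c) := by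
    obtain ⟨φ, hφ⟩ := Module.Projective.exists_dual_eq_one ℂ hc
    refine Function.LeftInverse.injective
      (g := TensorProduct.rid ℂ (V ⊗[ℂ] V) ∘ LinearMap.lTensor (V ⊗[ℂ] V) φ) fun x => ?_
    simp [hφ]
  obtain ⟨f, hf⟩ := LinearMap.exists_leftInverse_of_injective _ (LinearMap.ker_eq_bot.mpr h1)
  obtain ⟨g, hg⟩ := LinearMap.exists_leftInverse_of_injective _ (LinearMap.ker_eq_bot.mpr hσ)
  refine Function.LeftInverse.injective (g := TensorProduct.map f g) fun x => ?_
  rw [← LinearMap.comp_apply, insertRight, ← TensorProduct.map_comp, hf, hg,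
    TensorProduct.map_id, LinearMap.id_apply]

/-! ### Specialization of the operators to `ℂ((x))((z))` -/

section Specialization

/-- Multiplicativity of `specLocLinear`, for the multiplication of `TwoVarLaurent` that comes from its
structure of a commutative ring. -/
theorem specLocLinear_ring_mul (x y : ThreeLoc) :
    specLocLinear (x * y) = (inferInstance : CommRing TwoVarLaurent).toMul.mul
      (specLocLinear x) (specLocLinear y) :=
  map_mul specLoc x y

theorem lTensor_specLocLinear_extendScalars {V : Type u} [AddCommGroup V] [Module ℂ V]
    {T : ThreeTensor V →ₗ[ℂ] ThreeTensor V ⊗[ℂ] ThreeLoc}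
    {T' : ThreeTensor V →ₗ[ℂ] ThreeTensor V ⊗[ℂ] TwoVarLaurent}
    (h : ∀ t, LinearMap.lTensor _ specLocLinear (T t) = T' t) (x : ThreeTensor V ⊗[ℂ] ThreeLoc) :
    LinearMap.lTensor _ specLocLinear (extendScalars T x) =
      extendScalars (R := TwoVarLaurent) T' (LinearMap.lTensor _ specLocLinear x) := by
  have h1 := lTensor_extendScalars (R' := TwoVarLaurent) (s := specLocLinear)
    specLocLinear_ring_mul (T := T) (T' := T') (by intro t; exact h t) x
  exact h1

theorem specLocLinear_comp_diffOneTwo : specLocLinear ∘ₗ diffOneTwo = inX :=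
  LinearMap.ext (specLoc_laurentDiff_zero_one zero_ne_one_three)

theorem specLocLinear_comp_diffTwoThree : specLocLinear ∘ₗ diffTwoThree = inZ :=
  LinearMap.ext (specLoc_laurentDiff_one_two one_ne_two_three)

theorem specLocLinear_comp_diffOneThree : specLocLinear ∘ₗ diffOneThree = inXplusZ :=
  LinearMap.ext (specLoc_laurentDiff_zero_two zero_ne_two_three)

variable {V : Type u} [AddCommGroup V] [Module ℂ V] (S : V ⊗[ℂ] V →ₗ[ℂ] TwoTensorLaurent V)

theorem leg12_inX (t : ThreeTensor V) :
    LinearMap.lTensor _ specLocLinear (legOneTwo S diffOneTwo t) = leg12 S inX t := by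
  rw [lTensor_legOneTwo, specLocLinear_comp_diffOneTwo]
  rfl

theorem leg13_inXplusZ (t : ThreeTensor V) :
    LinearMap.lTensor _ specLocLinear (legOneThree S diffOneThree t) = leg13 S inXplusZ t := by
  rw [lTensor_legOneThree, specLocLinear_comp_diffOneThree]
  rfl

theorem leg23_inZ (t : ThreeTensor V) :
    LinearMap.lTensor _ specLocLinear (legTwoThree S diffTwoThree t) = leg23 S inZ t := by
  rw [lTensor_legTwoThree, specLocLinear_comp_diffTwoThree]
  rfl

end Specialization

/-! ### Unitarity and the quantum Yang–Baxter equation -/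

section Correlators

variable {V : Type u} [AddCommGroup V] [Module ℂ V] {A : VertexData V}
  (hA : A.IsWeakQuantumVertexAlgebra)

/-- Exchanging the first two operators in a correlator. -/
theorem VertexData.corr_left {a b : V} {s : TwoTensorLaurent V} (h : A.SJacobi a b s)
    (μ : V →ₗ[ℂ] ℂ) (c : V) : VertexData.corr hA μ ((a ⊗ₜ b) ⊗ₜ c) =
      permLoc (Equiv.swap 0 1) (VertexData.corrExt hA μ (insertRight diffOneTwo c s)) := by
  obtain ⟨n, b', a', f, rfl, p, hp⟩ := h.locality
  obtain ⟨G, hGf, hG⟩ := hp p le_rfl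
  have h1 := VertexData.permuted_left hG μ c
  simp only [← VertexData.threePointLinear_tmul, ← VertexData.locToIter_corr hA] at h1
  rw [eq_permLoc_of_permuted_mul zero_ne_one_three p hGf h1]
  simp only [map_sum, map_mul, insertRight_tmul, VertexData.corrExt_tmul, laurentDiffLinear_apply]
  exact Finset.sum_congr rfl fun k _ => mul_comm _ _

/-- Exchanging the last two operators in a correlator. -/
theorem VertexData.corr_right {b c : V} {s : TwoTensorLaurent V} (h : A.SJacobi b c s)
    (μ : V →ₗ[ℂ] ℂ) (a : V) : VertexData.corr hA μ ((a ⊗ₜ b) ⊗ₜ c) =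
      permLoc (Equiv.swap 1 2) (VertexData.corrExt hA μ (insertLeft diffTwoThree a s)) := by
  obtain ⟨n, c', b', f, rfl, p, hp⟩ := h.locality
  obtain ⟨G, hGf, hG⟩ := hp p le_rfl
  have h1 := VertexData.permuted_right hG μ a
  simp only [← VertexData.threePointLinear_tmul, ← VertexData.locToIter_corr hA] at h1
  rw [eq_permLoc_of_permuted_mul one_ne_two_three p hGf h1]
  simp only [map_sum, map_mul, insertLeft_tmul, VertexData.corrExt_tmul, laurentDiffLinear_apply]
  exact Finset.sum_congr rfl fun k _ => mul_comm _ _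

variable {S : V ⊗[ℂ] V →ₗ[ℂ] TwoTensorLaurent V} (hS : ∀ a b : V, A.SJacobi a b (S (b ⊗ₜ a)))
include hS

/-- `VertexData.corr_left` for the `ThreeLoc`-linear extensions. -/
theorem VertexData.corrExt_exchangeOneTwo (μ : V →ₗ[ℂ] ℂ) (x : ThreeTensor V ⊗[ℂ] ThreeLoc) :
    VertexData.corrExt hA μ (exchangeOneTwo V x) =
      permLoc (Equiv.swap 0 1) (VertexData.corrExt hA μ (operatorOneTwo S x)) := by
  refine threeTensorLoc_hom_ext (f := VertexData.corrExt hA μ ∘ₗ exchangeOneTwo V)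
    (g := permLocLinear (Equiv.swap 0 1) ∘ₗ VertexData.corrExt hA μ ∘ₗ operatorOneTwo S)
    (fun b a c r => ?_) x
  change VertexData.corr hA μ ((a ⊗ₜ b) ⊗ₜ c) * permLoc (Equiv.swap 0 1) r =
    permLoc (Equiv.swap 0 1) (VertexData.corrExt hA μ
      (extendScalars (legOneTwo S diffOneTwo) (((b ⊗ₜ a) ⊗ₜ c) ⊗ₜ r)))
  rw [VertexData.corr_left hA (hS a b), extendScalars_tmul, legOneTwo_tmul, ← map_mul]
  generalize insertRight diffOneTwo c (S (b ⊗ₜ a)) = y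
  congr 1
  refine threeTensorLoc_hom_ext
    (f := (LinearMap.mul ℂ ThreeLoc).flip r ∘ₗ VertexData.corrExt hA μ)
    (g := VertexData.corrExt hA μ ∘ₗ LinearMap.lTensor _ ((LinearMap.mul ℂ ThreeLoc).flip r))
    (fun a b c r' => ?_) y
  exact mul_assoc (VertexData.corr hA μ ((a ⊗ₜ b) ⊗ₜ c)) r' r

/-- `VertexData.corr_right` for the `ThreeLoc`-linear extensions. -/
theorem VertexData.corrExt_exchangeTwoThree (μ : V →ₗ[ℂ] ℂ) (x : ThreeTensor V ⊗[ℂ] ThreeLoc) :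
    VertexData.corrExt hA μ (exchangeTwoThree V x) =
      permLoc (Equiv.swap 1 2) (VertexData.corrExt hA μ (operatorTwoThree S x)) := by
  refine threeTensorLoc_hom_ext (f := VertexData.corrExt hA μ ∘ₗ exchangeTwoThree V)
    (g := permLocLinear (Equiv.swap 1 2) ∘ₗ VertexData.corrExt hA μ ∘ₗ operatorTwoThree S)
    (fun a c b r => ?_) x
  change VertexData.corr hA μ ((a ⊗ₜ b) ⊗ₜ c) * permLoc (Equiv.swap 1 2) r =
    permLoc (Equiv.swap 1 2) (VertexData.corrExt hA μ
      (extendScalars (legTwoThree S diffTwoThree) (((a ⊗ₜ c) ⊗ₜ b) ⊗ₜ r)))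
  rw [VertexData.corr_right hA (hS b c), extendScalars_tmul, legTwoThree_tmul, ← map_mul]
  generalize insertLeft diffTwoThree a (S (c ⊗ₜ b)) = y
  congr 1
  refine threeTensorLoc_hom_ext
    (f := (LinearMap.mul ℂ ThreeLoc).flip r ∘ₗ VertexData.corrExt hA μ)
    (g := VertexData.corrExt hA μ ∘ₗ LinearMap.lTensor _ ((LinearMap.mul ℂ ThreeLoc).flip r))
    (fun a b c r' => ?_) y
  exact mul_assoc (VertexData.corr hA μ ((a ⊗ₜ b) ⊗ₜ c)) r' r

variable (hsep : ∀ x y : ThreeTensor V ⊗[ℂ] ThreeLoc,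
  (∀ μ, VertexData.corrExt hA μ x = VertexData.corrExt hA μ y) → x = y)
include hsep

/-- Exchanging two operators twice does not change a correlator. -/
theorem VertexData.operator_unitary (x : ThreeTensor V ⊗[ℂ] ThreeLoc) :
    operatorOneTwo (opposite S) (operatorOneTwo S x) = x := by
  have h : ∀ y, operatorOneTwo S (exchangeOneTwo V (operatorOneTwo S (exchangeOneTwo V y))) = y :=
    fun y => by
    apply hsep
    intro μ
    apply permLoc_injective (Equiv.swap 0 1)
    rw [← VertexData.corrExt_exchangeOneTwo hA hS, exchangeOneTwo_exchangeOneTwo]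
    apply permLoc_injective (Equiv.swap 0 1)
    rw [← VertexData.corrExt_exchangeOneTwo hA hS, exchangeOneTwo_exchangeOneTwo, ← permLoc_mul,
      Equiv.swap_mul_self, permLoc_one]
  have h1 := congrArg (exchangeOneTwo V) (h (exchangeOneTwo V x))
  rw [exchangeOneTwo_exchangeOneTwo, exchangeOneTwo_operatorOneTwo,
    exchangeOneTwo_exchangeOneTwo] at h1
  exact h1

/-- The order of three operators in a correlator can be reversed by transpositions in two ways. -/
theorem VertexData.operator_yangBaxter (x : ThreeTensor V ⊗[ℂ] ThreeLoc) :
    operatorOneTwo S (operatorOneThree S (operatorTwoThree S x)) =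
      operatorTwoThree S (operatorOneThree S (operatorOneTwo S x)) := by
  have h13 : ∀ y, operatorOneThree S (exchangeTwoThree V y) =
      exchangeTwoThree V (operatorOneTwo S y) := fun y => by
    have := congrArg (exchangeTwoThree V) (operatorOneTwo_exchangeTwoThree S (exchangeTwoThree V y))
    rw [exchangeTwoThree_exchangeTwoThree, exchangeTwoThree_exchangeTwoThree] at this
    exact this.symm
  have h23 : ∀ y, operatorTwoThree S (exchangeOneTwo V y) =
      exchangeOneTwo V (operatorOneThree S y) := fun y => by
    have := congrArg (exchangeOneTwo V) (operatorOneThree_exchangeOneTwo S (exchangeOneTwo V y))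
    rw [exchangeOneTwo_exchangeOneTwo, exchangeOneTwo_exchangeOneTwo] at this
    exact this.symm
  apply hsep
  intro μ
  -- both sides compute the effect of reversing the order of the three operators in a correlator
  have h1 : VertexData.corrExt hA μ (exchangeOneTwo V (exchangeTwoThree V (exchangeOneTwo V x))) =
      permLoc (Equiv.swap 0 1) (permLoc (Equiv.swap 1 2) (permLoc (Equiv.swap 0 1)
        (VertexData.corrExt hA μ
          (operatorOneTwo S (operatorOneThree S (operatorTwoThree S x)))))) := by
    rw [VertexData.corrExt_exchangeOneTwo hA hS, operatorOneTwo_exchangeTwoThree,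
      VertexData.corrExt_exchangeTwoThree hA hS, operatorOneThree_exchangeOneTwo, h23,
      VertexData.corrExt_exchangeOneTwo hA hS]
  have h2 : VertexData.corrExt hA μ (exchangeTwoThree V (exchangeOneTwo V (exchangeTwoThree V x))) =
      permLoc (Equiv.swap 1 2) (permLoc (Equiv.swap 0 1) (permLoc (Equiv.swap 1 2)
        (VertexData.corrExt hA μ
          (operatorTwoThree S (operatorOneThree S (operatorOneTwo S x)))))) := by
    rw [VertexData.corrExt_exchangeTwoThree hA hS, h23,
      VertexData.corrExt_exchangeOneTwo hA hS, h13, operatorOneTwo_exchangeTwoThree,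
      VertexData.corrExt_exchangeTwoThree hA hS]
  rw [← exchange_braid, h1, permLoc_braid] at h2
  exact permLoc_injective _ (permLoc_injective _ (permLoc_injective _ h2))

/-- Unitarity of `S`, from that of its action on `V ⊗ V ⊗ 𝟏`. -/
theorem VertexData.isUnitaryOperator (hvac : A.vac ≠ 0) : IsUnitaryOperator S := by
  intro t
  apply insertRight_injective (σ := diffOneTwo) (laurentDiff_injective zero_ne_one_three) hvac
  have h := VertexData.operator_unitary hA hS hsep ((t ⊗ₜ A.vac) ⊗ₜ 1)
  have h1 : operatorOneTwo S ((t ⊗ₜ A.vac) ⊗ₜ 1) = insertRight diffOneTwo A.vac (S t) := by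
    rw [operatorOneTwo, extendScalars_tmul_one, legOneTwo_tmul]
  rw [h1] at h
  refine (map_extendScalars (T' := legOneTwo (opposite S) diffOneTwo)
    (map_mul (laurentDiff zero_ne_one_three))
    (fun t => (legOneTwo_tmul (opposite S) diffOneTwo t A.vac).symm) (S t)).trans (h.trans ?_)
  rw [insertRight_tmul]
  congr 1
  exact (map_one (laurentDiff zero_ne_one_three)).symm

/-- The Yang–Baxter equation for `S`, by the specialization `x₁ = x + z`, `x₂ = z`, `x₃ = 0`. -/
theorem VertexData.isYangBaxterOperator : IsYangBaxterOperator S := by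
  have h12 : ∀ x, LinearMap.lTensor _ specLocLinear (operatorOneTwo S x) =
      extendScalars (R := TwoVarLaurent) (leg12 S inX) (LinearMap.lTensor _ specLocLinear x) := by
    intro x
    exact lTensor_specLocLinear_extendScalars (leg12_inX S) x
  have h13 : ∀ x, LinearMap.lTensor _ specLocLinear (operatorOneThree S x) =
      extendScalars (R := TwoVarLaurent) (leg13 S inXplusZ) (LinearMap.lTensor _ specLocLinear x) := by
    intro x
    exact lTensor_specLocLinear_extendScalars (leg13_inXplusZ S) x
  have h23 : ∀ x, LinearMap.lTensor _ specLocLinear (operatorTwoThree S x) =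
      extendScalars (R := TwoVarLaurent) (leg23 S inZ) (LinearMap.lTensor _ specLocLinear x) := by
    intro x
    exact lTensor_specLocLinear_extendScalars (leg23_inZ S) x
  refine LinearMap.ext fun t => ?_
  have e12 : operatorOneTwo S (t ⊗ₜ 1) = legOneTwo S diffOneTwo t := extendScalars_tmul_one _ t
  have e23 : operatorTwoThree S (t ⊗ₜ 1) = legTwoThree S diffTwoThree t := extendScalars_tmul_one _ t
  have h := congrArg (LinearMap.lTensor _ specLocLinear)
    (VertexData.operator_yangBaxter hA hS hsep (t ⊗ₜ 1))
  rw [e12, e23, h12, h13, h23, h13, leg12_inX, leg23_inZ] at h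
  exact h

end Correlators

/-! ### Existence and uniqueness of the quantum Yang–Baxter operator -/

section Existence

variable {V : Type u} [AddCommGroup V] [Module ℂ V] {A : VertexData V}
  (hA : A.IsWeakQuantumVertexAlgebra)
  (hsep : ∀ x y : ThreeTensor V ⊗[ℂ] ThreeLoc,
    (∀ μ, VertexData.corrExt hA μ x = VertexData.corrExt hA μ y) → x = y) (hvac : A.vac ≠ 0)
include hsep hvac

/-- The tensor in the `𝒮`-Jacobi identity for two vectors is unique. -/
theorem VertexData.SJacobi.unique {a b : V} {s s' : TwoTensorLaurent V} (h : A.SJacobi a b s)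
    (h' : A.SJacobi a b s') : s = s' := by
  apply insertRight_injective (σ := diffOneTwo) (laurentDiff_injective zero_ne_one_three) hvac
  apply hsep
  intro μ
  apply permLoc_injective (Equiv.swap 0 1)
  exact (VertexData.corr_left hA h μ A.vac).symm.trans (VertexData.corr_left hA h' μ A.vac)

/-- The tensors in the `𝒮`-Jacobi identities for pairs of vectors depend linearly on the pairs. -/
theorem VertexData.exists_linear_sJacobi : ∃ S : V ⊗[ℂ] V →ₗ[ℂ] TwoTensorLaurent V,
    ∀ a b : V, A.SJacobi a b (S (b ⊗ₜ a)) := by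
  let Ψ : TwoTensorLaurent V →ₗ[ℂ] ((V →ₗ[ℂ] ℂ) → ThreeLoc) := LinearMap.pi fun μ =>
    permLocLinear (Equiv.swap 0 1) ∘ₗ VertexData.corrExt hA μ ∘ₗ insertRight diffOneTwo A.vac
  let Ω : V ⊗[ℂ] V →ₗ[ℂ] ((V →ₗ[ℂ] ℂ) → ThreeLoc) := LinearMap.pi fun μ =>
    VertexData.corr hA μ ∘ₗ (TensorProduct.mk ℂ (V ⊗[ℂ] V) V).flip A.vac ∘ₗ
      (TensorProduct.comm ℂ V V).toLinearMap
  have hΨ : Function.Injective Ψ := by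
    intro s s' h
    apply insertRight_injective (σ := diffOneTwo) (laurentDiff_injective zero_ne_one_three) hvac
    apply hsep
    intro μ
    exact permLoc_injective (Equiv.swap 0 1) (congrFun h μ)
  have hΩ : ∀ a b s, A.SJacobi a b s → Ω (b ⊗ₜ a) = Ψ s := fun a b s h =>
    funext fun μ => VertexData.corr_left hA h μ A.vac
  obtain ⟨Θ, hΘ⟩ := LinearMap.exists_leftInverse_of_injective Ψ (LinearMap.ker_eq_bot.mpr hΨ)
  refine ⟨Θ ∘ₗ Ω, fun a b => ?_⟩
  obtain ⟨s, hs⟩ := hA.sJacobi a b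
  -- the range of `Ω` lies in that of the injective map `Ψ`, so that `Θ ∘ Ω` solves `Ψ S = Ω`
  have : (Θ ∘ₗ Ω) (b ⊗ₜ a) = s := by
    rw [LinearMap.comp_apply, hΩ a b s hs, ← LinearMap.comp_apply, hΘ, LinearMap.id_apply]
  rw [this]
  exact hs

theorem VertexData.existsUnique_isQuantumVertexAlgebra :
    ∃! S : V ⊗[ℂ] V →ₗ[ℂ] TwoTensorLaurent V, A.IsQuantumVertexAlgebra S := by
  obtain ⟨S, hS⟩ := VertexData.exists_linear_sJacobi hA hsep hvac
  refine ⟨S, ⟨hA, VertexData.isUnitaryOperator hA hS hsep hvac,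
    VertexData.isYangBaxterOperator hA hS hsep, hS⟩, fun S' hS' => ?_⟩
  exact TensorProduct.ext' fun b a =>
    VertexData.SJacobi.unique hA hsep hvac (hS'.sJacobi a b) (hS a b)

end Existence

end QVA

end

theorem corollary3p17 {V : Type*} [AddCommGroup V] [Module ℂ V] (A : QVA.VertexData V)
    (hA : A.IsWeakQuantumVertexAlgebra) (hdim : Module.rank ℂ V ≤ Cardinal.aleph0)
    (E : ℤ → Submodule ℂ V) (hE : A.IsFiltration E)
    {U : Type*} [AddCommGroup U] [Module ℂ U]
    (hiso : Nonempty (QVA.VertexIso (QVA.grData hE) (QVA.FCD.data U))) :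
    A.Nondegenerate ∧
      ∃! S : TensorProduct ℂ V V →ₗ[ℂ] QVA.TwoTensorLaurent V, A.IsQuantumVertexAlgebra S := by
  obtain ⟨e⟩ := hiso
  obtain ⟨ι, b, hb⟩ := QVA.exists_basis_linearIndependent hE e
  exact ⟨QVA.VertexData.nondegenerate_of_basis A b hb,
    QVA.VertexData.existsUnique_isQuantumVertexAlgebra hA
      (fun _ _ h => QVA.VertexData.eq_of_corrExt hA b (hb 3) h) (QVA.vac_ne_zero hE e)⟩
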